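/- **Model.** Let $n\ge 0$ and $T\ge 1$. Agent $0$ is the major agent and $i\in N=\{1,\dots,n\}$ are the minor agents. Agent $i$ has state $x_i(t)\in\mathbb R^{d^i_x}$ and control $u_i(t)\in\mathbb R^{d^i_u}$; put $x=\mathrm{vec}(x_0,\dots,x_n)$, $u=\mathrm{vec}(u_0,\dots,u_n)$, $w=\mathrm{vec}(w_0,\dots,w_n)$. The dynamics are $x(t+1)=Ax(t)+Bu(t)+w(t)$, where the only possibly nonzero blocks of $A$ and $B$ are $A_{i0},A_{ii},B_{i0},B_{ii}$ ($0\le i\le n$), and minor agent $i$ has the output $y_i(t)=C_{ii}x_i(t)+v_i(t)\in\mathbb R^{d_y^i}$. The initial states $x_i(1)$, the process noises $w_i(t)$ and the observation noises $v_i(t)$, $1\le t\le T$, are independent, with zero mean and finite variance. The information of the agents is $$I_0(t)=I^c(t)=\{x_0(1{:}t),u_0(1{:}t-1)\},\qquad I_i(t)=\{x_0(1{:}t),y_i(1{:}t),u_0(1{:}t-1),u_i(1{:}t-1)\}\ (i\in N).$$ A (general) strategy $g$ consists of measurable control laws, $u_i(t)=g_{i,t}(I_i(t))$, $0\le i\le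 n$. Its cost is $$J(g)=\mathbb E\Big[\sum_{t=1}^{T-1}\big(x(t)^{\top}Qx(t)+u(t)^{\top}Ru(t)\big)+x(T)^{\top}Q_Tx(T)\Big]\in[0,\infty],$$ with $Q,Q_T$ symmetric positive semidefinite and $R$ symmetric positive definite; $g$ is optimal if it minimizes $J$ over all strategies. **Gains.** Let $\mathcal R(P,A,B,Q,R)=Q+A^{\top}PA-A^{\top}PB(R+B^{\top}PB)^{-1}B^{\top}PA$ and $\mathcal G(P,A,B,R)=(R+B^{\top}PB)^{-1}B^{\top}PA$. Put $S^c(T)=Q_T$, $S^\ell_i(T)=[Q_T]_{ii}$ and, for $t=T-1,\dots,1$, $$S^c(t)=\mathcal R(S^c(t+1),A,B,Q,R),\qquad S^\ell_i(t)=\mathcal R(S^\ell_i(t+1),A_{ii},B_{ii},Q_{ii},R_{ii}),$$ $$L^c(t)=\mathcal G(S^c(t+1),A,B,R),\qquad L^\ell_i(t)=\mathcal G(S^\ell_i(t+1),A_{ii},B_{ii},R_{ii}),$$ and let $L^c_i(t)$ be the $i$-th block row of $L^c(t)$. For a given strategy put $\hat x(t|c)=\mathbb E[x(t)\mid I^c(t)]$,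 $\hat x(t|i)=\mathbb E[x(t)\mid I_i(t)]$, $u^c(t)=\mathbb E[u(t)\mid I^c(t)]$, and let the subscript $i$ denote the $i$-th component of these vectors. **Theorem.** 1. *Optimal strategy.* An optimal strategy exists. A strategy is optimal if and only if, almost surely for all $1\le t\le T-1$, $$u_0(t)=-L^c_0(t)\,\hat x(t|c),\qquad u_i(t)=-L^c_i(t)\,\hat x(t|c)-L^\ell_i(t)\big(\hat x_i(t|i)-\hat x_i(t|c)\big)\quad(i\in N).$$ An optimal strategy has finite cost, $\mathbb E\|u(t)\|^2<\infty$ and $u^c(t)=-L^c(t)\hat x(t|c)$ a.s. for $1\le t\le T-1$. The optimal strategy is unique: for two optimal strategies $g,g'$ and $1\le t\le T-1$, the control actions agree almost surely, and $g_{i,t}=g'_{i,t}$ almost everywhere with respect to the law of $I_i(t)$, $0\le i\le n$. 2. *Major agent's estimate.* For every strategy with integrable control actions at the times $1,\dots,T-1$ one has, almost surely, $\hat x(1|c)=\mathrm{vec}(x_0(1),0,\dots,0)$ and, for $1\le t\le T-1$, $$\hat x(t+1|c)=A\begin{bmatrix}x_0(t)\\ \hat x_1(t|c)\\ \vdots\\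 \hat x_n(t|c)\end{bmatrix}+B\begin{bmatrix}u_0(t)\\ u^c_1(t)\\ \vdots\\ u^c_n(t)\end{bmatrix}+\begin{bmatrix}w_0(t)\\0\\ \vdots\\0\end{bmatrix},\qquad w_0(t)=x_0(t+1)-A_{00}x_0(t)-B_{00}u_0(t).$$ 3. *Minor agent's estimate.* For every strategy with integrable control actions at the times $1,\dots,T-1$, every $i\in N$ and $1\le t\le T$: if $f_{i,t}$ is a conditional density of $x_i(t)$ given $I_i(t)$, then almost surely $\hat x_i(t|i)=\int x\,f_{i,t}(x)\,dx$, where the integrand is integrable. 4. *Bayesian filter.* Let the strategy be arbitrary and $i\in N$. If $x_i(1)$ and $v_i(1)$ have densities $\xi_i$ and $\nu_i$, then $f_{i,1}(x)=\nu_i(y_i(1)-C_{ii}x)\,\xi_i(x)\big/\int\nu_i(y_i(1)-C_{ii}x')\,\xi_i(x')\,dx'$ is a conditional density of $x_i(1)$ given $I_i(1)$. If $2\le t\le T$, if $w_0(t-1)$, $w_i(t-1)$ and $v_i(t)$ have densities $\varphi_0$, $\varphi_i$ and $\nu_i$, and if $f_{i,t-1}$ is a conditional density of $x_i(t-1)$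 given $I_i(t-1)$, then $$f_{i,t}(x)=\frac{\beta_i(x)\int\gamma_i(x,x')\,\gamma_0\,f_{i,t-1}(x')\,dx'}{\int\beta_i(z)\int\gamma_i(z,x')\,\gamma_0\,f_{i,t-1}(x')\,dx'\,dz}$$ is a conditional density of $x_i(t)$ given $I_i(t)$, where $$\beta_i(x)=\nu_i\big(y_i(t)-C_{ii}x\big),\qquad \gamma_0=\varphi_0\big(x_0(t)-A_{00}x_0(t-1)-B_{00}u_0(t-1)\big),$$ $$\gamma_i(x,x')=\varphi_i\big(x-A_{ii}x'-A_{i0}x_0(t-1)-B_{ii}u_i(t-1)-B_{i0}u_0(t-1)\big).$$ In particular the update does not depend on the strategy. -/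

import Mathlib

open MeasureTheory ProbabilityTheory

open scoped ENNReal Matrix

noncomputable section

namespace MajorMinor

/-! ### Block vectors and matrices -/

/-- The vector `vec(x_0, …, x_n)` obtained by stacking the vectors `x_i ∈ ℝ^{d_i}`. -/
def stack {n : ℕ} {d : Fin (n + 1) → ℕ} (x : (i : Fin (n + 1)) → Fin (d i) → ℝ) :
    (Σ i, Fin (d i)) → ℝ :=
  fun p => x p.1 p.2

/-- The `i`-th component `x_i` of a stacked vector. -/
def comp {n : ℕ} {d : Fin (n + 1) → ℕ} (x : (Σ i, Fin (d i)) → ℝ) (i : Fin (n + 1)) :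
    Fin (d i) → ℝ :=
  fun k => x ⟨i, k⟩

/-- The vector `vec(a, b_1, …, b_n)`, with a major component `a` and minor components `b_i`. -/
def stackMM {n : ℕ} {d : Fin (n + 1) → ℕ} (a : Fin (d 0) → ℝ)
    (b : (i : Fin n) → Fin (d i.succ) → ℝ) : (Σ i, Fin (d i)) → ℝ :=
  stack (Fin.cons (α := fun i => Fin (d i) → ℝ) a b)

/-- The block `M_{ij}`. -/
def block {n : ℕ} {d e : Fin (n + 1) → ℕ}
    (M : Matrix (Σ i, Fin (d i)) (Σ i, Fin (e i)) ℝ) (i j : Fin (n + 1)) :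
    Matrix (Fin (d i)) (Fin (e j)) ℝ :=
  M.submatrix (fun k => ⟨i, k⟩) (fun k => ⟨j, k⟩)

/-- The block row `M_i`. -/
def blockRow {n : ℕ} {d e : Fin (n + 1) → ℕ}
    (M : Matrix (Σ i, Fin (d i)) (Σ i, Fin (e i)) ℝ) (i : Fin (n + 1)) :
    Matrix (Fin (d i)) (Σ i, Fin (e i)) ℝ :=
  M.submatrix (fun k => ⟨i, k⟩) id

/-! ### The Riccati and gain operators -/

/-- `Q + Aᵀ P A - Aᵀ P B (R + Bᵀ P B)⁻¹ Bᵀ P A`. -/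
def riccatiOp {X U : Type*} [Fintype X] [Fintype U] [DecidableEq U]
    (P A : Matrix X X ℝ) (B : Matrix X U ℝ) (Q : Matrix X X ℝ) (R : Matrix U U ℝ) :
    Matrix X X ℝ :=
  Q + Aᵀ * P * A - Aᵀ * P * B * (R + Bᵀ * P * B)⁻¹ * Bᵀ * P * A

/-- `(R + Bᵀ P B)⁻¹ Bᵀ P A`. -/
def gainOp {X U : Type*} [Fintype X] [Fintype U] [DecidableEq U]
    (P A : Matrix X X ℝ) (B : Matrix X U ℝ) (R : Matrix U U ℝ) : Matrix U X ℝ :=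
  (R + Bᵀ * P * B)⁻¹ * Bᵀ * P * A

/-- The backward Riccati recursion: the matrix that is reached `k` steps before the terminal
time, when the terminal value is `QT`. -/
def riccatiSeq {X U : Type*} [Fintype X] [Fintype U] [DecidableEq U]
    (A : Matrix X X ℝ) (B : Matrix X U ℝ) (Q : Matrix X X ℝ) (R : Matrix U U ℝ)
    (QT : Matrix X X ℝ) : ℕ → Matrix X X ℝ
  | 0 => QT
  | k + 1 => riccatiOp (riccatiSeq A B Q R QT k) A B Q R

/-! ### The system -/

/-- A linear quadratic system with one major agent (index `0`) and `n` minor agents. The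
minor agent `i : Fin n` has the index `i.succ` among all the agents. -/
structure System (n : ℕ) where
  /-- dimensions of the states -/
  dx : Fin (n + 1) → ℕ
  /-- dimensions of the control actions -/
  du : Fin (n + 1) → ℕ
  /-- dimensions of the outputs of the minor agents -/
  dy : Fin n → ℕ
  A : Matrix (Σ i, Fin (dx i)) (Σ i, Fin (dx i)) ℝ
  B : Matrix (Σ i, Fin (dx i)) (Σ i, Fin (du i)) ℝ
  C : (i : Fin n) → Matrix (Fin (dy i)) (Fin (dx i.succ)) ℝ
  Q : Matrix (Σ i, Fin (dx i)) (Σ i, Fin (dx i)) ℝ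
  QT : Matrix (Σ i, Fin (dx i)) (Σ i, Fin (dx i)) ℝ
  R : Matrix (Σ i, Fin (du i)) (Σ i, Fin (du i)) ℝ
  /-- only the blocks `A_{i0}` and `A_{ii}` can be nonzero -/
  A_sparse : ∀ i j, j ≠ 0 → j ≠ i → block A i j = 0
  /-- only the blocks `B_{i0}` and `B_{ii}` can be nonzero -/
  B_sparse : ∀ i j, j ≠ 0 → j ≠ i → block B i j = 0
  Q_posSemidef : Q.PosSemidef
  QT_posSemidef : QT.PosSemidef
  R_posDef : R.PosDef

namespace System

variable {n : ℕ} (S : System n)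

abbrev State : Type := (Σ i, Fin (S.dx i)) → ℝ

abbrev Control : Type := (Σ i, Fin (S.du i)) → ℝ

/-- The global Riccati matrix `S^c(t)`, `1 ≤ t ≤ T`. -/
def riccatiC (T t : ℕ) : Matrix (Σ i, Fin (S.dx i)) (Σ i, Fin (S.dx i)) ℝ :=
  riccatiSeq S.A S.B S.Q S.R S.QT (T - t)

/-- The global gain `L^c(t)`, `1 ≤ t < T`. -/
def gainC (T t : ℕ) : Matrix (Σ i, Fin (S.du i)) (Σ i, Fin (S.dx i)) ℝ :=
  gainOp (S.riccatiC T (t + 1)) S.A S.B S.R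

/-- The local Riccati matrix `S^ℓ_i(t)`, `1 ≤ t ≤ T`, of a minor agent. -/
def riccatiL (T : ℕ) (i : Fin n) (t : ℕ) :
    Matrix (Fin (S.dx i.succ)) (Fin (S.dx i.succ)) ℝ :=
  riccatiSeq (block S.A i.succ i.succ) (block S.B i.succ i.succ) (block S.Q i.succ i.succ)
    (block S.R i.succ i.succ) (block S.QT i.succ i.succ) (T - t)

/-- The local gain `L^ℓ_i(t)`, `1 ≤ t < T`, of a minor agent. -/
def gainL (T : ℕ) (i : Fin n) (t : ℕ) :
    Matrix (Fin (S.du i.succ)) (Fin (S.dx i.succ)) ℝ :=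
  gainOp (S.riccatiL T i (t + 1)) (block S.A i.succ i.succ) (block S.B i.succ i.succ)
    (block S.R i.succ i.succ)

/-- Values of the information `I_0(t) = (x_0(1:t), u_0(1:t-1))` of the major agent. -/
abbrev InfoMajor (t : ℕ) : Type :=
  (Finset.Icc 1 t → Fin (S.dx 0) → ℝ) × (Finset.Ico 1 t → Fin (S.du 0) → ℝ)

/-- Values of the information `I_i(t) = (x_0(1:t), y_i(1:t), u_0(1:t-1), u_i(1:t-1))` of a
minor agent. -/
abbrev InfoMinor (i : Fin n) (t : ℕ) : Type :=
  (Finset.Icc 1 t → Fin (S.dx 0) → ℝ) × (Finset.Icc 1 t → Fin (S.dy i) → ℝ) ×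
    (Finset.Ico 1 t → Fin (S.du 0) → ℝ) × (Finset.Ico 1 t → Fin (S.du i.succ) → ℝ)

/-- A general control strategy: measurable control laws `g_{0,t}` and `g_{i,t}`. Only the laws
at the times `1 ≤ t < T` have an effect on the cost. -/
structure Strategy where
  major : (t : ℕ) → S.InfoMajor t → Fin (S.du 0) → ℝ
  minor : (i : Fin n) → (t : ℕ) → S.InfoMinor i t → Fin (S.du i.succ) → ℝ
  measurable_major : ∀ t, Measurable (major t)
  measurable_minor : ∀ i t, Measurable (minor i t)

/-- The index set of the primitive random variables up to time `T`: the initial states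
`x_i(1)`, the process noises `w_i(t)` and the observation noises `v_i(t)`, `1 ≤ t ≤ T`. -/
abbrev PrimIndex (_S : System n) (T : ℕ) : Type :=
  Fin (n + 1) ⊕ (Fin (n + 1) × Finset.Icc 1 T) ⊕ (Fin n × Finset.Icc 1 T)

/-- The dimension of a primitive random variable. -/
def primDim (T : ℕ) : S.PrimIndex T → ℕ
  | .inl i => S.dx i
  | .inr (.inl (i, _)) => S.dx i
  | .inr (.inr (i, _)) => S.dy i

end System

/-! ### Primitive random variables -/

/-- The primitive random variables of a system on a sample space `Ω`. -/
structure Primitives {n : ℕ} (S : System n) (Ω : Type*) where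
  /-- the initial states `x_i(1)` -/
  init : (i : Fin (n + 1)) → Ω → Fin (S.dx i) → ℝ
  /-- the process noises `w_i(t)` -/
  w : (i : Fin (n + 1)) → ℕ → Ω → Fin (S.dx i) → ℝ
  /-- the observation noises `v_i(t)` -/
  v : (i : Fin n) → ℕ → Ω → Fin (S.dy i) → ℝ

namespace Primitives

variable {n : ℕ} {S : System n} {Ω : Type*} (P : Primitives S Ω)

/-- All primitive random variables up to time `T`, as one family. -/
def family (T : ℕ) : (k : S.PrimIndex T) → Ω → Fin (S.primDim T k) → ℝ
  | .inl i => P.init i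
  | .inr (.inl (i, t)) => P.w i t
  | .inr (.inr (i, t)) => P.v i t

/-- The primitive random variables up to time `T` are independent and have zero mean and finite
variance. -/
structure Admissible [MeasurableSpace Ω] (T : ℕ) (μ : Measure Ω) : Prop where
  measurable : ∀ k, Measurable (P.family T k)
  memLp : ∀ k, MemLp (P.family T k) 2 μ
  mean_zero : ∀ k, ∫ ω, P.family T k ω ∂μ = 0
  indep : iIndepFun (P.family T) μ

/-! ### Closed-loop processes -/

/-- The states `x(1) = vec(x_0(1), …, x_n(1))`, `x(t+1) = A x(t) + B u(t) + w(t)` that result from a sequence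
`u(1), u(2), …` of control actions (the value at time `0` is not used). -/
def stateOf (ω : Ω) (u : ℕ → S.Control) : ℕ → S.State
  | 0 => 0
  | 1 => stack fun i => P.init i ω
  | t + 2 => S.A *ᵥ stateOf ω u (t + 1) + S.B *ᵥ u (t + 1) + stack fun i => P.w i (t + 1) ω

/-- The outputs `y_i(t) = C_{ii} x_i(t) + v_i(t)`. -/
def outputOf (ω : Ω) (u : ℕ → S.Control) (i : Fin n) (t : ℕ) : Fin (S.dy i) → ℝ :=
  S.C i *ᵥ comp (P.stateOf ω u t) i.succ + P.v i t ω

/-- `I_0(t)`, for a sequence of control actions. -/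
def infoMajorOf (ω : Ω) (u : ℕ → S.Control) (t : ℕ) : S.InfoMajor t :=
  (fun s => comp (P.stateOf ω u s) 0, fun s => comp (u s) 0)

/-- `I_i(t)`, for a sequence of control actions. -/
def infoMinorOf (ω : Ω) (u : ℕ → S.Control) (i : Fin n) (t : ℕ) : S.InfoMinor i t :=
  (fun s => comp (P.stateOf ω u s) 0, fun s => P.outputOf ω u i s,
    fun s => comp (u s) 0, fun s => comp (u s) i.succ)

/-- The control actions generated by the strategy `g` up to time `t` (and `0` afterwards). The
action at time `t + 1` is chosen from the information at time `t + 1`, which involves only the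
actions up to time `t`. -/
def controlUpTo (g : S.Strategy) (ω : Ω) : ℕ → ℕ → S.Control
  | 0 => 0
  | t + 1 => Function.update (controlUpTo g ω t) (t + 1)
      (stackMM (g.major (t + 1) (P.infoMajorOf ω (controlUpTo g ω t) (t + 1)))
        fun i => g.minor i (t + 1) (P.infoMinorOf ω (controlUpTo g ω t) i (t + 1)))

/-- The control actions `u(t)` under the strategy `g`. -/
def control (g : S.Strategy) (t : ℕ) (ω : Ω) : S.Control := P.controlUpTo g ω t t

/-- The states `x(t)` under the strategy `g`. -/
def state (g : S.Strategy) (t : ℕ) (ω : Ω) : S.State :=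
  P.stateOf ω (fun s => P.control g s ω) t

/-- The information `I_0(t)` under the strategy `g`. It is also the common information
`I^c(t)`. -/
def infoMajor (g : S.Strategy) (t : ℕ) (ω : Ω) : S.InfoMajor t :=
  P.infoMajorOf ω (fun s => P.control g s ω) t

/-- The information `I_i(t)` under the strategy `g`. -/
def infoMinor (g : S.Strategy) (i : Fin n) (t : ℕ) (ω : Ω) : S.InfoMinor i t :=
  P.infoMinorOf ω (fun s => P.control g s ω) i t

/-! ### Cost and optimality -/

/-- The cost of a realization: the per-step costs at the times `1, …, T - 1` and the terminal
cost at time `T`. -/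
def pathCost (T : ℕ) (g : S.Strategy) (ω : Ω) : ℝ :=
  ∑ t ∈ Finset.Ico 1 T,
      (P.state g t ω ⬝ᵥ S.Q *ᵥ P.state g t ω + P.control g t ω ⬝ᵥ S.R *ᵥ P.control g t ω)
    + P.state g T ω ⬝ᵥ S.QT *ᵥ P.state g T ω

variable [MeasurableSpace Ω]

/-- The performance `J(g) ∈ [0, ∞]`: the expectation of the nonnegative cost. -/
def cost (μ : Measure Ω) (T : ℕ) (g : S.Strategy) : ℝ≥0∞ :=
  ∫⁻ ω, ENNReal.ofReal (P.pathCost T g ω) ∂μ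

/-- `g` minimizes the total expected cost over all general strategies. -/
def IsOptimal (μ : Measure Ω) (T : ℕ) (g : S.Strategy) : Prop :=
  ∀ g' : S.Strategy, P.cost μ T g ≤ P.cost μ T g'

/-! ### MMSE estimates -/

/-- The σ-algebra generated by `I_0(t) = I^c(t)`. -/
abbrev sigmaMajor (g : S.Strategy) (t : ℕ) : MeasurableSpace Ω :=
  MeasurableSpace.comap (P.infoMajor g t) inferInstance

/-- The σ-algebra generated by `I_i(t)`. -/
abbrev sigmaMinor (g : S.Strategy) (i : Fin n) (t : ℕ) : MeasurableSpace Ω :=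
  MeasurableSpace.comap (P.infoMinor g i t) inferInstance

/-- The major agent's estimate `x̂(t|c) = E[x(t) | I^c(t)]`. -/
def estMajor (μ : Measure Ω) (g : S.Strategy) (t : ℕ) : Ω → S.State :=
  μ[P.state g t | P.sigmaMajor g t]

/-- The minor agent's estimate `x̂(t|i) = E[x(t) | I_i(t)]`. -/
def estMinor (μ : Measure Ω) (g : S.Strategy) (i : Fin n) (t : ℕ) : Ω → S.State :=
  μ[P.state g t | P.sigmaMinor g i t]

/-- The common control `u^c(t) = E[u(t) | I^c(t)]`. -/
def commonControl (μ : Measure Ω) (g : S.Strategy) (t : ℕ) : Ω → S.Control :=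
  μ[P.control g t | P.sigmaMajor g t]

end Primitives

/-! ### Densities and the Bayesian filter -/

/-- The random vector `X` admits the density `φ` (with respect to Lebesgue measure). -/
def HasDensity {Ω : Type*} [MeasurableSpace Ω] (μ : Measure Ω) {d : ℕ}
    (X : Ω → Fin d → ℝ) (φ : (Fin d → ℝ) → ℝ≥0∞) : Prop :=
  Measurable φ ∧ μ.map X = volume.withDensity φ

/-- `f` is a conditional density of the random vector `X` given `Y`: for almost every
realization of `Y`, the conditional distribution of `X` given `Y` has the density `f Y`. -/
def IsCondDensity {Ω 𝓨 : Type*} [MeasurableSpace Ω] [MeasurableSpace 𝓨] (μ : Measure Ω)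
    [IsFiniteMeasure μ] {d : ℕ} (X : Ω → Fin d → ℝ) (Y : Ω → 𝓨)
    (f : 𝓨 → (Fin d → ℝ) → ℝ≥0∞) : Prop :=
  Measurable (Function.uncurry f) ∧
    ∀ᵐ ω ∂μ, condDistrib X Y μ (Y ω) = volume.withDensity (f (Y ω))

namespace System

variable {n : ℕ} (S : System n)

/-- The part `I_i(t)` of the information `I_i(t+1)`. -/
def InfoMinor.prev {S : System n} {i : Fin n} {t : ℕ} (I : S.InfoMinor i (t + 1)) :
    S.InfoMinor i t :=
  (fun s => I.1 ⟨s, Finset.Icc_subset_Icc_right t.le_succ s.2⟩,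
    fun s => I.2.1 ⟨s, Finset.Icc_subset_Icc_right t.le_succ s.2⟩,
    fun s => I.2.2.1 ⟨s, Finset.Ico_subset_Ico_right t.le_succ s.2⟩,
    fun s => I.2.2.2 ⟨s, Finset.Ico_subset_Ico_right t.le_succ s.2⟩)

/-- The initial density of the filter, where `ξ` is the density of `x_i(1)` and `ν` the one of
`v_i(1)`: as a function of `x`, it is `ν(y_i(1) - C_{ii} x) ξ(x)`, normalized. -/
def bayesInit (i : Fin n) (ξ : (Fin (S.dx i.succ) → ℝ) → ℝ≥0∞)
    (ν : (Fin (S.dy i) → ℝ) → ℝ≥0∞) (I : S.InfoMinor i 1) (x : Fin (S.dx i.succ) → ℝ) :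
    ℝ≥0∞ :=
  let y := I.2.1 ⟨1, by simp⟩
  (ν (y - S.C i *ᵥ x) * ξ x) / ∫⁻ x', ν (y - S.C i *ᵥ x') * ξ x'

/-- The factor `γ_0(t+1) = φ_0(x_0(t+1) - A_{00} x_0(t) - B_{00} u_0(t))`. -/
def filterGamma0 {i : Fin n} {t : ℕ} (ht : 1 ≤ t) (φ₀ : (Fin (S.dx 0) → ℝ) → ℝ≥0∞)
    (I : S.InfoMinor i (t + 1)) : ℝ≥0∞ :=
  φ₀ (I.1 ⟨t + 1, by simp⟩ - block S.A 0 0 *ᵥ I.1 ⟨t, by simp [ht]⟩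
    - block S.B 0 0 *ᵥ I.2.2.1 ⟨t, by simp [ht]⟩)

/-- The factor
`γ_i(t+1) = φ_i(x_i(t+1) - A_{ii} x_i(t) - A_{i0} x_0(t) - B_{ii} u_i(t) - B_{i0} u_0(t))` at
`x = x_i(t+1)` and `x' = x_i(t)`. -/
def filterGamma {i : Fin n} {t : ℕ} (ht : 1 ≤ t) (φ : (Fin (S.dx i.succ) → ℝ) → ℝ≥0∞)
    (I : S.InfoMinor i (t + 1)) (x x' : Fin (S.dx i.succ) → ℝ) : ℝ≥0∞ :=
  φ (x - block S.A i.succ i.succ *ᵥ x' - block S.A i.succ 0 *ᵥ I.1 ⟨t, by simp [ht]⟩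
    - block S.B i.succ i.succ *ᵥ I.2.2.2 ⟨t, by simp [ht]⟩
    - block S.B i.succ 0 *ᵥ I.2.2.1 ⟨t, by simp [ht]⟩)

/-- The factor `β_i(t+1) = ν_i(y_i(t+1) - C_{ii} x_i(t+1))` at `x = x_i(t+1)`. -/
def filterBeta {i : Fin n} {t : ℕ} (ν : (Fin (S.dy i) → ℝ) → ℝ≥0∞)
    (I : S.InfoMinor i (t + 1)) (x : Fin (S.dx i.succ) → ℝ) : ℝ≥0∞ :=
  ν (I.2.1 ⟨t + 1, by simp⟩ - S.C i *ᵥ x)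

/-- One step of the Bayesian filter, from time `t` to time `t + 1`. It depends on the data
`I_i(t+1)`, but not on the strategy. -/
def bayesUpdate {i : Fin n} {t : ℕ} (ht : 1 ≤ t) (φ₀ : (Fin (S.dx 0) → ℝ) → ℝ≥0∞)
    (φ : (Fin (S.dx i.succ) → ℝ) → ℝ≥0∞) (ν : (Fin (S.dy i) → ℝ) → ℝ≥0∞)
    (f : S.InfoMinor i t → (Fin (S.dx i.succ) → ℝ) → ℝ≥0∞)
    (I : S.InfoMinor i (t + 1)) (x : Fin (S.dx i.succ) → ℝ) : ℝ≥0∞ :=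
  (S.filterBeta ν I x *
      ∫⁻ x', S.filterGamma ht φ I x x' * S.filterGamma0 ht φ₀ I * f (InfoMinor.prev I) x') /
    ∫⁻ z, S.filterBeta ν I z *
      ∫⁻ x', S.filterGamma ht φ I z x' * S.filterGamma0 ht φ₀ I * f (InfoMinor.prev I) x'

end System

end MajorMinor

end

/-!
The major agent observes its own state, so its information generates, for every strategy, the
σ-algebra of its own initial state and noises. Subtracting from the state of a minor agent the part
that is driven by the major agent and by its own past actions leaves a free state, which evolves
without control, and the information of the minor agent is equivalent to the noises of the major
agent and its free outputs. Hence no agent influences what is learned (there is no dual effect), and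
given the information of the major agent the minor agents are conditionally independent.

Split state and control into their conditional expectations given the common information and the
remaining local parts. Conditional independence makes the cross terms of the quadratic cost vanish:
between the common and the local part, between different minor agents, and between the local
estimates and the estimation errors, which do not depend on the strategy. Completing the square
with the two families of Riccati matrices, the expected cost telescopes into the cost of the initial
data, contributions of noises and estimation errors that no strategy can change, and a sum of
nonnegative gaps, which vanish exactly when the control follows the stated gains. Such a strategy is
built forward in time, and any two of them generate the same actions by induction on time.

For the filter, new data of a minor agent are the old data together with a shifted noise of the
major agent and a shifted output noise, both independent of the past; the unnormalized density of
the data and the state therefore changes by the factors `γ_0`, `γ_i` and `β_i`, and Bayes' rule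
normalizes it.
-/

noncomputable section

namespace MajorMinor

/-! ### Block vectors -/

section Block

variable {n : ℕ} {d e : Fin (n + 1) → ℕ}

@[simp] lemma comp_stack (x : (i : Fin (n + 1)) → Fin (d i) → ℝ) (i : Fin (n + 1)) :
    comp (stack x) i = x i := rfl

@[simp] lemma comp_stackMM_zero (a : Fin (d 0) → ℝ) (b : (i : Fin n) → Fin (d i.succ) → ℝ) :
    comp (stackMM a b) 0 = a := rfl

@[simp] lemma comp_stackMM_succ (a : Fin (d 0) → ℝ) (b : (i : Fin n) → Fin (d i.succ) → ℝ)
    (i : Fin n) : comp (stackMM a b) i.succ = b i := rfl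

@[simp] lemma comp_add (x y : (Σ i, Fin (d i)) → ℝ) (i : Fin (n + 1)) :
    comp (x + y) i = comp x i + comp y i := rfl

@[simp] lemma comp_sub (x y : (Σ i, Fin (d i)) → ℝ) (i : Fin (n + 1)) :
    comp (x - y) i = comp x i - comp y i := rfl

@[simp] lemma comp_neg (x : (Σ i, Fin (d i)) → ℝ) (i : Fin (n + 1)) :
    comp (-x) i = -comp x i := rfl

lemma ext_comp {x y : (Σ i, Fin (d i)) → ℝ} (h : ∀ i, comp x i = comp y i) : x = y := by
  funext ⟨i, k⟩
  exact congrFun (h i) k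

lemma stackMM_comp (x : (Σ i, Fin (d i)) → ℝ) :
    stackMM (comp x 0) (fun i => comp x i.succ) = x :=
  ext_comp fun i => by cases i using Fin.cases <;> rfl

lemma comp_mulVec (M : Matrix (Σ i, Fin (d i)) (Σ i, Fin (e i)) ℝ) (x : (Σ i, Fin (e i)) → ℝ)
    (i : Fin (n + 1)) : comp (M *ᵥ x) i = blockRow M i *ᵥ x := rfl

lemma comp_mulVec_eq_sum (M : Matrix (Σ i, Fin (d i)) (Σ i, Fin (e i)) ℝ)
    (x : (Σ i, Fin (e i)) → ℝ) (i : Fin (n + 1)) :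
    comp (M *ᵥ x) i = ∑ j, block M i j *ᵥ comp x j := by
  funext k
  simp [comp, Matrix.mulVec, dotProduct, block, Finset.sum_apply, Fintype.sum_sigma]

section Sparse

variable {M : Matrix (Σ i, Fin (d i)) (Σ i, Fin (e i)) ℝ}
  (hM : ∀ i j, j ≠ 0 → j ≠ i → block M i j = 0) (x : (Σ i, Fin (e i)) → ℝ)

include hM

lemma comp_mulVec_zero_of_sparse : comp (M *ᵥ x) 0 = block M 0 0 *ᵥ comp x 0 := by
  rw [comp_mulVec_eq_sum]
  refine Fintype.sum_eq_single _ fun j hj => ?_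
  rw [hM 0 j hj hj, Matrix.zero_mulVec]

lemma comp_mulVec_succ_of_sparse (i : Fin n) :
    comp (M *ᵥ x) i.succ
      = block M i.succ 0 *ᵥ comp x 0 + block M i.succ i.succ *ᵥ comp x i.succ := by
  rw [comp_mulVec_eq_sum]
  refine Fintype.sum_eq_add _ _ (Fin.succ_ne_zero i).symm fun j hj => ?_
  rw [hM i.succ j hj.1 hj.2, Matrix.zero_mulVec]

end Sparse

/-- The projection `x ↦ x_i` as a continuous linear map, through which `comp` inherits measurability
and integrability and commutes with conditional expectations. -/
def compCLM (d : Fin (n + 1) → ℕ) (i : Fin (n + 1)) :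
    ((Σ i, Fin (d i)) → ℝ) →L[ℝ] (Fin (d i) → ℝ) :=
  ContinuousLinearMap.pi fun k => ContinuousLinearMap.proj ⟨i, k⟩

lemma measurable_of_comp {Ω : Type*} [MeasurableSpace Ω] {X : Ω → (Σ i, Fin (d i)) → ℝ}
    (h : ∀ i, Measurable fun ω => comp (X ω) i) : Measurable X :=
  measurable_pi_lambda _ fun ⟨i, k⟩ => (measurable_pi_apply k).comp (h i)

end Block

/-- Multiplication by a matrix as a continuous linear map, the counterpart of `compCLM` for
`Matrix.mulVec`. -/
def mulVecCLM {X Y : Type*} [Fintype X] (M : Matrix Y X ℝ) : (X → ℝ) →L[ℝ] (Y → ℝ) where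
  toLinearMap := M.mulVecLin
  cont := continuous_const.matrix_mulVec continuous_id

lemma measurable_mulVec {Ω X Y : Type*} [MeasurableSpace Ω] [Fintype X] [Finite Y]
    (M : Matrix Y X ℝ) {f : Ω → X → ℝ} (hf : Measurable f) : Measurable fun ω => M *ᵥ f ω :=
  (mulVecCLM M).continuous.measurable.comp hf

section TimeIndexed

variable {Ω β : Type*} [MeasurableSpace Ω] [MeasurableSpace β] {t : ℕ} (f : ℕ → Ω → β)

lemma measurable_pi_Icc_iff :
    Measurable (fun ω (s : Finset.Icc 1 t) => f s ω) ↔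
      ∀ s, 1 ≤ s → s ≤ t → Measurable (f s) := by
  simp [measurable_pi_iff]

lemma measurable_pi_Ico_iff :
    Measurable (fun ω (s : Finset.Ico 1 t) => f s ω) ↔
      ∀ s, 1 ≤ s → s < t → Measurable (f s) := by
  simp [measurable_pi_iff]

end TimeIndexed

/-! ### The closed-loop processes -/

namespace Primitives

variable {n : ℕ} {S : System n} {Ω : Type*} (P : Primitives S Ω)

lemma stateOf_congr {ω : Ω} {u u' : ℕ → S.Control} {t : ℕ}
    (h : ∀ s, 1 ≤ s → s < t → u s = u' s) : P.stateOf ω u t = P.stateOf ω u' t := by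
  induction t with
  | zero => rfl
  | succ t ih =>
    cases t with
    | zero => rfl
    | succ t =>
      rw [stateOf, stateOf, ih fun s hs hst => h s hs (by omega), h (t + 1) (by omega) (by omega)]

lemma infoMajorOf_congr {ω : Ω} {u u' : ℕ → S.Control} {t : ℕ}
    (h : ∀ s, 1 ≤ s → s < t → u s = u' s) : P.infoMajorOf ω u t = P.infoMajorOf ω u' t := by
  have hx : ∀ s : Finset.Icc 1 t, P.stateOf ω u s = P.stateOf ω u' s := fun s =>
    P.stateOf_congr fun r hr hrs => h r hr (hrs.trans_le (Finset.mem_Icc.1 s.2).2)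
  have hu : ∀ s : Finset.Ico 1 t, u s = u' s := fun s =>
    h s (Finset.mem_Ico.1 s.2).1 (Finset.mem_Ico.1 s.2).2
  simp only [infoMajorOf, hx, hu]

lemma infoMinorOf_congr {ω : Ω} {u u' : ℕ → S.Control} {i : Fin n} {t : ℕ}
    (h : ∀ s, 1 ≤ s → s < t → u s = u' s) :
    P.infoMinorOf ω u i t = P.infoMinorOf ω u' i t := by
  have hx : ∀ s : Finset.Icc 1 t, P.stateOf ω u s = P.stateOf ω u' s := fun s =>
    P.stateOf_congr fun r hr hrs => h r hr (hrs.trans_le (Finset.mem_Icc.1 s.2).2)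
  have hu : ∀ s : Finset.Ico 1 t, u s = u' s := fun s =>
    h s (Finset.mem_Ico.1 s.2).1 (Finset.mem_Ico.1 s.2).2
  simp only [infoMinorOf, outputOf, hx, hu]

lemma controlUpTo_eq_control (g : S.Strategy) (ω : Ω) {s t : ℕ} (h : s ≤ t) :
    P.controlUpTo g ω t s = P.control g s ω := by
  induction t, h using Nat.le_induction with
  | base => rfl
  | succ t hst ih => rw [controlUpTo, Function.update_of_ne (by omega), ih]

lemma control_succ (g : S.Strategy) (t : ℕ) (ω : Ω) :
    P.control g (t + 1) ω = stackMM (g.major (t + 1) (P.infoMajor g (t + 1) ω))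
      fun i => g.minor i (t + 1) (P.infoMinor g i (t + 1) ω) := by
  have h : ∀ s, 1 ≤ s → s < t + 1 → P.controlUpTo g ω t s = P.control g s ω := fun s _ hs =>
    P.controlUpTo_eq_control g ω (by omega)
  simp only [control, controlUpTo, Function.update_self, P.infoMajorOf_congr h,
    P.infoMinorOf_congr h, infoMajor, infoMinor]

lemma comp_control_zero (g : S.Strategy) {t : ℕ} (ht : 1 ≤ t) (ω : Ω) :
    comp (P.control g t ω) 0 = g.major t (P.infoMajor g t ω) := by
  obtain ⟨t, rfl⟩ := Nat.exists_eq_add_of_le' ht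
  rw [control_succ, comp_stackMM_zero]

lemma comp_control_succ (g : S.Strategy) {t : ℕ} (ht : 1 ≤ t) (ω : Ω) (i : Fin n) :
    comp (P.control g t ω) i.succ = g.minor i t (P.infoMinor g i t ω) := by
  obtain ⟨t, rfl⟩ := Nat.exists_eq_add_of_le' ht
  rw [control_succ, comp_stackMM_succ]

lemma control_congr {g g' : S.Strategy} {t : ℕ}
    (h0 : ∀ s, 1 ≤ s → s < t → g.major s = g'.major s)
    (hi : ∀ i s, 1 ≤ s → s < t → g.minor i s = g'.minor i s) (ω : Ω) :
    ∀ s, 1 ≤ s → s < t → P.control g s ω = P.control g' s ω := by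
  intro s
  induction s using Nat.strong_induction_on with
  | _ s ih =>
    intro hs hst
    have hpast : ∀ r, 1 ≤ r → r < s → P.control g r ω = P.control g' r ω :=
      fun r hr hrs => ih r hrs hr (hrs.trans hst)
    obtain ⟨s, rfl⟩ := Nat.exists_eq_add_of_le' hs
    simp only [control_succ, h0 _ hs hst, hi _ _ hs hst, infoMajor, infoMinor,
      P.infoMajorOf_congr hpast, P.infoMinorOf_congr hpast]

lemma state_one (g : S.Strategy) (ω : Ω) : P.state g 1 ω = stack fun i => P.init i ω := rfl

lemma state_succ (g : S.Strategy) {t : ℕ} (ht : 1 ≤ t) (ω : Ω) :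
    P.state g (t + 1) ω
      = S.A *ᵥ P.state g t ω + S.B *ᵥ P.control g t ω + stack fun i => P.w i t ω := by
  obtain ⟨t, rfl⟩ := Nat.exists_eq_add_of_le' ht
  rfl

lemma comp_state_succ_zero (g : S.Strategy) {t : ℕ} (ht : 1 ≤ t) (ω : Ω) :
    comp (P.state g (t + 1) ω) 0 = block S.A 0 0 *ᵥ comp (P.state g t ω) 0
      + block S.B 0 0 *ᵥ comp (P.control g t ω) 0 + P.w 0 t ω := by
  rw [P.state_succ g ht, comp_add, comp_add, comp_mulVec_zero_of_sparse S.A_sparse,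
    comp_mulVec_zero_of_sparse S.B_sparse, comp_stack]

lemma comp_state_succ_succ (g : S.Strategy) {t : ℕ} (ht : 1 ≤ t) (ω : Ω) (i : Fin n) :
    comp (P.state g (t + 1) ω) i.succ
      = (block S.A i.succ 0 *ᵥ comp (P.state g t ω) 0
          + block S.A i.succ i.succ *ᵥ comp (P.state g t ω) i.succ)
        + (block S.B i.succ 0 *ᵥ comp (P.control g t ω) 0
          + block S.B i.succ i.succ *ᵥ comp (P.control g t ω) i.succ) + P.w i.succ t ω := by
  rw [P.state_succ g ht, comp_add, comp_add, comp_mulVec_succ_of_sparse S.A_sparse,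
    comp_mulVec_succ_of_sparse S.B_sparse, comp_stack]

/-- The output `y_i(t)` under the strategy `g`. -/
def output (g : S.Strategy) (i : Fin n) (t : ℕ) (ω : Ω) : Fin (S.dy i) → ℝ :=
  S.C i *ᵥ comp (P.state g t ω) i.succ + P.v i t ω

/-- The part of the state `x_i(t)` of a minor agent that is driven by its own initial state and
process noise: the state it would have if `x_0`, `u_0` and `u_i` were zero. It does not depend on
the strategy. -/
def freeState (i : Fin n) : ℕ → Ω → Fin (S.dx i.succ) → ℝ
  | 0 => 0
  | 1 => P.init i.succ
  | t + 2 => fun ω => block S.A i.succ i.succ *ᵥ freeState i (t + 1) ω + P.w i.succ (t + 1) ω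

/-- The output of a minor agent in the state `freeState`. -/
def freeOutput (i : Fin n) (t : ℕ) (ω : Ω) : Fin (S.dy i) → ℝ :=
  S.C i *ᵥ P.freeState i t ω + P.v i t ω

lemma freeState_succ (i : Fin n) {t : ℕ} (ht : 1 ≤ t) (ω : Ω) :
    P.freeState i (t + 1) ω
      = block S.A i.succ i.succ *ᵥ P.freeState i t ω + P.w i.succ t ω := by
  obtain ⟨t, rfl⟩ := Nat.exists_eq_add_of_le' ht
  rfl

lemma comp_state_succ_sub_freeState (g : S.Strategy) (i : Fin n) {t : ℕ} (ht : 1 ≤ t) (ω : Ω) :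
    comp (P.state g (t + 1) ω) i.succ - P.freeState i (t + 1) ω
      = (block S.A i.succ 0 *ᵥ comp (P.state g t ω) 0
          + block S.A i.succ i.succ *ᵥ (comp (P.state g t ω) i.succ - P.freeState i t ω))
        + (block S.B i.succ 0 *ᵥ comp (P.control g t ω) 0
          + block S.B i.succ i.succ *ᵥ comp (P.control g t ω) i.succ) := by
  rw [P.comp_state_succ_succ g ht, P.freeState_succ i ht, Matrix.mulVec_sub]
  abel

lemma output_sub_freeOutput (g : S.Strategy) (i : Fin n) (t : ℕ) (ω : Ω) :
    P.output g i t ω - P.freeOutput i t ω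
      = S.C i *ᵥ (comp (P.state g t ω) i.succ - P.freeState i t ω) := by
  rw [output, freeOutput, Matrix.mulVec_sub, add_sub_add_right_eq_sub]

/-! ### Measurability of the closed-loop processes -/

section Measurability

variable [MeasurableSpace Ω] (g : S.Strategy) {t : ℕ}

lemma measurable_infoMajor_iff :
    Measurable (P.infoMajor g t) ↔
      (∀ s, 1 ≤ s → s ≤ t → Measurable fun ω => comp (P.state g s ω) 0) ∧
      ∀ s, 1 ≤ s → s < t → Measurable fun ω => comp (P.control g s ω) 0 :=
  measurable_fun_prod.trans <|
    and_congr (measurable_pi_Icc_iff fun s ω => comp (P.state g s ω) 0)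
      (measurable_pi_Ico_iff fun s ω => comp (P.control g s ω) 0)

lemma measurable_infoMinor_iff (i : Fin n) :
    Measurable (P.infoMinor g i t) ↔ Measurable (P.infoMajor g t) ∧
      (∀ s, 1 ≤ s → s ≤ t → Measurable (P.output g i s)) ∧
      ∀ s, 1 ≤ s → s < t → Measurable fun ω => comp (P.control g s ω) i.succ := by
  have h : Measurable (P.infoMinor g i t) ↔ _ ∧ _ ∧ _ ∧ _ :=
    measurable_fun_prod.trans <|
      and_congr (measurable_pi_Icc_iff fun s ω => comp (P.state g s ω) 0) <|
        measurable_fun_prod.trans <| and_congr (measurable_pi_Icc_iff (P.output g i)) <|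
          measurable_fun_prod.trans <|
            and_congr (measurable_pi_Ico_iff fun s ω => comp (P.control g s ω) 0)
              (measurable_pi_Ico_iff fun s ω => comp (P.control g s ω) i.succ)
  rw [h, measurable_infoMajor_iff]
  exact ⟨fun ⟨hx, hy, hu, hv⟩ => ⟨⟨hx, hu⟩, hy, hv⟩, fun ⟨⟨hx, hu⟩, hy, hv⟩ => ⟨hx, hy, hu, hv⟩⟩

lemma measurable_comp_state_zero (hinit : Measurable (P.init 0))
    (hw : ∀ s, 1 ≤ s → s < t → Measurable (P.w 0 s)) (ht : 1 ≤ t)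
    (hx : ∀ s, 1 ≤ s → s < t → Measurable fun ω => comp (P.state g s ω) 0)
    (hu : ∀ s, 1 ≤ s → s < t → Measurable fun ω => comp (P.control g s ω) 0) :
    Measurable fun ω => comp (P.state g t ω) 0 := by
  obtain rfl | ht1 := ht.eq_or_lt
  · exact hinit
  obtain ⟨s, rfl⟩ := Nat.exists_eq_add_of_le' ht
  have hs : 1 ≤ s := by omega
  simp only [P.comp_state_succ_zero g hs]
  exact ((measurable_mulVec _ (hx s hs s.lt_succ_self)).add
    (measurable_mulVec _ (hu s hs s.lt_succ_self))).add (hw s hs s.lt_succ_self)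

lemma measurable_major (hinit : Measurable (P.init 0))
    (hw : ∀ s, 1 ≤ s → s < t → Measurable (P.w 0 s)) :
    ∀ s, 1 ≤ s → s ≤ t → (Measurable fun ω => comp (P.state g s ω) 0) ∧
      Measurable fun ω => comp (P.control g s ω) 0 := by
  intro s
  induction s using Nat.strong_induction_on with
  | _ s ih =>
    intro hs hst
    have hpast : ∀ r, 1 ≤ r → r < s → _ := fun r hr hrs => ih r hrs hr (hrs.le.trans hst)
    have hx := P.measurable_comp_state_zero g hinit (fun r hr hrs => hw r hr (hrs.trans_le hst)) hs
      (fun r hr hrs => (hpast r hr hrs).1) fun r hr hrs => (hpast r hr hrs).2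
    refine ⟨hx, ?_⟩
    simp only [P.comp_control_zero g hs]
    refine (g.measurable_major s).comp ((P.measurable_infoMajor_iff g).2
      ⟨fun r hr hrs => ?_, fun r hr hrs => (hpast r hr hrs).2⟩)
    obtain rfl | hrs := hrs.eq_or_lt
    exacts [hx, (hpast r hr hrs).1]

lemma measurable_infoMajor_iff_noise (ht : 1 ≤ t) :
    Measurable (P.infoMajor g t) ↔
      Measurable (P.init 0) ∧ ∀ s, 1 ≤ s → s < t → Measurable (P.w 0 s) := by
  rw [measurable_infoMajor_iff]
  refine ⟨fun ⟨hx, hu⟩ => ⟨hx 1 le_rfl ht, fun s hs hst => ?_⟩, fun ⟨hinit, hw⟩ =>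
    ⟨fun s hs hst => (P.measurable_major g hinit hw s hs hst).1,
      fun s hs hst => (P.measurable_major g hinit hw s hs hst.le).2⟩⟩
  have hw_eq : P.w 0 s = fun ω => comp (P.state g (s + 1) ω) 0
      - (block S.A 0 0 *ᵥ comp (P.state g s ω) 0 + block S.B 0 0 *ᵥ comp (P.control g s ω) 0) :=
    funext fun ω => eq_sub_of_add_eq' (P.comp_state_succ_zero g hs ω).symm
  rw [hw_eq]
  exact (hx (s + 1) (by omega) hst).sub ((measurable_mulVec _ (hx s hs hst.le)).add
    (measurable_mulVec _ (hu s hs hst)))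

lemma measurable_state_sub_freeState (i : Fin n) (ht : 1 ≤ t)
    (hI : Measurable (P.infoMajor g t))
    (hu : ∀ s, 1 ≤ s → s < t → Measurable fun ω => comp (P.control g s ω) i.succ) :
    Measurable fun ω => comp (P.state g t ω) i.succ - P.freeState i t ω := by
  obtain ⟨hx₀, hu₀⟩ := (P.measurable_infoMajor_iff g).1 hI
  suffices h : ∀ s, 1 ≤ s → s ≤ t →
      Measurable fun ω => comp (P.state g s ω) i.succ - P.freeState i s ω from h t ht le_rfl
  intro s hs
  induction s, hs using Nat.le_induction with
  | base =>
    intro _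
    simp only [state_one, comp_stack, freeState, sub_self]
    exact measurable_const
  | succ s hs ih =>
    intro hst
    simp only [P.comp_state_succ_sub_freeState g i hs]
    exact ((measurable_mulVec _ (hx₀ s hs (by omega))).add
      (measurable_mulVec _ (ih (by omega)))).add
      ((measurable_mulVec _ (hu₀ s hs hst)).add (measurable_mulVec _ (hu s hs hst)))

lemma measurable_output_sub_freeOutput (i : Fin n) (ht : 1 ≤ t)
    (hI : Measurable (P.infoMajor g t))
    (hu : ∀ s, 1 ≤ s → s < t → Measurable fun ω => comp (P.control g s ω) i.succ) :
    Measurable fun ω => P.output g i t ω - P.freeOutput i t ω := by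
  simp only [output_sub_freeOutput]
  exact measurable_mulVec _ (P.measurable_state_sub_freeState g i ht hI hu)

lemma measurable_infoMajor_of_le {s : ℕ} (hst : s ≤ t) (hI : Measurable (P.infoMajor g t)) :
    Measurable (P.infoMajor g s) := by
  rw [measurable_infoMajor_iff] at hI ⊢
  exact ⟨fun r hr hrs => hI.1 r hr (hrs.trans hst), fun r hr hrs => hI.2 r hr (hrs.trans_le hst)⟩

lemma measurable_minor (i : Fin n) (hI : Measurable (P.infoMajor g t))
    (hy : ∀ s, 1 ≤ s → s ≤ t → Measurable (P.freeOutput i s)) :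
    ∀ s, 1 ≤ s → s ≤ t →
      Measurable (P.output g i s) ∧ Measurable fun ω => comp (P.control g s ω) i.succ := by
  intro s
  induction s using Nat.strong_induction_on with
  | _ s ih =>
    intro hs hst
    have hpast : ∀ r, 1 ≤ r → r < s → _ := fun r hr hrs => ih r hrs hr (hrs.le.trans hst)
    have hIs := P.measurable_infoMajor_of_le g hst hI
    have hu : ∀ r, 1 ≤ r → r < s → Measurable fun ω => comp (P.control g r ω) i.succ :=
      fun r hr hrs => (hpast r hr hrs).2
    have hout : Measurable (P.output g i s) := by
      rw [← sub_add_cancel (P.output g i s) (P.freeOutput i s)]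
      exact (P.measurable_output_sub_freeOutput g i hs hIs hu).add (hy s hs hst)
    refine ⟨hout, ?_⟩
    simp only [P.comp_control_succ g hs]
    refine (g.measurable_minor i s).comp
      ((P.measurable_infoMinor_iff g i).2 ⟨hIs, fun r hr hrs => ?_, hu⟩)
    obtain rfl | hrs := hrs.eq_or_lt
    exacts [hout, (hpast r hr hrs).1]

lemma measurable_infoMinor_iff_freeOutput (i : Fin n) :
    Measurable (P.infoMinor g i t) ↔ Measurable (P.infoMajor g t) ∧
      ∀ s, 1 ≤ s → s ≤ t → Measurable (P.freeOutput i s) := by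
  rw [measurable_infoMinor_iff]
  refine ⟨fun ⟨hI, hout, hu⟩ => ⟨hI, fun s hs hst => ?_⟩, fun ⟨hI, hy⟩ =>
    ⟨hI, fun s hs hst => (P.measurable_minor g i hI hy s hs hst).1,
      fun s hs hst => (P.measurable_minor g i hI hy s hs hst.le).2⟩⟩
  rw [← sub_sub_cancel (P.output g i s) (P.freeOutput i s)]
  exact (hout s hs hst).sub (P.measurable_output_sub_freeOutput g i hs
    (P.measurable_infoMajor_of_le g hst hI) fun r hr hrs => hu r hr (hrs.trans_le hst))

end Measurability

/-- The σ-algebra generated by `x_0(1)`, `w_0(1:t-1)` and the first `t` uncontrolled outputs of a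
minor agent: by `sigmaMinor_eq`, the information of the agent under every strategy. -/
abbrev sigmaFree (i : Fin n) (t : ℕ) : MeasurableSpace Ω :=
  MeasurableSpace.comap (P.init 0) inferInstance
    ⊔ (⨆ s ∈ Finset.Ico 1 t, MeasurableSpace.comap (P.w 0 s) inferInstance)
    ⊔ ⨆ s ∈ Finset.Icc 1 t, MeasurableSpace.comap (P.freeOutput i s) inferInstance

lemma sigmaMinor_eq (g : S.Strategy) (i : Fin n) {t : ℕ} (ht : 1 ≤ t) :
    P.sigmaMinor g i t = P.sigmaFree i t := by
  refine eq_of_forall_ge_iff fun m => ?_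
  rw [sigmaMinor, ← measurable_iff_comap_le, measurable_infoMinor_iff_freeOutput,
    P.measurable_infoMajor_iff_noise g ht]
  simp only [sigmaFree, sup_le_iff, iSup_le_iff, ← measurable_iff_comap_le, Finset.mem_Ico,
    Finset.mem_Icc, and_imp]

lemma measurable_sigmaMinor_state_sub_freeState (g : S.Strategy) (i : Fin n) {t : ℕ} (ht : 1 ≤ t) :
    Measurable[P.sigmaMinor g i t]
      fun ω => comp (P.state g t ω) i.succ - P.freeState i t ω := by
  let _ : MeasurableSpace Ω := P.sigmaMinor g i t
  obtain ⟨hI, -, hu⟩ := (P.measurable_infoMinor_iff g i).1 (comap_measurable (P.infoMinor g i t))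
  exact P.measurable_state_sub_freeState g i ht hI hu

end Primitives

/-! ### Conditional expectations -/

section CondExp

lemma isPiSystem_image2_inter {α : Type*} {C D : Set (Set α)} (hC : IsPiSystem C)
    (hD : IsPiSystem D) : IsPiSystem (Set.image2 (· ∩ ·) C D) := by
  rintro _ ⟨a, ha, b, hb, rfl⟩ _ ⟨a', ha', b', hb', rfl⟩ hne
  rw [Set.inter_inter_inter_comm] at hne ⊢
  exact ⟨a ∩ a', hC a ha a' ha' hne.left, b ∩ b', hD b hb b' hb' hne.right, rfl⟩

lemma generateFrom_image2_inter_eq_sup {α : Type*} (m₁ m₂ : MeasurableSpace α) :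
    MeasurableSpace.generateFrom
      (Set.image2 (· ∩ ·) {a | MeasurableSet[m₁] a} {b | MeasurableSet[m₂] b}) = m₁ ⊔ m₂ := by
  refine le_antisymm (MeasurableSpace.generateFrom_le ?_) (sup_le (fun a ha => ?_) fun b hb => ?_)
  · rintro _ ⟨a, ha, b, hb, rfl⟩
    exact MeasurableSet.inter (le_sup_left (a := m₁) (b := m₂) a ha)
      (le_sup_right (a := m₁) (b := m₂) b hb)
  · exact MeasurableSpace.measurableSet_generateFrom
      ⟨a, ha, Set.univ, MeasurableSet.univ, Set.inter_univ a⟩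
  · exact MeasurableSpace.measurableSet_generateFrom
      ⟨Set.univ, MeasurableSet.univ, b, hb, Set.univ_inter b⟩

variable {Ω E : Type*} {mΩ : MeasurableSpace Ω} {μ : Measure Ω}
  [NormedAddCommGroup E] [NormedSpace ℝ E]

section Indep

variable [CompleteSpace E] [IsFiniteMeasure μ] {m m₁ m₂ : MeasurableSpace Ω}
  (h₁ : m₁ ≤ mΩ) (h₂ : m₂ ≤ mΩ) (hind : Indep m₁ m₂ μ) {f : Ω → E}
  (hf : StronglyMeasurable[m₁] f) (hfi : Integrable f μ)

include h₁ h₂ hind hf hfi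

lemma setIntegral_eq_smul_of_indep {b : Set Ω} (hb : MeasurableSet[m₂] b) :
    ∫ ω in b, f ω ∂μ = μ.real b • ∫ ω, f ω ∂μ := by
  rw [← setIntegral_condExp h₂ hfi hb,
    setIntegral_congr_ae (h₂ _ hb) ((condExp_indep_eq h₁ h₂ hf hind).mono fun ω h _ => h),
    setIntegral_const]

lemma setIntegral_inter_eq_smul_of_indep {a b : Set Ω} (ha : MeasurableSet[m₁] a)
    (hb : MeasurableSet[m₂] b) :
    ∫ ω in a ∩ b, f ω ∂μ = μ.real b • ∫ ω in a, f ω ∂μ := by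
  rw [Set.inter_comm, ← setIntegral_indicator (h₁ _ ha), setIntegral_eq_smul_of_indep h₁ h₂ hind
    (hf.indicator ha) (hfi.indicator (h₁ _ ha)) hb, integral_indicator (h₁ _ ha)]

lemma setIntegral_condExp_of_mem_sup (hm : m ≤ m₁) {s : Set Ω} (hs : MeasurableSet[m ⊔ m₂] s) :
    ∫ ω in s, (μ[f | m]) ω ∂μ = ∫ ω in s, f ω ∂μ := by
  have hsup : m ⊔ m₂ ≤ mΩ := sup_le (hm.trans h₁) h₂
  induction s, hs using MeasurableSpace.induction_on_inter
    (generateFrom_image2_inter_eq_sup m m₂).symm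
    (isPiSystem_image2_inter (@MeasurableSpace.isPiSystem_measurableSet _ m)
      (@MeasurableSpace.isPiSystem_measurableSet _ m₂)) with
  | empty => simp
  | basic s hs =>
    obtain ⟨a, ha, b, hb, rfl⟩ := hs
    rw [setIntegral_inter_eq_smul_of_indep h₁ h₂ hind (stronglyMeasurable_condExp.mono hm)
        integrable_condExp (hm _ ha) hb,
      setIntegral_inter_eq_smul_of_indep h₁ h₂ hind hf hfi (hm _ ha) hb,
      setIntegral_condExp (hm.trans h₁) hfi ha]
  | compl s hs ih =>
    have h := integral_add_compl (hsup _ hs) (integrable_condExp (μ := μ) (m := m) (f := f))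
    rw [integral_condExp (hm.trans h₁), ← integral_add_compl (hsup _ hs) hfi, ih] at h
    exact add_left_cancel h
  | iUnion s hd hs ih =>
    rw [integral_iUnion (fun k => hsup _ (hs k)) hd integrable_condExp.integrableOn,
      integral_iUnion (fun k => hsup _ (hs k)) hd hfi.integrableOn]
    exact tsum_congr ih

lemma condExp_sup_of_indep (hm : m ≤ m₁) : μ[f | m ⊔ m₂] =ᵐ[μ] μ[f | m] :=
  (ae_eq_condExp_of_forall_setIntegral_eq (sup_le (hm.trans h₁) h₂) hfi
    (fun _ _ _ => integrable_condExp.integrableOn)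
    (fun _ hs _ => setIntegral_condExp_of_mem_sup h₁ h₂ hind hf hfi hm hs)
    (stronglyMeasurable_condExp.mono le_sup_left).aestronglyMeasurable).symm

end Indep

section Finite

variable {n : ℕ} {d : Fin (n + 1) → ℕ} {X Y : Type*} [Fintype X] [Fintype Y]
  {m : MeasurableSpace Ω} {p : ℝ≥0∞} {f : Ω → X → ℝ} {F : Ω → (Σ i, Fin (d i)) → ℝ}

lemma condExp_mulVec (M : Matrix Y X ℝ) (hf : Integrable f μ) :
    μ[fun ω => M *ᵥ f ω | m] =ᵐ[μ] fun ω => M *ᵥ μ[f | m] ω :=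
  ((mulVecCLM M).comp_condExp_comm hf).symm

lemma condExp_comp (hF : Integrable F μ) (i : Fin (n + 1)) :
    μ[fun ω => comp (F ω) i | m] =ᵐ[μ] fun ω => comp (μ[F | m] ω) i :=
  ((compCLM d i).comp_condExp_comm hF).symm

lemma condExp_apply (hf : Integrable f μ) (k : X) :
    μ[fun ω => f ω k | m] =ᵐ[μ] fun ω => μ[f | m] ω k :=
  ((ContinuousLinearMap.proj (R := ℝ) (φ := fun _ : X => ℝ) k).comp_condExp_comm hf).symm

lemma integrable_mulVec (M : Matrix Y X ℝ) (hf : Integrable f μ) :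
    Integrable (fun ω => M *ᵥ f ω) μ :=
  (mulVecCLM M).integrable_comp hf

lemma memLp_mulVec (M : Matrix Y X ℝ) (hf : MemLp f p μ) : MemLp (fun ω => M *ᵥ f ω) p μ :=
  (mulVecCLM M).comp_memLp' hf

lemma memLp_comp (hF : MemLp F p μ) (i : Fin (n + 1)) : MemLp (fun ω => comp (F ω) i) p μ :=
  (compCLM d i).comp_memLp' hF

lemma integrable_comp (hF : Integrable F μ) (i : Fin (n + 1)) :
    Integrable (fun ω => comp (F ω) i) μ :=
  (compCLM d i).integrable_comp hF

lemma memLp_of_comp (hF : ∀ i, MemLp (fun ω => comp (F ω) i) p μ) : MemLp F p μ :=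
  memLp_pi_iff.2 fun ⟨i, k⟩ => memLp_pi_iff.1 (hF i) k

end Finite

end CondExp

/-! ### The σ-algebras generated by the primitive random variables -/

namespace System

variable {n : ℕ} (S : System n) (T : ℕ)

/-- The agent that a primitive random variable belongs to. -/
def owner : S.PrimIndex T → Fin (n + 1)
  | .inl i => i
  | .inr (.inl (i, _)) => i
  | .inr (.inr (i, _)) => i.succ

/-- The primitive random variables that have an effect up to the observation at time `t`: the
process noise `w_i(s)` enters only at time `s + 1`. -/
def IsRealized (t : ℕ) : S.PrimIndex T → Prop
  | .inl _ => True
  | .inr (.inl (_, s)) => (s : ℕ) < t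
  | .inr (.inr (_, s)) => (s : ℕ) ≤ t

/-- The primitive random variables of the agents in `a` that are realized at time `t`. -/
def prims (a : Set (Fin (n + 1))) (t : ℕ) : Set (S.PrimIndex T) :=
  {k | S.owner T k ∈ a ∧ S.IsRealized T t k}

variable {S T}

lemma prims_mono {a b : Set (Fin (n + 1))} (h : a ⊆ b) (t : ℕ) :
    S.prims T a t ⊆ S.prims T b t := fun _ hk => ⟨h hk.1, hk.2⟩

lemma prims_union (a b : Set (Fin (n + 1))) (t : ℕ) :
    S.prims T (a ∪ b) t = S.prims T a t ∪ S.prims T b t := by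
  ext k
  simp only [prims, Set.mem_ofPred_eq, Set.mem_union, or_and_right]

lemma prims_disjoint {a b : Set (Fin (n + 1))} (h : Disjoint a b) (s t : ℕ) :
    Disjoint (S.prims T a s) (S.prims T b t) :=
  Set.disjoint_left.2 fun _ hs ht => Set.disjoint_left.1 h hs.1 ht.1

lemma prims_zero_succ {t : ℕ} (ht : 1 ≤ t) (htT : t ≤ T) :
    S.prims T {0} (t + 1)
      = S.prims T {0} t ∪ {.inr (.inl (0, ⟨t, Finset.mem_Icc.2 ⟨ht, htT⟩⟩))} := by
  ext k
  rcases k with i | ⟨i, s, hs⟩ | ⟨i, s⟩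
  · simp [prims, owner, IsRealized]
  · simp only [prims, owner, IsRealized, Set.mem_ofPred_eq, Set.mem_union, Set.mem_singleton_iff,
      Sum.inr.injEq, Sum.inl.injEq, Prod.mk.injEq, Subtype.mk.injEq, ← and_or_left,
      Nat.lt_succ_iff_lt_or_eq]
  · simp [prims, owner, Fin.succ_ne_zero]

end System

namespace Primitives

variable {n : ℕ} {S : System n} {Ω : Type*} (P : Primitives S Ω)

/-- The σ-algebra generated by the primitive random variables in `s`. -/
abbrev sig (T : ℕ) (s : Set (S.PrimIndex T)) : MeasurableSpace Ω :=
  ⨆ k ∈ s, MeasurableSpace.comap (P.family T k) inferInstance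

variable {P} {T : ℕ}

lemma sig_mono {s s' : Set (S.PrimIndex T)} (h : s ⊆ s') : P.sig T s ≤ P.sig T s' :=
  biSup_mono h

lemma sig_union (s s' : Set (S.PrimIndex T)) : P.sig T (s ∪ s') = P.sig T s ⊔ P.sig T s' :=
  iSup_union

lemma measurable_sig {s : Set (S.PrimIndex T)} {k : S.PrimIndex T} (hk : k ∈ s) :
    Measurable[P.sig T s] (P.family T k) :=
  Measurable.of_comap_le (le_biSup
    (fun k => MeasurableSpace.comap (P.family T k) inferInstance) hk)

section Prims

variable {a : Set (Fin (n + 1))} {i : Fin (n + 1)} (hi : i ∈ a) {s t : ℕ}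

include hi

lemma measurable_sig_init : Measurable[P.sig T (S.prims T a t)] (P.init i) :=
  measurable_sig (k := .inl i) ⟨hi, trivial⟩

lemma measurable_sig_w (hs : 1 ≤ s) (hst : s < t) (hsT : s ≤ T) :
    Measurable[P.sig T (S.prims T a t)] (P.w i s) :=
  measurable_sig (k := .inr (.inl (i, ⟨s, Finset.mem_Icc.2 ⟨hs, hsT⟩⟩))) ⟨hi, hst⟩

end Prims

lemma measurable_sig_v {a : Set (Fin (n + 1))} {i : Fin n} (hi : i.succ ∈ a) {s t : ℕ}
    (hs : 1 ≤ s) (hst : s ≤ t) (hsT : s ≤ T) :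
    Measurable[P.sig T (S.prims T a t)] (P.v i s) :=
  measurable_sig (k := .inr (.inr (i, ⟨s, Finset.mem_Icc.2 ⟨hs, hsT⟩⟩))) ⟨hi, hst⟩

lemma measurable_sig_freeState {a : Set (Fin (n + 1))} {i : Fin n} (hi : i.succ ∈ a) {s t : ℕ}
    (hs : 1 ≤ s) (hst : s ≤ t) (htT : t ≤ T) :
    Measurable[P.sig T (S.prims T a t)] (P.freeState i s) := by
  let _ : MeasurableSpace Ω := P.sig T (S.prims T a t)
  induction s, hs using Nat.le_induction with
  | base => exact measurable_sig_init hi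
  | succ s hs ih =>
    rw [funext (P.freeState_succ i hs)]
    exact (measurable_mulVec _ (ih (by omega))).add
      (measurable_sig_w hi hs hst (by omega))

section ClosedLoop

variable (g : S.Strategy) {a : Set (Fin (n + 1))} (h₀ : 0 ∈ a) {t : ℕ} (ht : 1 ≤ t) (htT : t ≤ T)

include h₀ ht htT

lemma measurable_sig_infoMajor : Measurable[P.sig T (S.prims T a t)] (P.infoMajor g t) := by
  let _ : MeasurableSpace Ω := P.sig T (S.prims T a t)
  exact (P.measurable_infoMajor_iff_noise g ht).2
    ⟨measurable_sig_init h₀, fun s hs hst => measurable_sig_w h₀ hs hst (by omega)⟩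

lemma measurable_sig_infoMinor {i : Fin n} (hi : i.succ ∈ a) :
    Measurable[P.sig T (S.prims T a t)] (P.infoMinor g i t) := by
  let _ : MeasurableSpace Ω := P.sig T (S.prims T a t)
  exact (P.measurable_infoMinor_iff_freeOutput g i).2 ⟨measurable_sig_infoMajor g h₀ ht htT,
    fun s hs hst => (measurable_mulVec _ (measurable_sig_freeState hi hs hst htT)).add
      (measurable_sig_v hi hs hst (by omega))⟩

end ClosedLoop

lemma sigmaMajor_le_sigmaMinor (g : S.Strategy) (i : Fin n) (t : ℕ) :
    P.sigmaMajor g t ≤ P.sigmaMinor g i t := by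
  let _ : MeasurableSpace Ω := P.sigmaMinor g i t
  exact ((P.measurable_infoMinor_iff g i).1 (comap_measurable (P.infoMinor g i t))).1.comap_le

lemma measurable_sigmaMajor_state (g : S.Strategy) {t : ℕ} (ht : 1 ≤ t) :
    Measurable[P.sigmaMajor g t] fun ω => comp (P.state g t ω) 0 := by
  let _ : MeasurableSpace Ω := P.sigmaMajor g t
  exact ((P.measurable_infoMajor_iff g).1 (comap_measurable (P.infoMajor g t))).1 t ht le_rfl

lemma measurable_sigmaMajor_control (g : S.Strategy) {t : ℕ} (ht : 1 ≤ t) :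
    Measurable[P.sigmaMajor g t] fun ω => comp (P.control g t ω) 0 := by
  let _ : MeasurableSpace Ω := P.sigmaMajor g t
  simp only [P.comp_control_zero g ht]
  exact (g.measurable_major t).comp (comap_measurable (P.infoMajor g t))

lemma measurable_sigmaMinor_control (g : S.Strategy) (i : Fin n) {t : ℕ} (ht : 1 ≤ t) :
    Measurable[P.sigmaMinor g i t] fun ω => comp (P.control g t ω) i.succ := by
  let _ : MeasurableSpace Ω := P.sigmaMinor g i t
  simp only [P.comp_control_succ g ht]
  exact (g.measurable_minor i t).comp (comap_measurable (P.infoMinor g i t))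

section ClosedLoop

variable (g : S.Strategy) {t : ℕ} (ht : 1 ≤ t) (htT : t ≤ T)

include ht htT

lemma sigmaMajor_eq : P.sigmaMajor g t = P.sig T (S.prims T {0} t) := by
  refine le_antisymm (measurable_sig_infoMajor g (Set.mem_singleton 0) ht htT).comap_le ?_
  let _ : MeasurableSpace Ω := P.sigmaMajor g t
  obtain ⟨hinit, hw⟩ :=
    (P.measurable_infoMajor_iff_noise g ht).1 (comap_measurable (P.infoMajor g t))
  refine iSup₂_le fun k hk => ?_
  rcases k with i | ⟨i, s, hs⟩ | ⟨i, s⟩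
  · obtain ⟨rfl, -⟩ := hk
    exact Measurable.comap_le hinit
  · obtain ⟨rfl, hst⟩ := hk
    exact Measurable.comap_le (hw s (Finset.mem_Icc.1 hs).1 hst)
  · exact absurd hk.1 (Fin.succ_ne_zero i)

lemma sigmaMinor_le_sig (i : Fin n) :
    P.sigmaMinor g i t ≤ P.sig T (S.prims T {0, i.succ} t) :=
  (measurable_sig_infoMinor g (by simp) ht htT (by simp)).comap_le

lemma measurable_sig_state_succ {a : Set (Fin (n + 1))} (h₀ : 0 ∈ a) {i : Fin n}
    (hi : i.succ ∈ a) :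
    Measurable[P.sig T (S.prims T a t)] fun ω => comp (P.state g t ω) i.succ := by
  have hdiff := (P.measurable_sigmaMinor_state_sub_freeState g i ht).mono
    (measurable_sig_infoMinor g h₀ ht htT hi).comap_le le_rfl
  convert hdiff.add (measurable_sig_freeState hi ht le_rfl htT) using 1
  exact (sub_add_cancel _ _).symm

lemma measurable_sig_state : Measurable[P.sig T (S.prims T Set.univ t)] (P.state g t) := by
  let _ : MeasurableSpace Ω := P.sig T (S.prims T Set.univ t)
  refine measurable_of_comp fun i => ?_
  cases i using Fin.cases with
  | zero =>
    exact (measurable_sigmaMajor_state g ht).mono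
      (measurable_sig_infoMajor g (Set.mem_univ _) ht htT).comap_le le_rfl
  | succ i => exact measurable_sig_state_succ g ht htT (Set.mem_univ _) (Set.mem_univ _)

lemma measurable_sig_control : Measurable[P.sig T (S.prims T Set.univ t)] (P.control g t) := by
  let _ : MeasurableSpace Ω := P.sig T (S.prims T Set.univ t)
  refine measurable_of_comp fun i => ?_
  cases i using Fin.cases with
  | zero =>
    exact (measurable_sigmaMajor_control g ht).mono
      (measurable_sig_infoMajor g (Set.mem_univ _) ht htT).comap_le le_rfl
  | succ i =>
    exact (measurable_sigmaMinor_control g i ht).mono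
      (measurable_sig_infoMinor g (Set.mem_univ _) ht htT (Set.mem_univ _)).comap_le le_rfl

end ClosedLoop

namespace Admissible

variable [mΩ : MeasurableSpace Ω] {μ : Measure Ω} (hP : P.Admissible T μ)

include hP

lemma sig_le (s : Set (S.PrimIndex T)) : P.sig T s ≤ mΩ :=
  iSup₂_le fun k _ => (hP.measurable k).comap_le

lemma indep_sig {s s' : Set (S.PrimIndex T)} (h : Disjoint s s') :
    Indep (P.sig T s) (P.sig T s') μ :=
  indep_iSup_of_disjoint (fun k => (hP.measurable k).comap_le) hP.indep.iIndep h

lemma condExp_sig_union [IsFiniteMeasure μ] {E : Type*} [NormedAddCommGroup E] [NormedSpace ℝ E]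
    [CompleteSpace E] {a b c : Set (S.PrimIndex T)} (hb : b ⊆ a) (hc : Disjoint a c)
    {f : Ω → E} (hf : StronglyMeasurable[P.sig T a] f) (hfi : Integrable f μ) :
    μ[f | P.sig T (b ∪ c)] =ᵐ[μ] μ[f | P.sig T b] := by
  rw [sig_union]
  exact condExp_sup_of_indep (hP.sig_le _) (hP.sig_le _) (hP.indep_sig hc) hf hfi (sig_mono hb)

lemma condExp_family_eq_zero [IsFiniteMeasure μ] {k : S.PrimIndex T} {a : Set (S.PrimIndex T)}
    (hk : k ∉ a) : μ[P.family T k | P.sig T a] =ᵐ[μ] 0 := by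
  have h := condExp_indep_eq (hP.sig_le {k}) (hP.sig_le a)
    (measurable_sig (P := P) (Set.mem_singleton k)).stronglyMeasurable
    (hP.indep_sig (Set.disjoint_singleton_left.2 hk))
  rw [hP.mean_zero k] at h
  exact h

lemma memLp_init (i : Fin (n + 1)) : MemLp (P.init i) 2 μ := hP.memLp (.inl i)

lemma memLp_state_one (g : S.Strategy) : MemLp (P.state g 1) 2 μ :=
  memLp_of_comp fun i => hP.memLp_init i

section ClosedLoop

variable (g : S.Strategy) (i : Fin n) {t : ℕ} (ht : 1 ≤ t) (htT : t ≤ T)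

include ht htT

lemma sigmaMajor_le : P.sigmaMajor g t ≤ mΩ := by
  rw [sigmaMajor_eq g ht htT]
  exact hP.sig_le _

lemma sigmaMinor_le : P.sigmaMinor g i t ≤ mΩ :=
  (sigmaMinor_le_sig g ht htT i).trans (hP.sig_le _)

lemma measurable_control : Measurable (P.control g t) :=
  (measurable_sig_control g ht htT).mono (hP.sig_le _) le_rfl

lemma measurable_infoMajor : Measurable (P.infoMajor g t) :=
  Measurable.of_comap_le (hP.sigmaMajor_le g ht htT)

lemma measurable_infoMinor : Measurable (P.infoMinor g i t) :=
  Measurable.of_comap_le (hP.sigmaMinor_le g i ht htT)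

lemma memLp_w (i : Fin (n + 1)) : MemLp (P.w i t) 2 μ :=
  hP.memLp (.inr (.inl (i, ⟨t, Finset.mem_Icc.2 ⟨ht, htT⟩⟩)))

lemma memLp_stack_w : MemLp (fun ω => stack fun i => P.w i t ω) 2 μ :=
  memLp_of_comp fun i => hP.memLp_w ht htT i

lemma memLp_state_succ [IsFiniteMeasure μ] {p : ℝ≥0∞} (hp : p ≤ 2)
    (hx : MemLp (P.state g t) p μ) (hu : MemLp (P.control g t) p μ) :
    MemLp (P.state g (t + 1)) p μ := by
  rw [funext (P.state_succ g ht)]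
  exact ((memLp_mulVec S.A hx).add (memLp_mulVec S.B hu)).add
    ((hP.memLp_stack_w ht htT).mono_exponent hp)

lemma memLp_state [IsFiniteMeasure μ] {p : ℝ≥0∞} (hp : p ≤ 2)
    (hu : ∀ t, 1 ≤ t → t < T → MemLp (P.control g t) p μ) : MemLp (P.state g t) p μ := by
  induction t, ht using Nat.le_induction with
  | base => exact (hP.memLp_state_one g).mono_exponent hp
  | succ t ht ih => exact hP.memLp_state_succ g ht (by omega) hp (ih (by omega)) (hu t ht htT)

lemma integrable_state [IsFiniteMeasure μ]
    (hu : ∀ t, 1 ≤ t → t < T → Integrable (P.control g t) μ) : Integrable (P.state g t) μ :=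
  memLp_one_iff_integrable.1 (hP.memLp_state g ht htT one_le_two
    fun s hs hsT => memLp_one_iff_integrable.2 (hu s hs hsT))

lemma memLp_freeState : MemLp (P.freeState i t) 2 μ := by
  induction t, ht using Nat.le_induction with
  | base => exact hP.memLp_init i.succ
  | succ t ht ih =>
    rw [funext (P.freeState_succ i ht)]
    exact (memLp_mulVec (block S.A i.succ i.succ) (ih (by omega))).add
      (hP.memLp_w ht (by omega) i.succ)

end ClosedLoop

end Admissible

end Primitives

/-! ### The major agent's estimate -/

namespace Primitives.Admissible

variable {n : ℕ} {S : System n} {Ω : Type*} {P : Primitives S Ω} {T : ℕ}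
  [mΩ : MeasurableSpace Ω] {μ : Measure Ω} [IsFiniteMeasure μ] (hP : P.Admissible T μ)

include hP

lemma estMajor_one (g : S.Strategy) (hT : 1 ≤ T) :
    ∀ᵐ ω ∂μ, P.estMajor μ g 1 ω = stackMM (comp (P.state g 1 ω) 0) fun _ => 0 := by
  have hx : Integrable (P.state g 1) μ := (hP.memLp_state_one g).integrable one_le_two
  have hmajor := condExp_of_stronglyMeasurable (hP.sigmaMajor_le g le_rfl hT)
    (measurable_sigmaMajor_state (P := P) g le_rfl).stronglyMeasurable (integrable_comp hx 0)
  have hminor (i : Fin n) : μ[P.init i.succ | P.sigmaMajor g 1] =ᵐ[μ] 0 := by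
    rw [sigmaMajor_eq g le_rfl hT]
    exact hP.condExp_family_eq_zero (k := .inl i.succ) fun h => Fin.succ_ne_zero i h.1
  filter_upwards [ae_all_iff.2 fun i => condExp_comp (m := P.sigmaMajor g 1) hx i,
    ae_all_iff.2 hminor] with ω hcomp hminor
  refine ext_comp fun i => ?_
  rw [estMajor, ← hcomp i]
  cases i using Fin.cases with
  | zero => rw [hmajor, comp_stackMM_zero]
  | succ i => exact (hminor i).trans (comp_stackMM_succ _ (fun _ => 0) i).symm

section ClosedLoop

variable (g : S.Strategy) {t : ℕ} (ht : 1 ≤ t)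

include ht

section Le

variable (htT : t ≤ T)

include htT

lemma comp_estMajor_zero (hx : Integrable (P.state g t) μ) :
    ∀ᵐ ω ∂μ, comp (P.estMajor μ g t ω) 0 = comp (P.state g t ω) 0 := by
  have h := condExp_of_stronglyMeasurable (hP.sigmaMajor_le g ht htT)
    (measurable_sigmaMajor_state (P := P) g ht).stronglyMeasurable (integrable_comp hx 0)
  filter_upwards [condExp_comp (m := P.sigmaMajor g t) hx 0] with ω hω
  rw [estMajor, ← hω, h]

lemma comp_commonControl_zero (hu : Integrable (P.control g t) μ) :
    ∀ᵐ ω ∂μ, comp (P.commonControl μ g t ω) 0 = comp (P.control g t ω) 0 := by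
  have h := condExp_of_stronglyMeasurable (hP.sigmaMajor_le g ht htT)
    (measurable_sigmaMajor_control (P := P) g ht).stronglyMeasurable (integrable_comp hu 0)
  filter_upwards [condExp_comp (m := P.sigmaMajor g t) hu 0] with ω hω
  rw [commonControl, ← hω, h]

end Le

variable (htT : t < T)

include htT

lemma condExp_sigmaMajor_succ_stack_w :
    ∀ᵐ ω ∂μ, μ[fun ω => stack fun i => P.w i t ω | P.sigmaMajor g (t + 1)] ω
      = stackMM (P.w 0 t ω) fun _ => 0 := by
  rw [sigmaMajor_eq g (by omega) htT]
  have hw := (hP.memLp_stack_w ht htT.le).integrable one_le_two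
  have hmajor := condExp_of_stronglyMeasurable (μ := μ) (hP.sig_le (S.prims T {0} (t + 1)))
    (measurable_sig_w (P := P) (Set.mem_singleton 0) ht t.lt_succ_self htT.le).stronglyMeasurable
    ((hP.memLp_w ht htT.le 0).integrable one_le_two)
  have hminor (i : Fin n) : μ[P.w i.succ t | P.sig T (S.prims T {0} (t + 1))] =ᵐ[μ] 0 :=
    hP.condExp_family_eq_zero (k := .inr (.inl (i.succ, ⟨t, Finset.mem_Icc.2 ⟨ht, htT.le⟩⟩)))
      fun h => Fin.succ_ne_zero i h.1
  filter_upwards [ae_all_iff.2 fun i => condExp_comp (m := P.sig T (S.prims T {0} (t + 1))) hw i,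
    ae_all_iff.2 hminor] with ω hcomp hminor
  refine ext_comp fun i => ?_
  rw [← hcomp i]
  simp only [comp_stack]
  cases i using Fin.cases with
  | zero => exact congrFun hmajor ω
  | succ i => exact hminor i

/-- The new information `w_0(t)` in `I^c(t + 1)` is independent of everything up to time `t`. -/
lemma condExp_sigmaMajor_succ {E : Type*} [NormedAddCommGroup E] [NormedSpace ℝ E]
    [CompleteSpace E] {f : Ω → E} (hf : StronglyMeasurable[P.sig T (S.prims T Set.univ t)] f)
    (hfi : Integrable f μ) : μ[f | P.sigmaMajor g (t + 1)] =ᵐ[μ] μ[f | P.sigmaMajor g t] := by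
  rw [sigmaMajor_eq g (by omega) htT, sigmaMajor_eq g ht htT.le, System.prims_zero_succ ht htT.le]
  refine hP.condExp_sig_union (System.prims_mono (Set.subset_univ _) t)
    (Set.disjoint_singleton_right.2 ?_) hf hfi
  exact fun h => lt_irrefl t h.2

lemma estMajor_succ (hx : Integrable (P.state g t) μ) (hu : Integrable (P.control g t) μ) :
    ∀ᵐ ω ∂μ, P.estMajor μ g (t + 1) ω = S.A *ᵥ P.estMajor μ g t ω
      + S.B *ᵥ P.commonControl μ g t ω + stackMM (P.w 0 t ω) fun _ => 0 := by
  have hw := (hP.memLp_stack_w ht htT.le).integrable one_le_two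
  have hAx := integrable_mulVec S.A hx
  have hBu := integrable_mulVec S.B hu
  have hstate : P.state g (t + 1) = (fun ω => S.A *ᵥ P.state g t ω)
      + (fun ω => S.B *ᵥ P.control g t ω) + fun ω => stack fun i => P.w i t ω :=
    funext (P.state_succ g ht)
  filter_upwards [condExp_add (hAx.add hBu) hw (P.sigmaMajor g (t + 1)),
    condExp_add hAx hBu (P.sigmaMajor g (t + 1)), hP.condExp_sigmaMajor_succ_stack_w g ht htT,
    condExp_mulVec (m := P.sigmaMajor g (t + 1)) S.A hx,
    condExp_mulVec (m := P.sigmaMajor g (t + 1)) S.B hu,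
    hP.condExp_sigmaMajor_succ g ht htT (measurable_sig_state g ht htT.le).stronglyMeasurable hx,
    hP.condExp_sigmaMajor_succ g ht htT (measurable_sig_control g ht htT.le).stronglyMeasurable hu]
    with ω hadd hadd' hw hA hB hx hu
  rw [estMajor, hstate, hadd, Pi.add_apply, hadd', Pi.add_apply, hw, hA, hB, hx, hu]
  rfl

end ClosedLoop

end Primitives.Admissible

/-! ### Conditional densities -/

section Density

variable {Ω 𝓨 : Type*} [MeasurableSpace Ω] [MeasurableSpace 𝓨] {μ : Measure Ω} {d k : ℕ}
  {X : Ω → Fin d → ℝ} {Y : Ω → 𝓨}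

/-- The pair `(Y, X)` of random variables has the joint density `q` with respect to `ρ ⊗ dx`. The
filter is a recursion for unnormalized densities of this kind, where `Y` is the data and `X` the
state that is to be estimated. -/
structure HasJointDensity (μ : Measure Ω) (Y : Ω → 𝓨) (X : Ω → Fin d → ℝ) (ρ : Measure 𝓨)
    (q : 𝓨 → (Fin d → ℝ) → ℝ≥0∞) : Prop where
  measurable_left : Measurable Y
  measurable_right : Measurable X
  measurable_density : Measurable (Function.uncurry q)
  map_eq : μ.map (fun ω => (Y ω, X ω)) = (ρ.prod volume).withDensity (Function.uncurry q)

lemma HasJointDensity.lintegral_eq {ρ : Measure 𝓨} {q : 𝓨 → (Fin d → ℝ) → ℝ≥0∞}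
    (hq : HasJointDensity μ Y X ρ q) {h : 𝓨 × (Fin d → ℝ) → ℝ≥0∞} (hh : Measurable h) :
    ∫⁻ ω, h (Y ω, X ω) ∂μ = ∫⁻ y, (∫⁻ x, q y x * h (y, x)) ∂ρ := by
  rw [← lintegral_map hh (hq.measurable_left.prodMk hq.measurable_right), hq.map_eq,
    lintegral_withDensity_eq_lintegral_mul _ hq.measurable_density hh,
    lintegral_prod _ (hq.measurable_density.mul hh).aemeasurable]
  rfl

lemma HasJointDensity.of_lintegral_eq (hY : Measurable Y) (hX : Measurable X) {ρ : Measure 𝓨}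
    {q : 𝓨 → (Fin d → ℝ) → ℝ≥0∞} (hq : Measurable (Function.uncurry q))
    (h_eq : ∀ h : 𝓨 × (Fin d → ℝ) → ℝ≥0∞, Measurable h →
      ∫⁻ ω, h (Y ω, X ω) ∂μ = ∫⁻ y, (∫⁻ x, q y x * h (y, x)) ∂ρ) :
    HasJointDensity μ Y X ρ q where
  measurable_left := hY
  measurable_right := hX
  measurable_density := hq
  map_eq := by
    refine Measure.ext_of_lintegral _ fun h hh => ?_
    rw [lintegral_map hh (hY.prodMk hX), h_eq h hh,
      lintegral_withDensity_eq_lintegral_mul _ hq hh, lintegral_prod _ (hq.mul hh).aemeasurable]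
    rfl

lemma HasJointDensity.map {𝓘 : Type*} [MeasurableSpace 𝓘] {ρ : Measure 𝓨} {N : 𝓨 → 𝓘}
    (hN : Measurable N) {q : 𝓘 → (Fin d → ℝ) → ℝ≥0∞} (hqm : Measurable (Function.uncurry q))
    (hq : HasJointDensity μ Y X ρ fun y => q (N y)) :
    HasJointDensity μ (fun ω => N (Y ω)) X (ρ.map N) q := by
  have hNY : Measurable fun ω => N (Y ω) := hN.comp hq.measurable_left
  refine .of_lintegral_eq hNY hq.measurable_right hqm fun h hh => ?_
  have hNh : Measurable fun p : 𝓨 × (Fin d → ℝ) => h (N p.1, p.2) :=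
    hh.comp ((hN.comp measurable_fst).prodMk measurable_snd)
  exact (hq.lintegral_eq hNh).trans (lintegral_map (hqm.mul hh).lintegral_prod_right' hN).symm

lemma lintegral_mul_div_lintegral_ae_eq {α : Type*} [MeasurableSpace α] {ν : Measure α}
    {f : α → ℝ≥0∞} (hf : Measurable f) (hfin : ∫⁻ x, f x ∂ν ≠ ∞) :
    (fun x => (∫⁻ x', f x' ∂ν) * (f x / ∫⁻ x', f x' ∂ν)) =ᵐ[ν] f := by
  by_cases h0 : ∫⁻ x, f x ∂ν = 0
  · filter_upwards [(lintegral_eq_zero_iff hf).1 h0] with x hx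
    rw [h0, zero_mul, hx, Pi.zero_apply]
  · exact .of_forall fun x => ENNReal.mul_div_cancel h0 hfin

section Normalize

variable {ρ : Measure 𝓨} {q : 𝓨 → (Fin d → ℝ) → ℝ≥0∞} (hq : HasJointDensity μ Y X ρ q)

include hq

lemma HasJointDensity.measurable_density_apply (y : 𝓨) : Measurable (q y) :=
  hq.measurable_density.comp measurable_prodMk_left

lemma HasJointDensity.lintegral_left_eq {h : 𝓨 → ℝ≥0∞} (hh : Measurable h) :
    ∫⁻ ω, h (Y ω) ∂μ = ∫⁻ y, (∫⁻ x, q y x) * h y ∂ρ :=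
  (hq.lintegral_eq (hh.comp measurable_fst)).trans <|
    lintegral_congr fun y => lintegral_mul_const (h y) (hq.measurable_density_apply y)

lemma HasJointDensity.ae_lintegral_ne_top [IsFiniteMeasure μ] :
    ∀ᵐ y ∂ρ, ∫⁻ x, q y x ≠ ∞ := by
  have hmass : ∫⁻ y, (∫⁻ x, q y x) ∂ρ = μ Set.univ := by
    simpa using (hq.lintegral_left_eq measurable_one).symm
  filter_upwards [ae_lt_top hq.measurable_density.lintegral_prod_right'
    (hmass ▸ measure_ne_top μ _)] with y hy using hy.ne

lemma HasJointDensity.lintegral_div_eq [IsFiniteMeasure μ] {h : 𝓨 × (Fin d → ℝ) → ℝ≥0∞}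
    (hh : Measurable h) :
    ∫⁻ ω, h (Y ω, X ω) ∂μ
      = ∫⁻ ω, (∫⁻ x, q (Y ω) x / (∫⁻ x', q (Y ω) x') * h (Y ω, x)) ∂μ := by
  have hqm := hq.measurable_density
  have hdiv : Measurable fun p : 𝓨 × (Fin d → ℝ) => q p.1 p.2 / (∫⁻ x', q p.1 x') * h p :=
    (hqm.div (hqm.lintegral_prod_right'.comp measurable_fst)).mul hh
  rw [hq.lintegral_eq hh, hq.lintegral_left_eq
    (h := fun y => ∫⁻ x, q y x / (∫⁻ x', q y x') * h (y, x)) hdiv.lintegral_prod_right']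
  refine lintegral_congr_ae ?_
  filter_upwards [hq.ae_lintegral_ne_top] with y hy
  have hdivy : Measurable fun x => q y x / (∫⁻ x', q y x') * h (y, x) :=
    hdiv.comp measurable_prodMk_left
  rw [← lintegral_const_mul _ hdivy]
  refine lintegral_congr_ae ?_
  filter_upwards [lintegral_mul_div_lintegral_ae_eq (hq.measurable_density_apply y) hy] with x hx
  rw [← mul_assoc, hx]

lemma HasJointDensity.isCondDensity [IsFiniteMeasure μ] :
    IsCondDensity μ X Y fun y x => q y x / ∫⁻ x', q y x' := by
  have hY := hq.measurable_left
  have hX := hq.measurable_right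
  have hf : Measurable (Function.uncurry fun y x => q y x / ∫⁻ x', q y x') :=
    hq.measurable_density.div (hq.measurable_density.lintegral_prod_right'.comp measurable_fst)
  let κ : Kernel 𝓨 (Fin d → ℝ) :=
    Kernel.withDensity (Kernel.const 𝓨 volume) fun y x => q y x / ∫⁻ x', q y x'
  have hκ (y : 𝓨) : κ y = volume.withDensity fun x => q y x / ∫⁻ x', q y x' := by
    rw [Kernel.withDensity_apply _ hf, Kernel.const_apply]
  have hfinite : IsFiniteKernel κ := by
    refine ⟨⟨1, ENNReal.one_lt_top, fun y => ?_⟩⟩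
    rw [hκ, withDensity_apply _ MeasurableSet.univ, setLIntegral_univ]
    simp only [div_eq_mul_inv]
    rw [lintegral_mul_const _ (hq.measurable_density_apply y)]
    exact ENNReal.div_self_le_one
  have hlaw : μ.map (fun ω => (Y ω, X ω)) = μ.map Y ⊗ₘ κ := by
    refine Measure.ext_of_lintegral _ fun h hh => ?_
    rw [lintegral_map hh (hY.prodMk hX), Measure.lintegral_compProd hh,
      lintegral_map hh.lintegral_kernel_prod_right' hY, hq.lintegral_div_eq hh]
    refine lintegral_congr fun ω => ?_
    rw [hκ]
    exact (lintegral_withDensity_eq_lintegral_mul _ (hf.comp measurable_prodMk_left)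
      (hh.comp measurable_prodMk_left)).symm
  refine ⟨hf, ?_⟩
  filter_upwards [ae_of_ae_map hY.aemeasurable
    (condDistrib_ae_eq_of_measure_eq_compProd_of_measurable hY hX hlaw)] with ω hω
  rw [hω, hκ]

end Normalize

lemma IsCondDensity.hasJointDensity [IsFiniteMeasure μ] {f : 𝓨 → (Fin d → ℝ) → ℝ≥0∞}
    (hf : IsCondDensity μ X Y f) (hX : Measurable X) (hY : Measurable Y) :
    HasJointDensity μ Y X (μ.map Y) f := by
  refine .of_lintegral_eq hY hX hf.1 fun h hh => ?_
  rw [← lintegral_map hh (hY.prodMk hX), ← compProd_map_condDistrib hX.aemeasurable,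
    Measure.lintegral_compProd hh, lintegral_map hh.lintegral_kernel_prod_right' hY]
  refine .trans (lintegral_congr_ae ?_)
    (lintegral_map (hf.1.mul hh).lintegral_prod_right' hY).symm
  filter_upwards [hf.2] with ω hω
  rw [hω]
  exact lintegral_withDensity_eq_lintegral_mul _ (hf.1.comp measurable_prodMk_left)
    (hh.comp measurable_prodMk_left)

lemma IsCondDensity.condExp_eq_integral [IsFiniteMeasure μ] {f : 𝓨 → (Fin d → ℝ) → ℝ≥0∞}
    (hf : IsCondDensity μ X Y f) (hX : Integrable X μ) (hY : Measurable Y) :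
    ∀ᵐ ω ∂μ, Integrable (fun x => (f (Y ω) x).toReal • x) volume ∧
      μ[X | MeasurableSpace.comap Y inferInstance] ω = ∫ x, (f (Y ω) x).toReal • x := by
  have hcond : ∀ᵐ ω ∂μ, Integrable (fun x => x) (condDistrib X Y μ (Y ω)) :=
    Integrable.condDistrib_ae hY.aemeasurable hX.1.aemeasurable
      (f := fun p : 𝓨 × (Fin d → ℝ) => p.2)
      ((integrable_map_measure measurable_snd.aestronglyMeasurable
        (hY.aemeasurable.prodMk hX.1.aemeasurable)).2 hX)
  filter_upwards [hf.2, hcond, condExp_ae_eq_integral_condDistrib' hY hX] with ω hω hint hexp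
  have hfm : Measurable (f (Y ω)) := hf.1.comp measurable_prodMk_left
  have hmass : ∫⁻ x, f (Y ω) x = 1 := by
    rw [← setLIntegral_univ, ← withDensity_apply _ MeasurableSet.univ, ← hω, measure_univ]
  have hfin : ∀ᵐ x, f (Y ω) x < ∞ := ae_lt_top hfm (hmass ▸ ENNReal.one_ne_top)
  rw [hω] at hint hexp
  refine ⟨(integrable_withDensity_iff_integrable_smul' hfm hfin).1 hint, ?_⟩
  rw [hexp, integral_withDensity_eq_integral_toReal_smul hfm hfin]

section AddNoise

variable [IsFiniteMeasure μ] {W : Ω → Fin k → ℝ} {φ : (Fin k → ℝ) → ℝ≥0∞}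
  (hW : Measurable W) (hφ : HasDensity μ W φ)

include hW hφ

lemma HasDensity.hasJointDensity_of_indepFun (hY : Measurable Y) (hind : IndepFun Y W μ) :
    HasJointDensity μ Y W (μ.map Y) fun _ => φ where
  measurable_left := hY
  measurable_right := hW
  measurable_density := hφ.1.comp measurable_snd
  map_eq := by
    rw [(indepFun_iff_map_prod_eq_prod_map_map hY.aemeasurable hW.aemeasurable).1 hind, hφ.2,
      prod_withDensity_right hφ.1]
    rfl

lemma HasDensity.hasJointDensity_add (hY : Measurable Y) (hind : IndepFun Y W μ)
    {F : 𝓨 → Fin k → ℝ} (hF : Measurable F) :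
    HasJointDensity μ Y (fun ω => F (Y ω) + W ω) (μ.map Y) fun y x => φ (x - F y) := by
  have hFW : Measurable fun ω => F (Y ω) + W ω := (hF.comp hY).add hW
  refine .of_lintegral_eq hY hFW
    (hφ.1.comp (measurable_snd.sub (hF.comp measurable_fst))) fun h hh => ?_
  have hFh : Measurable fun p : 𝓨 × (Fin k → ℝ) => h (p.1, F p.1 + p.2) :=
    hh.comp (measurable_fst.prodMk ((hF.comp measurable_fst).add measurable_snd))
  refine ((hφ.hasJointDensity_of_indepFun hW hY hind).lintegral_eq hFh).trans ?_
  refine lintegral_congr fun y => ?_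
  rw [← lintegral_sub_right_eq_self _ (F y)]
  simp only [add_sub_cancel]

section Joint

variable {ρ : Measure 𝓨} {q : 𝓨 → (Fin d → ℝ) → ℝ≥0∞} (hq : HasJointDensity μ Y X ρ q)
  (hind : IndepFun (fun ω => (Y ω, X ω)) W μ) {F : 𝓨 → (Fin d → ℝ) → Fin k → ℝ}
  (hF : Measurable (Function.uncurry F))

include hq hF

omit [IsFiniteMeasure μ] in
omit hW in
lemma HasJointDensity.measurable_density_sub_mul :
    Measurable fun p : (𝓨 × (Fin k → ℝ)) × (Fin d → ℝ) =>
      φ (p.1.2 - F p.1.1 p.2) * q p.1.1 p.2 := by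
  have hyx : Measurable fun p : (𝓨 × (Fin k → ℝ)) × (Fin d → ℝ) => (p.1.1, p.2) := by fun_prop
  exact (hφ.1.comp (measurable_fst.snd.sub (hF.comp hyx))).mul (hq.measurable_density.comp hyx)

include hind

lemma HasJointDensity.lintegral_add {h : 𝓨 × (Fin d → ℝ) × (Fin k → ℝ) → ℝ≥0∞}
    (hh : Measurable h) :
    ∫⁻ ω, h (Y ω, X ω, F (Y ω) (X ω) + W ω) ∂μ
      = ∫⁻ y, (∫⁻ x, ∫⁻ z, q y x * (φ (z - F y x) * h (y, x, z))) ∂ρ := by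
  have hpair := hq.measurable_left.prodMk hq.measurable_right
  have hassoc : Measurable fun p : (𝓨 × (Fin d → ℝ)) × (Fin k → ℝ) => h (p.1.1, p.1.2, p.2) := by
    fun_prop
  have hφF : Measurable fun p : (𝓨 × (Fin d → ℝ)) × (Fin k → ℝ) =>
      φ (p.2 - F p.1.1 p.1.2) * h (p.1.1, p.1.2, p.2) :=
    (hφ.1.comp (measurable_snd.sub (hF.comp measurable_fst))).mul hassoc
  calc ∫⁻ ω, h (Y ω, X ω, F (Y ω) (X ω) + W ω) ∂μ
      = ∫⁻ ω, (∫⁻ z, φ (z - F (Y ω) (X ω)) * h (Y ω, X ω, z)) ∂μ := by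
        rw [← lintegral_map (g := fun ω => (Y ω, X ω))
            (f := fun p => ∫⁻ z, φ (z - F p.1 p.2) * h (p.1, p.2, z))
            hφF.lintegral_prod_right' hpair]
        exact (hφ.hasJointDensity_add hW hpair hind hF).lintegral_eq hassoc
    _ = ∫⁻ y, (∫⁻ x, q y x * ∫⁻ z, φ (z - F y x) * h (y, x, z)) ∂ρ :=
        hq.lintegral_eq hφF.lintegral_prod_right'
    _ = _ := lintegral_congr fun y => lintegral_congr fun x =>
        (lintegral_const_mul _ (hφF.comp (measurable_prodMk_left (x := (y, x))))).symm

/-- The prediction step, known as the Chapman-Kolmogorov equation. -/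
lemma HasJointDensity.predict :
    HasJointDensity μ Y (fun ω => F (Y ω) (X ω) + W ω) ρ
      fun y z => ∫⁻ x, φ (z - F y x) * q y x := by
  have hY := hq.measurable_left
  have hFX : Measurable fun ω => F (Y ω) (X ω) + W ω :=
    (hF.comp (hY.prodMk hq.measurable_right)).add hW
  have hφq := hq.measurable_density_sub_mul hφ hF
  refine .of_lintegral_eq hY hFX hφq.lintegral_prod_right' fun h hh => ?_
  refine (hq.lintegral_add hW hφ hind hF (h := fun p => h (p.1, p.2.2)) (by fun_prop)).trans ?_
  refine lintegral_congr fun y => ?_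
  have hy : Measurable fun p : (Fin k → ℝ) × (Fin d → ℝ) =>
      φ (p.1 - F y p.2) * q y p.2 * h (y, p.1) :=
    (hφq.comp (by fun_prop : Measurable fun p : (Fin k → ℝ) × (Fin d → ℝ) =>
      ((y, p.1), p.2))).mul (by fun_prop)
  calc ∫⁻ x, ∫⁻ z, q y x * (φ (z - F y x) * h (y, z))
      = ∫⁻ x, ∫⁻ z, φ (z - F y x) * q y x * h (y, z) :=
        lintegral_congr fun x => lintegral_congr fun z => by ring
    _ = ∫⁻ z, ∫⁻ x, φ (z - F y x) * q y x * h (y, z) :=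
        lintegral_lintegral_swap (hy.comp measurable_swap).aemeasurable
    _ = ∫⁻ z, (∫⁻ x, φ (z - F y x) * q y x) * h (y, z) :=
        lintegral_congr fun z =>
          lintegral_mul_const _ (hφq.comp (measurable_prodMk_left (x := (y, z))))

/-- The update step: Bayes' rule without the normalization. -/
lemma HasJointDensity.observe :
    HasJointDensity μ (fun ω => (Y ω, F (Y ω) (X ω) + W ω)) X (ρ.prod volume)
      fun p x => φ (p.2 - F p.1 x) * q p.1 x := by
  have hY := hq.measurable_left
  have hX := hq.measurable_right
  have hφq := hq.measurable_density_sub_mul hφ hF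
  have hYFX : Measurable fun ω => (Y ω, F (Y ω) (X ω) + W ω) :=
    hY.prodMk ((hF.comp (hY.prodMk hX)).add hW)
  refine .of_lintegral_eq hYFX hX hφq fun h hh => ?_
  refine (hq.lintegral_add hW hφ hind hF (h := fun p => h ((p.1, p.2.2), p.2.1))
    (by fun_prop)).trans (.trans ?_
      (lintegral_prod _ (hφq.mul hh).lintegral_prod_right'.aemeasurable).symm)
  refine lintegral_congr fun y => ?_
  have hy : Measurable fun p : (Fin d → ℝ) × (Fin k → ℝ) =>
      φ (p.2 - F y p.1) * q y p.1 * h ((y, p.2), p.1) :=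
    (hφq.mul hh).comp (by fun_prop : Measurable fun p : (Fin d → ℝ) × (Fin k → ℝ) =>
      ((y, p.2), p.1))
  calc ∫⁻ x, ∫⁻ z, q y x * (φ (z - F y x) * h ((y, z), x))
      = ∫⁻ x, ∫⁻ z, φ (z - F y x) * q y x * h ((y, z), x) :=
        lintegral_congr fun x => lintegral_congr fun z => by ring
    _ = ∫⁻ z, ∫⁻ x, φ (z - F y x) * q y x * h ((y, z), x) :=
        lintegral_lintegral_swap hy.aemeasurable

end Joint

end AddNoise

end Density

/-! ### The Bayesian filter -/

section ExtendTuple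

variable {ι E : Type*} [DecidableEq ι] {s s' : Finset ι}

/-- The family on `s'` that agrees with `a` on `s` and has the value `b` elsewhere. It records how
the information grows from one time to the next. -/
def extendTuple (s' : Finset ι) (a : s → E) (b : E) : s' → E :=
  fun r => if hr : (r : ι) ∈ s then a ⟨r, hr⟩ else b

lemma extendTuple_of_mem (a : s → E) (b : E) (r : s') (hr : (r : ι) ∈ s) :
    extendTuple s' a b r = a ⟨r, hr⟩ :=
  dif_pos hr

lemma extendTuple_of_notMem (a : s → E) (b : E) (r : s') (hr : (r : ι) ∉ s) :
    extendTuple s' a b r = b :=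
  dif_neg hr

lemma extendTuple_restrict (F : ι → E) (b : E) (hb : ∀ r ∈ s', r ∉ s → F r = b) :
    extendTuple s' (fun r : s => F r) b = fun r : s' => F r := by
  funext r
  by_cases hr : (r : ι) ∈ s
  · exact extendTuple_of_mem _ b r hr
  · exact (extendTuple_of_notMem _ b r hr).trans (hb r r.2 hr).symm

lemma measurable_extendTuple {α : Type*} [MeasurableSpace α] [MeasurableSpace E] {a : α → s → E}
    {b : α → E} (ha : Measurable a) (hb : Measurable b) :
    Measurable fun x => extendTuple s' (a x) (b x) := by
  refine measurable_pi_lambda _ fun r => ?_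
  by_cases hr : (r : ι) ∈ s
  · simp only [extendTuple_of_mem _ _ r hr]
    exact measurable_pi_iff.1 ha _
  · simp only [extendTuple_of_notMem _ _ r hr]
    exact hb

end ExtendTuple

namespace System

variable {n : ℕ} {S : System n} {i : Fin n} {t : ℕ}

/-- The part `I_0(t)` of the information `I_i(t)`. -/
def InfoMinor.major (I : S.InfoMinor i t) : S.InfoMajor t :=
  (I.1, I.2.2.1)

lemma InfoMinor.measurable_major :
    Measurable (InfoMinor.major : S.InfoMinor i t → S.InfoMajor t) :=
  measurable_fst.prodMk measurable_snd.snd.fst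

lemma InfoMinor.measurable_prev :
    Measurable (InfoMinor.prev : S.InfoMinor i (t + 1) → S.InfoMinor i t) := by
  unfold InfoMinor.prev
  fun_prop

/-- The information `I_i(1)`, with the data `x_0(1)`, `y_i(1)`. -/
def firstInfo (p : (Fin (S.dx 0) → ℝ) × (Fin (S.dy i) → ℝ)) : S.InfoMinor i 1 :=
  (fun _ => p.1, fun _ => p.2, fun _ => 0, fun _ => 0)

lemma measurable_firstInfo : Measurable (firstInfo (S := S) (i := i)) := by
  unfold firstInfo
  fun_prop

namespace Strategy

variable (g : S.Strategy)

/-- The information `I_i(t+1)` that results from `I_i(t)` and the new data `x_0(t+1)`, `y_i(t+1)`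
when the strategy `g` is used. -/
def nextInfo (i : Fin n) (t : ℕ)
    (p : (S.InfoMinor i t × (Fin (S.dx 0) → ℝ)) × (Fin (S.dy i) → ℝ)) : S.InfoMinor i (t + 1) :=
  (extendTuple _ p.1.1.1 p.1.2, extendTuple _ p.1.1.2.1 p.2,
    extendTuple _ p.1.1.2.2.1 (g.major t p.1.1.major),
    extendTuple _ p.1.1.2.2.2 (g.minor i t p.1.1))

lemma measurable_nextInfo (i : Fin n) (t : ℕ) : Measurable (g.nextInfo i t) := by
  have hmajor := (g.measurable_major t).comp (InfoMinor.measurable_major (i := i))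
  exact (measurable_extendTuple measurable_fst.fst.fst measurable_fst.snd).prodMk
    ((measurable_extendTuple measurable_fst.fst.snd.fst measurable_snd).prodMk
      ((measurable_extendTuple measurable_fst.fst.snd.snd.fst
          (hmajor.comp measurable_fst.fst)).prodMk
        (measurable_extendTuple measurable_fst.fst.snd.snd.snd
          ((g.measurable_minor i t).comp measurable_fst.fst))))

lemma prev_nextInfo (p : (S.InfoMinor i t × (Fin (S.dx 0) → ℝ)) × (Fin (S.dy i) → ℝ)) :
    InfoMinor.prev (g.nextInfo i t p) = p.1.1 :=
  Prod.ext (funext fun r => extendTuple_of_mem _ _ _ r.2) <|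
    Prod.ext (funext fun r => extendTuple_of_mem _ _ _ r.2) <|
      Prod.ext (funext fun r => extendTuple_of_mem _ _ _ r.2)
        (funext fun r => extendTuple_of_mem _ _ _ r.2)

/-- The part of `x_0(t+1)` that is known at time `t`, as a function of the information of a minor
agent. -/
def driftMajor (ht : 1 ≤ t) (z : S.InfoMinor i t) : Fin (S.dx 0) → ℝ :=
  block S.A 0 0 *ᵥ z.1 ⟨t, by simp [ht]⟩ + block S.B 0 0 *ᵥ g.major t z.major

/-- The state `x_i(t+1)` without its noise, as a function of `I_i(t)` and `x_i(t)`. -/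
def driftMinor (ht : 1 ≤ t) (z : S.InfoMinor i t) (x : Fin (S.dx i.succ) → ℝ) :
    Fin (S.dx i.succ) → ℝ :=
  (block S.A i.succ 0 *ᵥ z.1 ⟨t, by simp [ht]⟩ + block S.A i.succ i.succ *ᵥ x)
    + (block S.B i.succ 0 *ᵥ g.major t z.major + block S.B i.succ i.succ *ᵥ g.minor i t z)

lemma measurable_driftMajor (ht : 1 ≤ t) :
    Measurable (g.driftMajor ht : S.InfoMinor i t → Fin (S.dx 0) → ℝ) :=
  (measurable_mulVec _ (by fun_prop)).add
    (measurable_mulVec _ ((g.measurable_major t).comp InfoMinor.measurable_major))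

lemma measurable_driftMinor (ht : 1 ≤ t) :
    Measurable (Function.uncurry (g.driftMinor ht : S.InfoMinor i t → _ → _)) :=
  ((measurable_mulVec _ (by fun_prop)).add (measurable_mulVec _ measurable_snd)).add
    ((measurable_mulVec _
        ((g.measurable_major t).comp (InfoMinor.measurable_major.comp measurable_fst))).add
      (measurable_mulVec _ ((g.measurable_minor i t).comp measurable_fst)))

end Strategy

section FilterDensity

variable (ht : 1 ≤ t) {φ₀ : (Fin (S.dx 0) → ℝ) → ℝ≥0∞} {φ : (Fin (S.dx i.succ) → ℝ) → ℝ≥0∞}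
  {ν : (Fin (S.dy i) → ℝ) → ℝ≥0∞} {f : S.InfoMinor i t → (Fin (S.dx i.succ) → ℝ) → ℝ≥0∞}

/-- The numerator of `bayesUpdate`: the density of the next step before it is normalized. -/
def filterDensity (φ₀ : (Fin (S.dx 0) → ℝ) → ℝ≥0∞) (φ : (Fin (S.dx i.succ) → ℝ) → ℝ≥0∞)
    (ν : (Fin (S.dy i) → ℝ) → ℝ≥0∞) (f : S.InfoMinor i t → (Fin (S.dx i.succ) → ℝ) → ℝ≥0∞)
    (I : S.InfoMinor i (t + 1)) (x : Fin (S.dx i.succ) → ℝ) : ℝ≥0∞ :=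
  S.filterBeta ν I x *
    ∫⁻ x', S.filterGamma ht φ I x x' * S.filterGamma0 ht φ₀ I * f (InfoMinor.prev I) x'

lemma measurable_filterDensity (hφ₀ : Measurable φ₀) (hφ : Measurable φ) (hν : Measurable ν)
    (hf : Measurable (Function.uncurry f)) :
    Measurable (Function.uncurry (filterDensity ht φ₀ φ ν f)) := by
  have hbeta : Measurable fun p : S.InfoMinor i (t + 1) × (Fin (S.dx i.succ) → ℝ) =>
      S.filterBeta ν p.1 p.2 :=
    hν.comp ((by fun_prop : Measurable _).sub (measurable_mulVec _ measurable_snd))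
  have hgamma : Measurable fun r : (S.InfoMinor i (t + 1) × (Fin (S.dx i.succ) → ℝ))
      × (Fin (S.dx i.succ) → ℝ) => S.filterGamma ht φ r.1.1 r.1.2 r.2 :=
    hφ.comp ((((measurable_fst.snd.sub (measurable_mulVec _ measurable_snd)).sub
      (measurable_mulVec _ (by fun_prop))).sub (measurable_mulVec _ (by fun_prop))).sub
      (measurable_mulVec _ (by fun_prop)))
  have hgamma₀ : Measurable fun I : S.InfoMinor i (t + 1) => S.filterGamma0 ht φ₀ I :=
    hφ₀.comp (((by fun_prop : Measurable _).sub (measurable_mulVec _ (by fun_prop))).sub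
      (measurable_mulVec _ (by fun_prop)))
  have hprev : Measurable fun r : (S.InfoMinor i (t + 1) × (Fin (S.dx i.succ) → ℝ))
      × (Fin (S.dx i.succ) → ℝ) => (InfoMinor.prev r.1.1, r.2) :=
    (InfoMinor.measurable_prev.comp measurable_fst.fst).prodMk measurable_snd
  exact hbeta.mul ((hgamma.mul (hgamma₀.comp measurable_fst.fst)).mul
    (hf.comp hprev)).lintegral_prod_right'

lemma filterDensity_nextInfo (g : S.Strategy) (hφ : Measurable φ)
    (hf : Measurable (Function.uncurry f))
    (p : (S.InfoMinor i t × (Fin (S.dx 0) → ℝ)) × (Fin (S.dy i) → ℝ)) :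
    filterDensity ht φ₀ φ ν f (g.nextInfo i t p)
      = fun x => ν (p.2 - S.C i *ᵥ x) * (φ₀ (p.1.2 - g.driftMajor ht p.1.1)
          * ∫⁻ x', φ (x - g.driftMinor ht p.1.1 x') * f p.1.1 x') := by
  funext x
  have hbeta : S.filterBeta ν (g.nextInfo i t p) x = ν (p.2 - S.C i *ᵥ x) := by
    simp [filterBeta, Strategy.nextInfo, extendTuple]
  have hgamma₀ : S.filterGamma0 ht φ₀ (g.nextInfo i t p)
      = φ₀ (p.1.2 - g.driftMajor ht p.1.1) := by
    simp [filterGamma0, Strategy.nextInfo, Strategy.driftMajor, extendTuple, sub_sub, ht]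
  have hgamma (x' : Fin (S.dx i.succ) → ℝ) : S.filterGamma ht φ (g.nextInfo i t p) x x'
      = φ (x - g.driftMinor ht p.1.1 x') := by
    have hsub : ∀ a b c d : Fin (S.dx i.succ) → ℝ, x - a - b - c - d = x - (b + a + (d + c)) :=
      fun a b c d => by abel
    simp [filterGamma, Strategy.nextInfo, Strategy.driftMinor, extendTuple, ht, hsub]
  have hmeas : Measurable fun x' => φ (x - g.driftMinor ht p.1.1 x') * f p.1.1 x' :=
    (hφ.comp (measurable_const.sub ((g.measurable_driftMinor ht).comp measurable_prodMk_left))).mul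
      (hf.comp measurable_prodMk_left)
  rw [filterDensity, hbeta, hgamma₀, Strategy.prev_nextInfo, ← lintegral_const_mul _ hmeas]
  congr 1
  refine lintegral_congr fun x' => ?_
  rw [hgamma, mul_comm (φ _), mul_assoc]

end FilterDensity

end System

namespace Primitives

variable {n : ℕ} {S : System n} {Ω : Type*} (P : Primitives S Ω) (g : S.Strategy) (i : Fin n)
  {t : ℕ} (ht : 1 ≤ t) (ω : Ω)

lemma infoMinor_one :
    P.infoMinor g i 1 ω
      = System.firstInfo (P.init 0 ω, S.C i *ᵥ P.init i.succ ω + P.v i 1 ω) := by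
  refine Prod.ext (funext ?_) (Prod.ext (funext ?_) (Prod.ext (funext ?_) (funext ?_))) <;>
    rintro ⟨r, hr⟩
  · obtain rfl : r = 1 := by simpa using hr
    rfl
  · obtain rfl : r = 1 := by simpa using hr
    rfl
  · simp at hr
  · simp at hr

include ht

lemma infoMinor_succ :
    P.infoMinor g i (t + 1) ω = g.nextInfo i t
      ((P.infoMinor g i t ω, comp (P.state g (t + 1) ω) 0), P.output g i (t + 1) ω) := by
  have hIcc : ∀ r ∈ Finset.Icc 1 (t + 1), r ∉ Finset.Icc 1 t → r = t + 1 := by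
    simp only [Finset.mem_Icc]
    omega
  have hIco : ∀ r ∈ Finset.Ico 1 (t + 1), r ∉ Finset.Ico 1 t → r = t := by
    simp only [Finset.mem_Ico]
    omega
  refine Prod.ext ?_ (Prod.ext ?_ (Prod.ext ?_ ?_))
  · exact (extendTuple_restrict (fun r => comp (P.state g r ω) 0) _
      fun r hr hr' => by rw [hIcc r hr hr']).symm
  · exact (extendTuple_restrict (fun r => P.output g i r ω) _
      fun r hr hr' => by rw [hIcc r hr hr']).symm
  · exact (extendTuple_restrict (fun r => comp (P.control g r ω) 0) _
      fun r hr hr' => by rw [hIco r hr hr', P.comp_control_zero g ht]; rfl).symm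
  · exact (extendTuple_restrict (fun r => comp (P.control g r ω) i.succ) _
      fun r hr hr' => by rw [hIco r hr hr', P.comp_control_succ g ht]).symm

lemma comp_state_succ_eq_driftMajor :
    comp (P.state g (t + 1) ω) 0 = g.driftMajor ht (P.infoMinor g i t ω) + P.w 0 t ω := by
  rw [P.comp_state_succ_zero g ht, P.comp_control_zero g ht]
  rfl

lemma comp_state_succ_eq_driftMinor :
    comp (P.state g (t + 1) ω) i.succ
      = g.driftMinor ht (P.infoMinor g i t ω) (comp (P.state g t ω) i.succ)
        + P.w i.succ t ω := by
  rw [P.comp_state_succ_succ g ht, P.comp_control_zero g ht, P.comp_control_succ g ht]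
  rfl

section NextState

omit ω

variable {T : ℕ} (htT : t ≤ T) {s : Set (S.PrimIndex T)} (hs : S.prims T {0, i.succ} t ⊆ s)

include htT hs

lemma measurable_sig_infoMinor_prodMk_state :
    Measurable[P.sig T s] fun ω => (P.infoMinor g i t ω, comp (P.state g t ω) i.succ) :=
  ((measurable_sig_infoMinor g (by simp) ht htT (by simp)).prodMk
    (measurable_sig_state_succ g ht htT (by simp) (by simp))).mono (sig_mono hs) le_rfl

lemma measurable_sig_state_succ_major (hw : Measurable[P.sig T s] (P.w 0 t)) :
    Measurable[P.sig T s] fun ω => comp (P.state g (t + 1) ω) 0 := by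
  simp only [P.comp_state_succ_eq_driftMajor g i ht]
  exact ((g.measurable_driftMajor ht).comp
    (P.measurable_sig_infoMinor_prodMk_state g i ht htT hs).fst).add hw

lemma measurable_sig_state_succ_minor (hw : Measurable[P.sig T s] (P.w i.succ t)) :
    Measurable[P.sig T s] fun ω => comp (P.state g (t + 1) ω) i.succ := by
  simp only [P.comp_state_succ_eq_driftMinor g i ht]
  exact ((g.measurable_driftMinor ht).comp
    (P.measurable_sig_infoMinor_prodMk_state g i ht htT hs)).add hw

end NextState

namespace Admissible

omit ω ht

variable {P} [mΩ : MeasurableSpace Ω] {μ : Measure Ω} {T : ℕ} (hP : P.Admissible T μ)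

include hP

lemma indepFun_of_measurable_sig {β γ : Type*} [MeasurableSpace β] [MeasurableSpace γ]
    {X : Ω → β} {Y : Ω → γ} {a b : Set (S.PrimIndex T)} (hab : Disjoint a b)
    (hX : Measurable[P.sig T a] X) (hY : Measurable[P.sig T b] Y) : IndepFun X Y μ :=
  indep_of_indep_of_le (hP.indep_sig hab) hX.comap_le hY.comap_le

section Init

variable {ξ : (Fin (S.dx i.succ) → ℝ) → ℝ≥0∞} {ν : (Fin (S.dy i) → ℝ) → ℝ≥0∞}

lemma hasJointDensity_init [IsFiniteMeasure μ] (hT : 1 ≤ T) (hξ : HasDensity μ (P.init i.succ) ξ)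
    (hν : HasDensity μ (P.v i 1) ν) :
    HasJointDensity μ (fun ω => (P.init 0 ω, S.C i *ᵥ P.init i.succ ω + P.v i 1 ω))
      (P.init i.succ) ((μ.map (P.init 0)).prod volume) fun p x => ν (p.2 - S.C i *ᵥ x) * ξ x := by
  let kv : S.PrimIndex T := .inr (.inr (i, ⟨1, Finset.mem_Icc.2 ⟨le_rfl, hT⟩⟩))
  have hind_init : IndepFun (P.init 0) (P.init i.succ) μ :=
    hP.indepFun_of_measurable_sig (a := {.inl 0}) (b := {.inl i.succ})
      (by simp [(Fin.succ_ne_zero i).symm])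
      (measurable_sig (k := .inl 0) rfl) (measurable_sig (k := .inl i.succ) rfl)
  have hind_v : IndepFun (fun ω => (P.init 0 ω, P.init i.succ ω)) (P.v i 1) μ :=
    hP.indepFun_of_measurable_sig (a := {.inl 0, .inl i.succ}) (b := {kv}) (by simp [kv])
      (Measurable.prodMk (measurable_sig (k := .inl 0) (by simp))
        (measurable_sig (k := .inl i.succ) (by simp)))
      (measurable_sig (k := kv) rfl)
  exact (hξ.hasJointDensity_of_indepFun (hP.measurable (.inl i.succ))
    (hP.measurable (.inl 0)) hind_init).observe (hP.measurable kv) hν hind_v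
    (F := fun _ x => S.C i *ᵥ x) (measurable_mulVec _ measurable_snd)

lemma isCondDensity_bayesInit [IsFiniteMeasure μ] (hT : 1 ≤ T) (hξ : HasDensity μ (P.init i.succ) ξ)
    (hν : HasDensity μ (P.v i 1) ν) :
    IsCondDensity μ (fun ω => comp (P.state g 1 ω) i.succ) (P.infoMinor g i 1)
      (S.bayesInit i ξ ν) := by
  have hdensity : Measurable fun p : S.InfoMinor i 1 × (Fin (S.dx i.succ) → ℝ) =>
      ν (p.1.2.1 ⟨1, by simp⟩ - S.C i *ᵥ p.2) * ξ p.2 :=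
    (hν.1.comp ((by fun_prop : Measurable _).sub (measurable_mulVec _ measurable_snd))).mul
      (hξ.1.comp measurable_snd)
  have hjoint := (hP.hasJointDensity_init i hT hξ hν).map System.measurable_firstInfo
    (q := fun I x => ν (I.2.1 ⟨1, by simp⟩ - S.C i *ᵥ x) * ξ x) hdensity
  simp only [← P.infoMinor_one g] at hjoint
  exact hjoint.isCondDensity

end Init

section Update

variable {f : S.InfoMinor i t → (Fin (S.dx i.succ) → ℝ) → ℝ≥0∞}
  {φ₀ : (Fin (S.dx 0) → ℝ) → ℝ≥0∞} {φ : (Fin (S.dx i.succ) → ℝ) → ℝ≥0∞}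
  {ν : (Fin (S.dy i) → ℝ) → ℝ≥0∞} [IsFiniteMeasure μ] (ht : 1 ≤ t) (htT : t < T)
  (hφ₀ : HasDensity μ (P.w 0 t) φ₀) (hφ : HasDensity μ (P.w i.succ t) φ)

include htT hφ₀ hφ

lemma hasJointDensity_state_succ
    (hf : IsCondDensity μ (fun ω => comp (P.state g t ω) i.succ) (P.infoMinor g i t) f) :
    HasJointDensity μ (fun ω => (P.infoMinor g i t ω, comp (P.state g (t + 1) ω) 0))
      (fun ω => comp (P.state g (t + 1) ω) i.succ) ((μ.map (P.infoMinor g i t)).prod volume)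
      fun p x => φ₀ (p.2 - g.driftMajor ht p.1) *
        ∫⁻ x', φ (x - g.driftMinor ht p.1 x') * f p.1 x' := by
  let kw (j : Fin (n + 1)) : S.PrimIndex T := .inr (.inl (j, ⟨t, Finset.mem_Icc.2 ⟨ht, htT.le⟩⟩))
  let past := S.prims T {0, i.succ} t
  have hkw (j) : kw j ∉ past := by simp [past, kw, System.prims, System.IsRealized]
  have hdrift := g.measurable_driftMinor (i := i) ht
  have hZX := P.measurable_sig_infoMinor_prodMk_state g i ht htT.le (subset_refl past)
  have hZX' : Measurable[P.sig T (insert (kw i.succ) past)] fun ω =>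
      (P.infoMinor g i t ω, comp (P.state g (t + 1) ω) i.succ) :=
    (hZX.fst.mono (sig_mono (Set.subset_insert _ _)) le_rfl).prodMk
      (P.measurable_sig_state_succ_minor g i ht htT.le (Set.subset_insert _ _)
        (measurable_sig (k := kw i.succ) (Set.mem_insert _ _)))
  have hind := hP.indepFun_of_measurable_sig (b := {kw i.succ}) (by simp [hkw]) hZX
    (measurable_sig (k := kw i.succ) rfl)
  have hind₀ := hP.indepFun_of_measurable_sig (b := {kw 0})
    (by simp [hkw, kw, (Fin.succ_ne_zero i).symm]) hZX' (measurable_sig (k := kw 0) rfl)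
  simp only [P.comp_state_succ_eq_driftMajor g i ht, P.comp_state_succ_eq_driftMinor g i ht]
    at hind₀ ⊢
  exact ((hf.hasJointDensity (hZX.snd.mono (hP.sig_le _) le_rfl)
    (hZX.fst.mono (hP.sig_le _) le_rfl)).predict (hP.measurable (kw i.succ)) hφ hind hdrift).observe
    (hP.measurable (kw 0)) hφ₀ hind₀ (F := fun z _ => g.driftMajor ht z)
    ((g.measurable_driftMajor ht).comp measurable_fst)

lemma isCondDensity_bayesUpdate (hν : HasDensity μ (P.v i (t + 1)) ν)
    (hf : IsCondDensity μ (fun ω => comp (P.state g t ω) i.succ) (P.infoMinor g i t) f) :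
    IsCondDensity μ (fun ω => comp (P.state g (t + 1) ω) i.succ) (P.infoMinor g i (t + 1))
      (S.bayesUpdate ht φ₀ φ ν f) := by
  let kw (j : Fin (n + 1)) : S.PrimIndex T := .inr (.inl (j, ⟨t, Finset.mem_Icc.2 ⟨ht, htT.le⟩⟩))
  let kv : S.PrimIndex T := .inr (.inr (i, ⟨t + 1, Finset.mem_Icc.2 ⟨by omega, htT⟩⟩))
  let past := insert (kw 0) (insert (kw i.succ) (S.prims T {0, i.succ} t))
  have hsub : S.prims T {0, i.succ} t ⊆ past :=
    (Set.subset_insert _ _).trans (Set.subset_insert _ _)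
  have hkv : kv ∉ past := by simp [past, kv, kw, System.prims, System.IsRealized]
  have hpast : Measurable[P.sig T past] fun ω =>
      ((P.infoMinor g i t ω, comp (P.state g (t + 1) ω) 0), comp (P.state g (t + 1) ω) i.succ) :=
    ((P.measurable_sig_infoMinor_prodMk_state g i ht htT.le hsub).fst.prodMk
      (P.measurable_sig_state_succ_major g i ht htT.le hsub
        (measurable_sig (k := kw 0) (by simp [past])))).prodMk
      (P.measurable_sig_state_succ_minor g i ht htT.le hsub
        (measurable_sig (k := kw i.succ) (by simp [past])))
  have hind := hP.indepFun_of_measurable_sig (b := {kv}) (by simp [hkv]) hpast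
    (measurable_sig (k := kv) rfl)
  have hjoint : HasJointDensity μ
      (fun ω => ((P.infoMinor g i t ω, comp (P.state g (t + 1) ω) 0), P.output g i (t + 1) ω))
      (fun ω => comp (P.state g (t + 1) ω) i.succ)
      (((μ.map (P.infoMinor g i t)).prod volume).prod volume)
      fun p => System.filterDensity ht φ₀ φ ν f (g.nextInfo i t p) := by
    simp only [System.filterDensity_nextInfo ht g hφ.1 hf.1]
    exact (hP.hasJointDensity_state_succ g i ht htT hφ₀ hφ hf).observe (hP.measurable kv) hν hind
      (F := fun _ x => S.C i *ᵥ x) (measurable_mulVec _ measurable_snd)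
  rw [funext (P.infoMinor_succ g i ht)]
  exact (hjoint.map (g.measurable_nextInfo i t)
    (System.measurable_filterDensity ht hφ₀.1 hφ.1 hν.1 hf.1)).isCondDensity

end Update

end Admissible

end Primitives

/-! ### Riccati recursions and completion of squares -/

section Riccati

lemma transpose_eq_self_of_posSemidef {X : Type*} {M : Matrix X X ℝ} (hM : M.PosSemidef) :
    Mᵀ = M := by
  simpa using hM.isHermitian.eq

variable {X U : Type*} [Fintype X] [Fintype U]

lemma mulVec_dotProduct_mulVec (M : Matrix U X ℝ) (x : X → ℝ) (u : U → ℝ) :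
    (M *ᵥ x) ⬝ᵥ u = x ⬝ᵥ Mᵀ *ᵥ u := by
  rw [Matrix.dotProduct_transpose_mulVec, dotProduct_comm]

lemma dotProduct_mulVec_add_self (M : Matrix X X ℝ) (x y : X → ℝ) :
    (x + y) ⬝ᵥ M *ᵥ (x + y)
      = x ⬝ᵥ M *ᵥ x + y ⬝ᵥ M *ᵥ y + (x ⬝ᵥ M *ᵥ y + y ⬝ᵥ M *ᵥ x) := by
  simp only [Matrix.mulVec_add, dotProduct_add, add_dotProduct]
  ring

section Weight

variable {P : Matrix X X ℝ} (hP : P.PosSemidef) (A : Matrix X X ℝ) (B : Matrix X U ℝ)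
  {R : Matrix U U ℝ} (hR : R.PosDef)

include hP hR

omit [Fintype U] in
lemma posDef_weight [Finite U] : (R + Bᵀ * P * B).PosDef :=
  hR.add_posSemidef (by simpa using hP.conjTranspose_mul_mul_same B)

variable [DecidableEq U]

lemma weight_mul_gainOp : (R + Bᵀ * P * B) * gainOp P A B R = Bᵀ * P * A := by
  have hdet := (Matrix.isUnit_iff_isUnit_det _).1 (posDef_weight hP B hR).isUnit
  rw [gainOp, Matrix.mul_assoc (_ * _), Matrix.mul_assoc _⁻¹,
    Matrix.mul_nonsing_inv_cancel_left _ _ hdet, Matrix.mul_assoc]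

lemma transpose_gainOp_mul_weight : (gainOp P A B R)ᵀ * (R + Bᵀ * P * B) = Aᵀ * P * B := by
  have h := congrArg Matrix.transpose (weight_mul_gainOp hP A B hR)
  rw [Matrix.transpose_mul,
    transpose_eq_self_of_posSemidef (posDef_weight hP B hR).posSemidef] at h
  rw [h]
  simp only [Matrix.transpose_mul, Matrix.transpose_transpose,
    transpose_eq_self_of_posSemidef hP, Matrix.mul_assoc]

lemma riccatiOp_eq_sub (Q : Matrix X X ℝ) :
    riccatiOp P A B Q R
      = Q + Aᵀ * P * A - (gainOp P A B R)ᵀ * (R + Bᵀ * P * B) * gainOp P A B R := by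
  rw [transpose_gainOp_mul_weight hP A B hR]
  simp only [riccatiOp, gainOp, Matrix.mul_assoc]

lemma complete_square (Q : Matrix X X ℝ) (x : X → ℝ) (u : U → ℝ) :
    x ⬝ᵥ Q *ᵥ x + u ⬝ᵥ R *ᵥ u + (A *ᵥ x + B *ᵥ u) ⬝ᵥ P *ᵥ (A *ᵥ x + B *ᵥ u)
      = x ⬝ᵥ riccatiOp P A B Q R *ᵥ x + (u + gainOp P A B R *ᵥ x) ⬝ᵥ
          (R + Bᵀ * P * B) *ᵥ (u + gainOp P A B R *ᵥ x) := by
  rw [riccatiOp_eq_sub hP A B hR, Matrix.mul_assoc _ _ (gainOp P A B R),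
    weight_mul_gainOp hP A B hR, dotProduct_mulVec_add_self, dotProduct_mulVec_add_self]
  simp only [mulVec_dotProduct_mulVec, Matrix.mulVec_mulVec, ← Matrix.mul_assoc,
    weight_mul_gainOp hP A B hR, transpose_gainOp_mul_weight hP A B hR]
  simp only [Matrix.sub_mulVec, Matrix.add_mulVec, dotProduct_sub, dotProduct_add]
  ring

lemma posSemidef_riccatiOp {Q : Matrix X X ℝ} (hQ : Q.PosSemidef) :
    (riccatiOp P A B Q R).PosSemidef := by
  refine Matrix.PosSemidef.of_dotProduct_mulVec_nonneg ?_ fun x => ?_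
  · rw [riccatiOp_eq_sub hP A B hR]
    exact (hQ.isHermitian.add (Matrix.isHermitian_conjTranspose_mul_mul A hP.isHermitian)).sub
      (Matrix.isHermitian_conjTranspose_mul_mul _ (posDef_weight hP B hR).isHermitian)
  · have h := complete_square hP A B hR Q x (-(gainOp P A B R *ᵥ x))
    rw [neg_add_cancel, Matrix.mulVec_zero, dotProduct_zero, add_zero] at h
    exact h ▸ add_nonneg (add_nonneg (hQ.dotProduct_mulVec_nonneg _)
      (hR.posSemidef.dotProduct_mulVec_nonneg _)) (hP.dotProduct_mulVec_nonneg _)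

end Weight

variable [DecidableEq U]

lemma posSemidef_riccatiSeq (A : Matrix X X ℝ) (B : Matrix X U ℝ) {Q : Matrix X X ℝ}
    (hQ : Q.PosSemidef) {R : Matrix U U ℝ} (hR : R.PosDef) {QT : Matrix X X ℝ}
    (hQT : QT.PosSemidef) (k : ℕ) : (riccatiSeq A B Q R QT k).PosSemidef := by
  induction k with
  | zero => exact hQT
  | succ k ih => exact posSemidef_riccatiOp ih A B hR hQ

end Riccati

namespace System

variable {n : ℕ} (S : System n) (T : ℕ)

lemma posDef_block_R (i : Fin (n + 1)) : (block S.R i i).PosDef :=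
  S.R_posDef.submatrix fun _ _ h => by simpa using h

lemma posSemidef_riccatiC (t : ℕ) : (S.riccatiC T t).PosSemidef :=
  posSemidef_riccatiSeq _ _ S.Q_posSemidef S.R_posDef S.QT_posSemidef _

lemma posSemidef_riccatiL (i : Fin n) (t : ℕ) : (S.riccatiL T i t).PosSemidef :=
  posSemidef_riccatiSeq _ _ (S.Q_posSemidef.submatrix _) (S.posDef_block_R _)
    (S.QT_posSemidef.submatrix _) _

lemma riccatiC_self : S.riccatiC T T = S.QT := by
  rw [riccatiC, Nat.sub_self, riccatiSeq]

lemma riccatiL_self (i : Fin n) : S.riccatiL T i T = block S.QT i.succ i.succ := by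
  rw [riccatiL, Nat.sub_self, riccatiSeq]

variable {T}

lemma riccatiC_eq_riccatiOp {t : ℕ} (htT : t < T) :
    S.riccatiC T t = riccatiOp (S.riccatiC T (t + 1)) S.A S.B S.Q S.R := by
  rw [riccatiC, riccatiC, show T - t = T - (t + 1) + 1 by omega, riccatiSeq]

lemma riccatiL_eq_riccatiOp (i : Fin n) {t : ℕ} (htT : t < T) :
    S.riccatiL T i t = riccatiOp (S.riccatiL T i (t + 1)) (block S.A i.succ i.succ)
      (block S.B i.succ i.succ) (block S.Q i.succ i.succ) (block S.R i.succ i.succ) := by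
  rw [riccatiL, riccatiL, show T - t = T - (t + 1) + 1 by omega, riccatiSeq]

end System

/-! ### Expectations of quadratic forms -/

section QuadMean

variable {Ω X Y : Type*} [Fintype X] [Fintype Y] {mΩ : MeasurableSpace Ω} {μ : Measure Ω}

/-- The expectation `E[fᵀ M f]` of a quadratic form (`0` if the form is not integrable). -/
def quadMean (μ : Measure Ω) (M : Matrix X X ℝ) (f : Ω → X → ℝ) : ℝ :=
  ∫ ω, f ω ⬝ᵥ M *ᵥ f ω ∂μ

/-- The random vectors `f` and `g` are orthogonal: `E[f gᵀ] = 0`, where entries that are not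
integrable count as `0`. -/
def Orth {X Y : Type*} (μ : Measure Ω) (f : Ω → X → ℝ) (g : Ω → Y → ℝ) : Prop :=
  ∀ k l, ∫ ω, f ω k * g ω l ∂μ = 0

lemma Orth.symm {X Y : Type*} {f : Ω → X → ℝ} {g : Ω → Y → ℝ} (h : Orth μ f g) : Orth μ g f :=
  fun k l => by simpa only [mul_comm] using h l k

lemma Orth.congr {X Y : Type*} {f f' : Ω → X → ℝ} {g g' : Ω → Y → ℝ} (hf : f =ᵐ[μ] f')
    (hg : g =ᵐ[μ] g') (h : Orth μ f' g') : Orth μ f g := fun k l => by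
  rw [← h k l]
  refine integral_congr_ae ?_
  filter_upwards [hf, hg] with ω hf hg
  rw [hf, hg]

lemma orth_zero {X Y : Type*} (g : Ω → Y → ℝ) : Orth μ (0 : Ω → X → ℝ) g := fun k l => by simp

lemma quadMean_congr {f g : Ω → X → ℝ} (h : f =ᵐ[μ] g) (M : Matrix X X ℝ) :
    quadMean μ M f = quadMean μ M g :=
  integral_congr_ae (h.mono fun ω hω => by simp only [hω])

lemma quadMean_zero (M : Matrix X X ℝ) : quadMean μ M 0 = 0 := by
  simp [quadMean]

lemma dotProduct_mulVec_eq_sum (M : Matrix X Y ℝ) (x : X → ℝ) (y : Y → ℝ) :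
    x ⬝ᵥ M *ᵥ y = ∑ k, ∑ l, M k l * (x k * y l) := by
  simp only [dotProduct, Matrix.mulVec, Finset.mul_sum, mul_left_comm]

section MemLp

variable {f : Ω → X → ℝ} {g : Ω → Y → ℝ} (hf : MemLp f 2 μ) (hg : MemLp g 2 μ)

include hf hg

lemma integrable_apply_mul_apply (k : X) (l : Y) : Integrable (fun ω => f ω k * g ω l) μ :=
  (memLp_pi_iff.1 hf k).integrable_mul (memLp_pi_iff.1 hg l)

lemma integrable_dotProduct_mulVec (M : Matrix X Y ℝ) :
    Integrable (fun ω => f ω ⬝ᵥ M *ᵥ g ω) μ := by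
  simp only [dotProduct_mulVec_eq_sum]
  exact integrable_finsetSum _ fun k _ => integrable_finsetSum _ fun l _ =>
    (integrable_apply_mul_apply hf hg k l).const_mul _

lemma integral_dotProduct_mulVec (M : Matrix X Y ℝ) :
    ∫ ω, f ω ⬝ᵥ M *ᵥ g ω ∂μ = ∑ k, ∑ l, M k l * ∫ ω, f ω k * g ω l ∂μ := by
  have hint (k l) : Integrable (fun ω => M k l * (f ω k * g ω l)) μ :=
    (integrable_apply_mul_apply hf hg k l).const_mul _
  simp only [dotProduct_mulVec_eq_sum, ← integral_const_mul]
  rw [integral_finsetSum _ fun k _ => integrable_finsetSum _ fun l _ => hint k l]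
  exact Finset.sum_congr rfl fun k _ => integral_finsetSum _ fun l _ => hint k l

lemma Orth.integral_dotProduct_mulVec_eq_zero (h : Orth μ f g) (M : Matrix X Y ℝ) :
    ∫ ω, f ω ⬝ᵥ M *ᵥ g ω ∂μ = 0 := by
  rw [integral_dotProduct_mulVec hf hg]
  exact Finset.sum_eq_zero fun k _ => Finset.sum_eq_zero fun l _ => by rw [h k l, mul_zero]

end MemLp

lemma Orth.quadMean_add {f g : Ω → X → ℝ} (h : Orth μ f g) (hf : MemLp f 2 μ) (hg : MemLp g 2 μ)
    (M : Matrix X X ℝ) : quadMean μ M (f + g) = quadMean μ M f + quadMean μ M g := by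
  have hff := integrable_dotProduct_mulVec hf hf M
  have hgg := integrable_dotProduct_mulVec hg hg M
  have hfg := integrable_dotProduct_mulVec hf hg M
  have hgf := integrable_dotProduct_mulVec hg hf M
  simp only [quadMean, Pi.add_apply, dotProduct_mulVec_add_self]
  rw [integral_add (by exact hff.add hgg) (by exact hfg.add hgf), integral_add hff hgg,
    integral_add hfg hgf, h.integral_dotProduct_mulVec_eq_zero hf hg,
    h.symm.integral_dotProduct_mulVec_eq_zero hg hf, add_zero, add_zero]

lemma orth_of_condExp_eq_zero [IsFiniteMeasure μ] {m : MeasurableSpace Ω} (hm : m ≤ mΩ)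
    {f : Ω → X → ℝ} {g : Ω → Y → ℝ} (hf : MemLp f 2 μ) (hg : MemLp g 2 μ)
    (hf0 : μ[f | m] =ᵐ[μ] 0) (hgm : AEStronglyMeasurable[m] g μ) : Orth μ f g := by
  intro k l
  have hfi : Integrable f μ := hf.integrable one_le_two
  have hgl : AEStronglyMeasurable[m] (fun ω => g ω l) μ :=
    (continuous_apply l).comp_aestronglyMeasurable hgm
  have hpull := condExp_mul_of_aestronglyMeasurable_right hgl
    (integrable_apply_mul_apply hf hg k l) (hfi.eval k)
  rw [← integral_condExp hm]
  refine integral_eq_zero_of_ae (hpull.trans ?_)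
  filter_upwards [condExp_apply (m := m) hfi k, hf0] with ω hk h0
  rw [Pi.mul_apply, hk, h0, Pi.zero_apply, Pi.zero_apply, zero_mul, Pi.zero_apply]

lemma quadMean_eq_sum_block {n : ℕ} {d : Fin (n + 1) → ℕ} {f : Ω → (Σ i, Fin (d i)) → ℝ}
    (hf : MemLp f 2 μ)
    (horth : ∀ i j, i ≠ j → Orth μ (fun ω => comp (f ω) i) (fun ω => comp (f ω) j))
    (M : Matrix (Σ i, Fin (d i)) (Σ i, Fin (d i)) ℝ) :
    quadMean μ M f = ∑ i, quadMean μ (block M i i) fun ω => comp (f ω) i := by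
  rw [quadMean, integral_dotProduct_mulVec hf hf, Fintype.sum_sigma]
  refine Finset.sum_congr rfl fun i _ => ?_
  rw [quadMean, integral_dotProduct_mulVec (memLp_comp hf i) (memLp_comp hf i)]
  refine Finset.sum_congr rfl fun k _ => ?_
  rw [Fintype.sum_sigma]
  refine Fintype.sum_eq_single i fun j hji => Finset.sum_eq_zero fun l _ => ?_
  rw [show ∫ ω, f ω ⟨i, k⟩ * f ω ⟨j, l⟩ ∂μ = 0 from horth i j hji.symm k l, mul_zero]

lemma quadMean_nonneg {M : Matrix X X ℝ} (hM : M.PosSemidef) (f : Ω → X → ℝ) :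
    0 ≤ quadMean μ M f :=
  integral_nonneg fun ω => hM.dotProduct_mulVec_nonneg (f ω)

lemma quadMean_eq_zero_iff {M : Matrix X X ℝ} (hM : M.PosDef) {f : Ω → X → ℝ}
    (hf : MemLp f 2 μ) : quadMean μ M f = 0 ↔ f =ᵐ[μ] 0 := by
  refine (integral_eq_zero_iff_of_nonneg
    (fun ω => hM.posSemidef.dotProduct_mulVec_nonneg (f ω))
    (integrable_dotProduct_mulVec hf hf M)).trans (Filter.eventually_congr (.of_forall fun ω => ?_))
  refine ⟨fun h => ?_, fun h => by simp [h]⟩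
  by_contra hω
  exact (hM.dotProduct_mulVec_pos hω).ne' h

open scoped MatrixOrder in
lemma memLp_of_integrable_dotProduct_mulVec {M : Matrix X X ℝ} (hM : M.PosDef)
    {f : Ω → X → ℝ} (hf : Measurable f) (h : Integrable (fun ω => f ω ⬝ᵥ M *ᵥ f ω) μ) :
    MemLp f 2 μ := by
  classical
  obtain ⟨B, hB⟩ := CStarAlgebra.nonneg_iff_eq_star_mul_self.mp hM.posSemidef.nonneg
  replace hB : M = Bᵀ * B := by simpa [Matrix.star_eq_conjTranspose] using hB
  have hdet : IsUnit B.det := by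
    have hMdet := (Matrix.isUnit_iff_isUnit_det _).1 hM.isUnit
    rw [hB, Matrix.det_mul] at hMdet
    exact isUnit_of_mul_isUnit_right hMdet
  have hsum (ω) : f ω ⬝ᵥ M *ᵥ f ω = ∑ l, (B *ᵥ f ω) l ^ 2 := by
    rw [hB, ← Matrix.mulVec_mulVec, ← mulVec_dotProduct_mulVec]
    simp only [dotProduct, sq]
  have hBf : MemLp (fun ω => B *ᵥ f ω) 2 μ := by
    refine memLp_pi_iff.2 fun k => ?_
    have hmeas := (measurable_pi_apply k).comp (measurable_mulVec B hf)
    refine (memLp_two_iff_integrable_sq hmeas.aestronglyMeasurable).2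
      (h.mono (hmeas.pow_const 2).aestronglyMeasurable (.of_forall fun ω => ?_))
    rw [Real.norm_of_nonneg (sq_nonneg _), hsum,
      Real.norm_of_nonneg (Finset.sum_nonneg fun l _ => sq_nonneg _)]
    exact Finset.single_le_sum (f := fun l => (B *ᵥ f ω) l ^ 2) (fun l _ => sq_nonneg _)
      (Finset.mem_univ k)
  simpa only [Matrix.mulVec_mulVec, Matrix.nonsing_inv_mul _ hdet, Matrix.one_mulVec]
    using memLp_mulVec B⁻¹ hBf

lemma condExp_sub_condExp [IsFiniteMeasure μ] {E : Type*} [NormedAddCommGroup E]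
    [NormedSpace ℝ E] [CompleteSpace E] {m : MeasurableSpace Ω} (hm : m ≤ mΩ) {f : Ω → E}
    (hf : Integrable f μ) : μ[f - μ[f | m] | m] =ᵐ[μ] 0 := by
  have h := condExp_sub hf (integrable_condExp (μ := μ) (m := m) (f := f)) m
  rwa [condExp_of_stronglyMeasurable hm stronglyMeasurable_condExp integrable_condExp,
    sub_self] at h

lemma quadMean_eq_condExp_add [IsFiniteMeasure μ] {m : MeasurableSpace Ω} (hm : m ≤ mΩ)
    {f : Ω → X → ℝ} (hf : MemLp f 2 μ) (M : Matrix X X ℝ) :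
    quadMean μ M f = quadMean μ M (μ[f | m]) + quadMean μ M (f - μ[f | m]) := by
  have hE : MemLp (μ[f | m]) 2 μ := hf.condExp one_le_two
  have horth : Orth μ (f - μ[f | m]) (μ[f | m]) :=
    orth_of_condExp_eq_zero hm (hf.sub hE) hE (condExp_sub_condExp hm (hf.integrable one_le_two))
      stronglyMeasurable_condExp.aestronglyMeasurable
  rw [← horth.symm.quadMean_add hE (hf.sub hE), add_sub_cancel]

lemma orth_sub_condExp_of_condExp_eq [IsFiniteMeasure μ] {m m' : MeasurableSpace Ω} (hle : m ≤ m')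
    (hm' : m' ≤ mΩ) {f : Ω → X → ℝ} {g : Ω → Y → ℝ} (hf : MemLp f 2 μ) (hg : MemLp g 2 μ)
    (hfm : μ[f | m'] =ᵐ[μ] μ[f | m]) (hgm : StronglyMeasurable[m'] g) :
    Orth μ (f - μ[f | m]) (g - μ[g | m]) := by
  refine orth_of_condExp_eq_zero hm' (hf.sub (hf.condExp one_le_two))
    (hg.sub (hg.condExp one_le_two)) ?_
    (hgm.sub (stronglyMeasurable_condExp.mono hle)).aestronglyMeasurable
  have hsub := condExp_sub (hf.integrable one_le_two)
    (integrable_condExp (μ := μ) (m := m) (f := f)) m'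
  rw [condExp_of_stronglyMeasurable hm' (stronglyMeasurable_condExp.mono hle)
    integrable_condExp] at hsub
  filter_upwards [hsub, hfm] with ω hsub hfm
  rw [hsub, Pi.sub_apply, hfm, sub_self, Pi.zero_apply]

lemma quadMean_eq_condExp_add_sum_block [IsFiniteMeasure μ] {m : MeasurableSpace Ω} (hm : m ≤ mΩ)
    {n : ℕ} {d : Fin (n + 1) → ℕ} {f : Ω → (Σ i, Fin (d i)) → ℝ} (hf : MemLp f 2 μ)
    (h₀ : StronglyMeasurable[m] fun ω => comp (f ω) 0)
    (horth : ∀ i j : Fin n, i ≠ j →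
      Orth μ ((fun ω => comp (f ω) i.succ) - μ[fun ω => comp (f ω) i.succ | m])
        ((fun ω => comp (f ω) j.succ) - μ[fun ω => comp (f ω) j.succ | m]))
    (M : Matrix (Σ i, Fin (d i)) (Σ i, Fin (d i)) ℝ) :
    quadMean μ M f = quadMean μ M (μ[f | m])
      + ∑ i : Fin n, quadMean μ (block M i.succ i.succ)
          fun ω => comp (f ω - (μ[f | m]) ω) i.succ := by
  have hfi : Integrable f μ := hf.integrable one_le_two
  have hcomp (i) : (fun ω => comp (f ω - (μ[f | m]) ω) i)
      =ᵐ[μ] (fun ω => comp (f ω) i) - μ[fun ω => comp (f ω) i | m] := by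
    filter_upwards [condExp_comp (m := m) hfi i] with ω hω
    rw [comp_sub, Pi.sub_apply, hω]
  have hmajor : (fun ω => comp (f ω - (μ[f | m]) ω) 0) =ᵐ[μ] 0 := by
    refine (hcomp 0).trans (.of_eq ?_)
    rw [condExp_of_stronglyMeasurable hm h₀ (integrable_comp hfi 0), sub_self]
  have horth' (i j : Fin (n + 1)) (hij : i ≠ j) : Orth μ (fun ω => comp (f ω - (μ[f | m]) ω) i)
      (fun ω => comp (f ω - (μ[f | m]) ω) j) := by
    cases i using Fin.cases with
    | zero => exact .congr hmajor .rfl (orth_zero _)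
    | succ i =>
      cases j using Fin.cases with
      | zero => exact .symm (.congr hmajor .rfl (orth_zero _))
      | succ j => exact .congr (hcomp _) (hcomp _) (horth i j fun h => hij (congrArg Fin.succ h))
  rw [quadMean_eq_condExp_add hm hf,
    quadMean_eq_sum_block (hf.sub (hf.condExp one_le_two)) horth', Fin.sum_univ_succ]
  congr 1
  refine add_eq_right.2 ?_
  exact (quadMean_congr hmajor _).trans (quadMean_zero _)

lemma quadMean_complete_square [DecidableEq Y] {P : Matrix X X ℝ} (hP : P.PosSemidef)
    (A : Matrix X X ℝ) (B : Matrix X Y ℝ) (Q : Matrix X X ℝ) {R : Matrix Y Y ℝ} (hR : R.PosDef)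
    {x : Ω → X → ℝ} {u : Ω → Y → ℝ} (hx : MemLp x 2 μ) (hu : MemLp u 2 μ) :
    quadMean μ Q x + quadMean μ R u + quadMean μ P (fun ω => A *ᵥ x ω + B *ᵥ u ω)
      = quadMean μ (riccatiOp P A B Q R) x
        + quadMean μ (R + Bᵀ * P * B) fun ω => u ω + gainOp P A B R *ᵥ x ω := by
  have hnext : MemLp (fun ω => A *ᵥ x ω + B *ᵥ u ω) 2 μ :=
    (memLp_mulVec A hx).add (memLp_mulVec B hu)
  have hgap : MemLp (fun ω => u ω + gainOp P A B R *ᵥ x ω) 2 μ := hu.add (memLp_mulVec _ hx)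
  have hQ := integrable_dotProduct_mulVec hx hx Q
  have hRu := integrable_dotProduct_mulVec hu hu R
  simp only [quadMean]
  rw [← integral_add hQ hRu,
    ← integral_add (by exact hQ.add hRu) (integrable_dotProduct_mulVec hnext hnext P),
    ← integral_add (integrable_dotProduct_mulVec hx hx _)
      (integrable_dotProduct_mulVec hgap hgap _)]
  exact integral_congr_ae (.of_forall fun ω => complete_square hP A B hR Q (x ω) (u ω))

omit [Fintype Y] in
lemma stronglyMeasurable_mulVec {m : MeasurableSpace Ω} (M : Matrix Y X ℝ) {f : Ω → X → ℝ}
    (hf : StronglyMeasurable[m] f) : StronglyMeasurable[m] fun ω => M *ᵥ f ω :=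
  (mulVecCLM M).continuous.comp_stronglyMeasurable hf

lemma stronglyMeasurable_comp {m : MeasurableSpace Ω} {n : ℕ} {d : Fin (n + 1) → ℕ}
    {f : Ω → (Σ i, Fin (d i)) → ℝ} (hf : StronglyMeasurable[m] f) (i : Fin (n + 1)) :
    StronglyMeasurable[m] fun ω => comp (f ω) i :=
  (compCLM d i).continuous.comp_stronglyMeasurable hf

end QuadMean

/-! ### The cost as a sum of stage losses -/

namespace System

variable {n : ℕ} (S : System n) (T : ℕ)

/-- The Hessian `R + Bᵀ S^c(t+1) B` of the common stage problem at time `t`. -/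
def weightC (t : ℕ) : Matrix (Σ i, Fin (S.du i)) (Σ i, Fin (S.du i)) ℝ :=
  S.R + S.Bᵀ * S.riccatiC T (t + 1) * S.B

/-- The Hessian `R_{ii} + B_{ii}ᵀ S^ℓ_i(t+1) B_{ii}` of the local stage problem of a minor agent
at time `t`. -/
def weightL (i : Fin n) (t : ℕ) : Matrix (Fin (S.du i.succ)) (Fin (S.du i.succ)) ℝ :=
  block S.R i.succ i.succ
    + (block S.B i.succ i.succ)ᵀ * S.riccatiL T i (t + 1) * block S.B i.succ i.succ

lemma posDef_weightC (t : ℕ) : (S.weightC T t).PosDef :=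
  posDef_weight (S.posSemidef_riccatiC T (t + 1)) S.B S.R_posDef

lemma posDef_weightL (i : Fin n) (t : ℕ) : (S.weightL T i t).PosDef :=
  posDef_weight (S.posSemidef_riccatiL T i (t + 1)) _ (S.posDef_block_R i.succ)

end System

namespace Primitives

variable {n : ℕ} {S : System n} {Ω : Type*} (P : Primitives S Ω)

section Defs

variable [MeasurableSpace Ω] (μ : Measure Ω) (g : S.Strategy) (i : Fin n) (T t : ℕ)

/-- The local part `x_i(t) - x̂_i(t|c)` of the state of a minor agent. -/
def localState (ω : Ω) : Fin (S.dx i.succ) → ℝ :=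
  comp (P.state g t ω - P.estMajor μ g t ω) i.succ

/-- The local part `u_i(t) - u^c_i(t)` of the action of a minor agent. -/
def localControl (ω : Ω) : Fin (S.du i.succ) → ℝ :=
  comp (P.control g t ω - P.commonControl μ g t ω) i.succ

/-- The minor agent's estimate `x̂_i(t|i) - x̂_i(t|c)` of its local state. -/
def localEst (ω : Ω) : Fin (S.dx i.succ) → ℝ :=
  comp (P.estMinor μ g i t ω) i.succ - comp (P.estMajor μ g t ω) i.succ

/-- The error of the minor agent's estimate of its uncontrolled state. It is also the error
`x_i(t) - x̂_i(t|i)` under any strategy, see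
`Primitives.Admissible.comp_state_sub_comp_estMinor`. -/
def errMinor : Ω → Fin (S.dx i.succ) → ℝ :=
  P.freeState i t - μ[P.freeState i t | P.sigmaFree i t]

/-- The expected quadratic cost-to-go from time `t`, up to the contribution of later losses. -/
def value : ℝ :=
  quadMean μ (S.riccatiC T t) (P.estMajor μ g t)
    + ∑ i, quadMean μ (S.riccatiL T i t) (P.localState μ g i t)

/-- The loss at time `t` from not following the gains. -/
def gap : ℝ :=
  quadMean μ (S.weightC T t) (fun ω => P.commonControl μ g t ω + S.gainC T t *ᵥ P.estMajor μ g t ω)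
    + ∑ i, quadMean μ (S.weightL T i t)
        fun ω => P.localControl μ g i t ω + S.gainL T i t *ᵥ P.localEst μ g i t ω

/-- The loss at time `t` that is caused by the noise and the estimation errors. It does not depend
on the strategy. -/
def noiseCost : ℝ :=
  quadMean μ (S.riccatiC T (t + 1)) (fun ω => stackMM (P.w 0 t ω) fun _ => 0)
    + ∑ i, (quadMean μ (S.riccatiL T i (t + 1)) (P.w i.succ t)
      + quadMean μ (S.weightL T i t) fun ω => S.gainL T i t *ᵥ P.errMinor μ i t ω)

end Defs

variable {P} {T : ℕ}

lemma sigmaMajor_le_sig (g : S.Strategy) {t : ℕ} (ht : 1 ≤ t) (htT : t ≤ T) :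
    P.sigmaMajor g t ≤ P.sig T (S.prims T Set.univ t) :=
  (measurable_sig_infoMajor g (Set.mem_univ _) ht htT).comap_le

variable [mΩ : MeasurableSpace Ω] {μ : Measure Ω}

section MemLp

variable {g : S.Strategy} {t : ℕ} (i : Fin n)

lemma memLp_estMajor (hx : MemLp (P.state g t) 2 μ) : MemLp (P.estMajor μ g t) 2 μ :=
  hx.condExp one_le_two

lemma memLp_commonControl (hu : MemLp (P.control g t) 2 μ) : MemLp (P.commonControl μ g t) 2 μ :=
  hu.condExp one_le_two

lemma memLp_localState (hx : MemLp (P.state g t) 2 μ) : MemLp (P.localState μ g i t) 2 μ :=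
  memLp_comp (hx.sub (memLp_estMajor hx)) i.succ

lemma memLp_localControl (hu : MemLp (P.control g t) 2 μ) : MemLp (P.localControl μ g i t) 2 μ :=
  memLp_comp (hu.sub (memLp_commonControl hu)) i.succ

lemma memLp_localEst (hx : MemLp (P.state g t) 2 μ) : MemLp (P.localEst μ g i t) 2 μ := by
  have hi : MemLp (P.estMinor μ g i t) 2 μ := hx.condExp one_le_two
  exact (memLp_comp hi i.succ).sub (memLp_comp (memLp_estMajor hx) i.succ)

end MemLp

lemma gap_nonneg (g : S.Strategy) (t : ℕ) : 0 ≤ P.gap μ g T t :=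
  add_nonneg (quadMean_nonneg (S.posDef_weightC T t).posSemidef _)
    (Finset.sum_nonneg fun i _ => quadMean_nonneg (S.posDef_weightL T i t).posSemidef _)

lemma value_one_congr (hT : 1 ≤ T) (g g' : S.Strategy) : P.value μ g T 1 = P.value μ g' T 1 := by
  have hstate : P.state g 1 = P.state g' 1 := rfl
  have hsigma : P.sigmaMajor g 1 = P.sigmaMajor g' 1 := by
    rw [sigmaMajor_eq g le_rfl hT, sigmaMajor_eq g' le_rfl hT]
  have hest : P.estMajor μ g 1 = P.estMajor μ g' 1 := by rw [estMajor, estMajor, hsigma, hstate]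
  have hlocal (i : Fin n) : P.localState μ g i 1 = P.localState μ g' i 1 :=
    funext fun ω => by rw [localState, localState, hest, hstate]
  simp only [value, hest, hlocal]

namespace Admissible

variable (hP : P.Admissible T μ) [IsFiniteMeasure μ]

include hP

/-- Given the noises of the major agent, the minor agents are independent. -/
lemma orth_sub_condExp {X Y : Type*} [Fintype X] [Fintype Y] {i j : Fin n} (hij : i ≠ j) {t : ℕ}
    {f : Ω → X → ℝ} {f' : Ω → Y → ℝ} (hf : MemLp f 2 μ) (hf' : MemLp f' 2 μ)
    (hfm : Measurable[P.sig T (S.prims T {0, i.succ} t)] f)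
    (hfm' : Measurable[P.sig T (S.prims T {0, j.succ} t)] f') :
    Orth μ (f - μ[f | P.sig T (S.prims T {0} t)]) (f' - μ[f' | P.sig T (S.prims T {0} t)]) := by
  refine orth_sub_condExp_of_condExp_eq (sig_mono (System.prims_mono (by simp) t)) (hP.sig_le _)
    hf hf' ?_ hfm'.stronglyMeasurable
  rw [Set.insert_eq, System.prims_union]
  refine hP.condExp_sig_union (a := S.prims T {0, i.succ} t) (System.prims_mono (by simp) t)
    (System.prims_disjoint ?_ t t) hfm.stronglyMeasurable (hf.integrable one_le_two)
  simp [hij.symm, Fin.succ_ne_zero]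

section Stage

variable (g : S.Strategy) {t : ℕ} (ht : 1 ≤ t)

include ht

section Le

variable (htT : t ≤ T)

include htT

lemma quadMean_state (hx : MemLp (P.state g t) 2 μ)
    (M : Matrix (Σ i, Fin (S.dx i)) (Σ i, Fin (S.dx i)) ℝ) :
    quadMean μ M (P.state g t) = quadMean μ M (P.estMajor μ g t)
      + ∑ i : Fin n, quadMean μ (block M i.succ i.succ) (P.localState μ g i t) := by
  refine quadMean_eq_condExp_add_sum_block (hP.sigmaMajor_le g ht htT) hx
    (measurable_sigmaMajor_state g ht).stronglyMeasurable (fun i j hij => ?_) M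
  rw [sigmaMajor_eq g ht htT]
  exact hP.orth_sub_condExp hij (memLp_comp hx _) (memLp_comp hx _)
    (measurable_sig_state_succ g ht htT (by simp) (by simp))
    (measurable_sig_state_succ g ht htT (by simp) (by simp))

lemma quadMean_control (hu : MemLp (P.control g t) 2 μ)
    (M : Matrix (Σ i, Fin (S.du i)) (Σ i, Fin (S.du i)) ℝ) :
    quadMean μ M (P.control g t) = quadMean μ M (P.commonControl μ g t)
      + ∑ i : Fin n, quadMean μ (block M i.succ i.succ) (P.localControl μ g i t) := by
  have hminor (i : Fin n) : Measurable[P.sig T (S.prims T {0, i.succ} t)]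
      fun ω => comp (P.control g t ω) i.succ :=
    (measurable_sigmaMinor_control g i ht).mono (sigmaMinor_le_sig g ht htT i) le_rfl
  refine quadMean_eq_condExp_add_sum_block (hP.sigmaMajor_le g ht htT) hu
    (measurable_sigmaMajor_control g ht).stronglyMeasurable (fun i j hij => ?_) M
  rw [sigmaMajor_eq g ht htT]
  exact hP.orth_sub_condExp hij (memLp_comp hu _) (memLp_comp hu _) (hminor i) (hminor j)

omit g in
lemma memLp_stackMM_w : MemLp (fun ω => stackMM (d := S.dx) (P.w 0 t ω) fun _ => 0) 2 μ := by
  refine memLp_of_comp fun i => ?_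
  cases i using Fin.cases with
  | zero => exact hP.memLp_w ht htT 0
  | succ i =>
    simp only [comp_stackMM_succ]
    exact memLp_const 0

omit g in
lemma condExp_w_eq_zero (i : Fin (n + 1)) :
    μ[P.w i t | P.sig T (S.prims T Set.univ t)] =ᵐ[μ] 0 :=
  hP.condExp_family_eq_zero (k := .inr (.inl (i, ⟨t, Finset.mem_Icc.2 ⟨ht, htT⟩⟩)))
    fun h => lt_irrefl t h.2

omit g in
lemma condExp_stackMM_w_eq_zero :
    μ[fun ω => stackMM (d := S.dx) (P.w 0 t ω) fun _ => 0 | P.sig T (S.prims T Set.univ t)]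
      =ᵐ[μ] 0 := by
  have hw := (hP.memLp_stackMM_w ht htT).integrable one_le_two
  have hminor (i : Fin n) : μ[fun _ : Ω => (0 : Fin (S.dx i.succ) → ℝ) |
      P.sig T (S.prims T Set.univ t)] = 0 := condExp_zero
  filter_upwards [ae_all_iff.2 fun i => condExp_comp (m := P.sig T (S.prims T Set.univ t)) hw i,
    hP.condExp_w_eq_zero ht htT 0] with ω hcomp hmajor
  refine ext_comp fun i => ?_
  rw [← hcomp i]
  cases i using Fin.cases with
  | zero => exact hmajor
  | succ i => exact congrFun (hminor i) ω

lemma comp_state_sub_comp_estMinor (i : Fin n) (hx : Integrable (P.state g t) μ) :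
    ∀ᵐ ω ∂μ, comp (P.state g t ω) i.succ - comp (P.estMinor μ g i t ω) i.succ
      = P.errMinor μ i t ω := by
  have hsigma := P.sigmaMinor_eq g i ht
  have hfree := (hP.memLp_freeState i ht htT).integrable one_le_two
  have hstate := integrable_comp hx i.succ
  have hknown := condExp_of_stronglyMeasurable (hP.sigmaMinor_le g i ht htT)
    (P.measurable_sigmaMinor_state_sub_freeState g i ht).stronglyMeasurable (hstate.sub hfree)
  filter_upwards [condExp_sub hstate hfree (P.sigmaMinor g i t),
    condExp_comp (m := P.sigmaMinor g i t) hx i.succ] with ω hsub hcomp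
  have h := (congrFun hknown ω).symm.trans hsub
  rw [Pi.sub_apply, hcomp] at h
  rw [errMinor, ← hsigma, Pi.sub_apply, estMinor, sub_eq_sub_iff_sub_eq_sub]
  exact h

omit [IsFiniteMeasure μ] in
lemma memLp_errMinor (i : Fin n) : MemLp (P.errMinor μ i t) 2 μ :=
  (hP.memLp_freeState i ht htT).sub ((hP.memLp_freeState i ht htT).condExp one_le_two)

lemma condExp_errMinor_eq_zero (i : Fin n) : μ[P.errMinor μ i t | P.sigmaMinor g i t] =ᵐ[μ] 0 := by
  rw [errMinor, P.sigmaMinor_eq g i ht]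
  exact condExp_sub_condExp ((P.sigmaMinor_eq g i ht).ge.trans (hP.sigmaMinor_le g i ht htT))
    ((hP.memLp_freeState i ht htT).integrable one_le_two)

lemma quadMean_localControl_add (i : Fin n) (hx : MemLp (P.state g t) 2 μ)
    (hu : MemLp (P.control g t) 2 μ) (L : Matrix (Fin (S.du i.succ)) (Fin (S.dx i.succ)) ℝ)
    (M : Matrix (Fin (S.du i.succ)) (Fin (S.du i.succ)) ℝ) :
    quadMean μ M (fun ω => P.localControl μ g i t ω + L *ᵥ P.localState μ g i t ω)
      = quadMean μ M (fun ω => P.localControl μ g i t ω + L *ᵥ P.localEst μ g i t ω)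
        + quadMean μ M fun ω => L *ᵥ P.errMinor μ i t ω := by
  have herr := hP.memLp_errMinor ht htT i
  have hknown : MemLp (fun ω => P.localControl μ g i t ω + L *ᵥ P.localEst μ g i t ω) 2 μ :=
    (memLp_localControl i hu).add (memLp_mulVec L (memLp_localEst i hx))
  have hle := sigmaMajor_le_sigmaMinor (P := P) g i t
  have hmeas : StronglyMeasurable[P.sigmaMinor g i t]
      fun ω => P.localControl μ g i t ω + L *ᵥ P.localEst μ g i t ω :=
    ((measurable_sigmaMinor_control g i ht).stronglyMeasurable.sub
      (stronglyMeasurable_comp (stronglyMeasurable_condExp.mono hle) i.succ)).add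
      (stronglyMeasurable_mulVec L ((stronglyMeasurable_comp stronglyMeasurable_condExp i.succ).sub
        (stronglyMeasurable_comp (stronglyMeasurable_condExp.mono hle) i.succ)))
  have hzero : μ[fun ω => L *ᵥ P.errMinor μ i t ω | P.sigmaMinor g i t] =ᵐ[μ] 0 := by
    filter_upwards [condExp_mulVec (m := P.sigmaMinor g i t) L (herr.integrable one_le_two),
      hP.condExp_errMinor_eq_zero g ht htT i] with ω hL herr
    rw [hL, herr, Pi.zero_apply, Matrix.mulVec_zero, Pi.zero_apply]
  have horth := orth_of_condExp_eq_zero (hP.sigmaMinor_le g i ht htT) (memLp_mulVec L herr) hknown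
    hzero hmeas.aestronglyMeasurable
  rw [← horth.symm.quadMean_add hknown (memLp_mulVec L herr)]
  refine quadMean_congr ?_ M
  filter_upwards [hP.comp_state_sub_comp_estMinor g ht htT i (hx.integrable one_le_two)] with ω hω
  rw [Pi.add_apply, add_assoc, ← Matrix.mulVec_add, ← hω, localState, localEst, comp_sub,
    sub_add_sub_cancel']

end Le

variable (htT : t < T)

include htT

lemma localState_succ (i : Fin n) (hx : Integrable (P.state g t) μ)
    (hu : Integrable (P.control g t) μ) :
    ∀ᵐ ω ∂μ, P.localState μ g i (t + 1) ω = block S.A i.succ i.succ *ᵥ P.localState μ g i t ω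
      + block S.B i.succ i.succ *ᵥ P.localControl μ g i t ω + P.w i.succ t ω := by
  filter_upwards [hP.estMajor_succ g ht htT hx hu, hP.comp_estMajor_zero g ht htT.le hx,
    hP.comp_commonControl_zero g ht htT.le hu] with ω hsucc hstate hcontrol
  rw [localState, localState, localControl, comp_sub, comp_sub, comp_sub, hsucc,
    P.comp_state_succ_succ g ht, comp_add, comp_add, comp_mulVec_succ_of_sparse S.A_sparse,
    comp_mulVec_succ_of_sparse S.B_sparse, comp_stackMM_succ, hstate, hcontrol]
  simp only [Matrix.mulVec_sub]
  abel

variable (hx : MemLp (P.state g t) 2 μ) (hu : MemLp (P.control g t) 2 μ)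

include hx hu

lemma quadMean_estMajor_succ (M : Matrix (Σ i, Fin (S.dx i)) (Σ i, Fin (S.dx i)) ℝ) :
    quadMean μ M (P.estMajor μ g (t + 1))
      = quadMean μ M (fun ω => S.A *ᵥ P.estMajor μ g t ω + S.B *ᵥ P.commonControl μ g t ω)
        + quadMean μ M fun ω => stackMM (P.w 0 t ω) fun _ => 0 := by
  have hnext : MemLp (fun ω => S.A *ᵥ P.estMajor μ g t ω + S.B *ᵥ P.commonControl μ g t ω) 2 μ :=
    (memLp_mulVec S.A (memLp_estMajor hx)).add (memLp_mulVec S.B (memLp_commonControl hu))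
  have hle := sigmaMajor_le_sig (P := P) g ht htT.le
  have hmeas : StronglyMeasurable[P.sig T (S.prims T Set.univ t)]
      fun ω => S.A *ᵥ P.estMajor μ g t ω + S.B *ᵥ P.commonControl μ g t ω :=
    (stronglyMeasurable_mulVec S.A (stronglyMeasurable_condExp.mono hle)).add
      (stronglyMeasurable_mulVec S.B (stronglyMeasurable_condExp.mono hle))
  have hw := hP.memLp_stackMM_w ht htT.le
  have horth := orth_of_condExp_eq_zero (hP.sig_le _) hw hnext
    (hP.condExp_stackMM_w_eq_zero ht htT.le) hmeas.aestronglyMeasurable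
  rw [← horth.symm.quadMean_add hnext hw]
  exact quadMean_congr
    (hP.estMajor_succ g ht htT (hx.integrable one_le_two) (hu.integrable one_le_two)) M

lemma quadMean_localState_succ (i : Fin n)
    (M : Matrix (Fin (S.dx i.succ)) (Fin (S.dx i.succ)) ℝ) :
    quadMean μ M (P.localState μ g i (t + 1))
      = quadMean μ M (fun ω => block S.A i.succ i.succ *ᵥ P.localState μ g i t ω
          + block S.B i.succ i.succ *ᵥ P.localControl μ g i t ω)
        + quadMean μ M (P.w i.succ t) := by
  have hnext : MemLp (fun ω => block S.A i.succ i.succ *ᵥ P.localState μ g i t ω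
      + block S.B i.succ i.succ *ᵥ P.localControl μ g i t ω) 2 μ :=
    (memLp_mulVec (block S.A i.succ i.succ) (memLp_localState i hx)).add
      (memLp_mulVec (block S.B i.succ i.succ) (memLp_localControl i hu))
  have hle := sigmaMajor_le_sig (P := P) g ht htT.le
  have hstate : StronglyMeasurable[P.sig T (S.prims T Set.univ t)] (P.localState μ g i t) :=
    stronglyMeasurable_comp ((measurable_sig_state g ht htT.le).stronglyMeasurable.sub
      (stronglyMeasurable_condExp.mono hle)) i.succ
  have hcontrol : StronglyMeasurable[P.sig T (S.prims T Set.univ t)] (P.localControl μ g i t) :=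
    stronglyMeasurable_comp ((measurable_sig_control g ht htT.le).stronglyMeasurable.sub
      (stronglyMeasurable_condExp.mono hle)) i.succ
  have hmeas : StronglyMeasurable[P.sig T (S.prims T Set.univ t)]
      fun ω => block S.A i.succ i.succ *ᵥ P.localState μ g i t ω
        + block S.B i.succ i.succ *ᵥ P.localControl μ g i t ω :=
    (stronglyMeasurable_mulVec (block S.A i.succ i.succ) hstate).add
      (stronglyMeasurable_mulVec (block S.B i.succ i.succ) hcontrol)
  have hw := hP.memLp_w ht htT.le i.succ
  have horth := orth_of_condExp_eq_zero (hP.sig_le _) hw hnext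
    (hP.condExp_w_eq_zero ht htT.le i.succ) hmeas.aestronglyMeasurable
  rw [← horth.symm.quadMean_add hnext hw]
  exact quadMean_congr
    (hP.localState_succ g ht htT i (hx.integrable one_le_two) (hu.integrable one_le_two)) M

lemma common_stage :
    quadMean μ S.Q (P.estMajor μ g t) + quadMean μ S.R (P.commonControl μ g t)
        + quadMean μ (S.riccatiC T (t + 1)) (P.estMajor μ g (t + 1))
      = quadMean μ (S.riccatiC T t) (P.estMajor μ g t)
        + quadMean μ (S.weightC T t)
            (fun ω => P.commonControl μ g t ω + S.gainC T t *ᵥ P.estMajor μ g t ω)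
        + quadMean μ (S.riccatiC T (t + 1)) (fun ω => stackMM (P.w 0 t ω) fun _ => 0) := by
  rw [hP.quadMean_estMajor_succ g ht htT hx hu, ← add_assoc,
    quadMean_complete_square (S.posSemidef_riccatiC T (t + 1)) S.A S.B S.Q S.R_posDef
      (memLp_estMajor hx) (memLp_commonControl hu), ← S.riccatiC_eq_riccatiOp htT]
  rfl

lemma local_stage (i : Fin n) :
    quadMean μ (block S.Q i.succ i.succ) (P.localState μ g i t)
        + quadMean μ (block S.R i.succ i.succ) (P.localControl μ g i t)
        + quadMean μ (S.riccatiL T i (t + 1)) (P.localState μ g i (t + 1))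
      = quadMean μ (S.riccatiL T i t) (P.localState μ g i t)
        + quadMean μ (S.weightL T i t)
            (fun ω => P.localControl μ g i t ω + S.gainL T i t *ᵥ P.localEst μ g i t ω)
        + (quadMean μ (S.riccatiL T i (t + 1)) (P.w i.succ t)
          + quadMean μ (S.weightL T i t) fun ω => S.gainL T i t *ᵥ P.errMinor μ i t ω) := by
  have hsquare := quadMean_complete_square (S.posSemidef_riccatiL T i (t + 1))
    (block S.A i.succ i.succ) (block S.B i.succ i.succ) (block S.Q i.succ i.succ)
    (S.posDef_block_R i.succ) (memLp_localState i hx) (memLp_localControl i hu)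
  rw [← S.riccatiL_eq_riccatiOp i htT] at hsquare
  have herror := hP.quadMean_localControl_add g ht htT.le i hx hu (S.gainL T i t) (S.weightL T i t)
  rw [hP.quadMean_localState_succ g ht htT hx hu]
  simp only [System.gainL, System.weightL] at hsquare herror ⊢
  linarith

lemma stage_add_value :
    quadMean μ S.Q (P.state g t) + quadMean μ S.R (P.control g t) + P.value μ g T (t + 1)
      = P.value μ g T t + P.gap μ g T t + P.noiseCost μ T t := by
  have hlocal := Finset.sum_congr rfl fun (i : Fin n) (_ : i ∈ Finset.univ) =>
    hP.local_stage g ht htT hx hu i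
  simp only [Finset.sum_add_distrib] at hlocal
  simp only [hP.quadMean_state g ht htT.le hx, hP.quadMean_control g ht htT.le hu, value, gap,
    noiseCost, Finset.sum_add_distrib]
  linarith [hP.common_stage g ht htT hx hu]

end Stage

end Admissible

end Primitives

/-! ### The total cost -/

namespace Primitives

variable {n : ℕ} {S : System n} {Ω : Type*} {P : Primitives S Ω} {T : ℕ}

lemma stageCost_nonneg (g : S.Strategy) (t : ℕ) (ω : Ω) :
    0 ≤ P.state g t ω ⬝ᵥ S.Q *ᵥ P.state g t ω + P.control g t ω ⬝ᵥ S.R *ᵥ P.control g t ω :=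
  add_nonneg (S.Q_posSemidef.dotProduct_mulVec_nonneg _)
    (S.R_posDef.posSemidef.dotProduct_mulVec_nonneg _)

lemma pathCost_nonneg (g : S.Strategy) (ω : Ω) : 0 ≤ P.pathCost T g ω :=
  add_nonneg (Finset.sum_nonneg fun t _ => stageCost_nonneg g t ω)
    (S.QT_posSemidef.dotProduct_mulVec_nonneg _)

lemma controlCost_le_pathCost (g : S.Strategy) {t : ℕ} (ht : 1 ≤ t) (htT : t < T) (ω : Ω) :
    P.control g t ω ⬝ᵥ S.R *ᵥ P.control g t ω ≤ P.pathCost T g ω :=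
  calc P.control g t ω ⬝ᵥ S.R *ᵥ P.control g t ω
    _ ≤ P.state g t ω ⬝ᵥ S.Q *ᵥ P.state g t ω + P.control g t ω ⬝ᵥ S.R *ᵥ P.control g t ω :=
      le_add_of_nonneg_left (S.Q_posSemidef.dotProduct_mulVec_nonneg _)
    _ ≤ ∑ t ∈ Finset.Ico 1 T, (P.state g t ω ⬝ᵥ S.Q *ᵥ P.state g t ω
          + P.control g t ω ⬝ᵥ S.R *ᵥ P.control g t ω) :=
      Finset.single_le_sum (fun t _ => stageCost_nonneg g t ω) (Finset.mem_Ico.2 ⟨ht, htT⟩)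
    _ ≤ P.pathCost T g ω := le_add_of_nonneg_right (S.QT_posSemidef.dotProduct_mulVec_nonneg _)

variable [MeasurableSpace Ω] {μ : Measure Ω}

lemma value_nonneg (g : S.Strategy) (t : ℕ) : 0 ≤ P.value μ g T t :=
  add_nonneg (quadMean_nonneg (S.posSemidef_riccatiC T t) _)
    (Finset.sum_nonneg fun i _ => quadMean_nonneg (S.posSemidef_riccatiL T i t) _)

lemma noiseCost_nonneg (t : ℕ) : 0 ≤ P.noiseCost μ T t :=
  add_nonneg (quadMean_nonneg (S.posSemidef_riccatiC T (t + 1)) _)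
    (Finset.sum_nonneg fun i _ => add_nonneg
      (quadMean_nonneg (S.posSemidef_riccatiL T i (t + 1)) _)
      (quadMean_nonneg (S.posDef_weightL T i t).posSemidef _))

lemma gap_eq_zero_iff {g : S.Strategy} {t : ℕ} (hx : MemLp (P.state g t) 2 μ)
    (hu : MemLp (P.control g t) 2 μ) :
    P.gap μ g T t = 0 ↔
      (fun ω => P.commonControl μ g t ω + S.gainC T t *ᵥ P.estMajor μ g t ω) =ᵐ[μ] 0 ∧
      ∀ i, (fun ω => P.localControl μ g i t ω + S.gainL T i t *ᵥ P.localEst μ g i t ω)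
        =ᵐ[μ] 0 := by
  have hcommon : MemLp (fun ω => P.commonControl μ g t ω + S.gainC T t *ᵥ P.estMajor μ g t ω) 2 μ :=
    (memLp_commonControl hu).add (memLp_mulVec (S.gainC T t) (memLp_estMajor hx))
  have hlocal (i : Fin n) :
      MemLp (fun ω => P.localControl μ g i t ω + S.gainL T i t *ᵥ P.localEst μ g i t ω) 2 μ :=
    (memLp_localControl i hu).add (memLp_mulVec (S.gainL T i t) (memLp_localEst i hx))
  have hnonneg (i : Fin n) := quadMean_nonneg (μ := μ) (S.posDef_weightL T i t).posSemidef
    fun ω => P.localControl μ g i t ω + S.gainL T i t *ᵥ P.localEst μ g i t ω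
  rw [gap, add_eq_zero_iff_of_nonneg (quadMean_nonneg (S.posDef_weightC T t).posSemidef _)
    (Finset.sum_nonneg fun i _ => hnonneg i), quadMean_eq_zero_iff (S.posDef_weightC T t) hcommon,
    Finset.sum_eq_zero_iff_of_nonneg fun i _ => hnonneg i]
  simp only [Finset.mem_univ, true_imp_iff,
    quadMean_eq_zero_iff (S.posDef_weightL T _ t) (hlocal _)]

namespace Admissible

variable (hP : P.Admissible T μ) (g : S.Strategy)

include hP

lemma memLp_control_of_cost_lt_top (hcost : P.cost μ T g < ⊤) {t : ℕ} (ht : 1 ≤ t) (htT : t < T) :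
    MemLp (P.control g t) 2 μ := by
  have hmeas := hP.measurable_control g ht htT.le
  have hcont : Continuous fun u : S.Control => u ⬝ᵥ S.R *ᵥ u :=
    continuous_id.dotProduct (mulVecCLM S.R).continuous
  refine memLp_of_integrable_dotProduct_mulVec S.R_posDef hmeas ?_
  refine (lintegral_ofReal_ne_top_iff_integrable
    (hcont.measurable.comp hmeas).aestronglyMeasurable (.of_forall fun ω =>
      S.R_posDef.posSemidef.dotProduct_mulVec_nonneg _)).1 (ne_top_of_le_ne_top hcost.ne ?_)
  exact lintegral_mono fun ω => ENNReal.ofReal_le_ofReal (controlCost_le_pathCost g ht htT ω)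

section CostEq

variable [IsFiniteMeasure μ] (hu : ∀ t, 1 ≤ t → t < T → MemLp (P.control g t) 2 μ)

include hu

lemma integrable_stageCost {t : ℕ} (ht : t ∈ Finset.Ico 1 T) :
    Integrable (fun ω => P.state g t ω ⬝ᵥ S.Q *ᵥ P.state g t ω
      + P.control g t ω ⬝ᵥ S.R *ᵥ P.control g t ω) μ := by
  obtain ⟨ht, htT⟩ := Finset.mem_Ico.1 ht
  have hx := hP.memLp_state g ht htT.le le_rfl hu
  exact (integrable_dotProduct_mulVec hx hx S.Q).add
    (integrable_dotProduct_mulVec (hu t ht htT) (hu t ht htT) S.R)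

variable (hT : 1 ≤ T)

include hT

lemma integrable_pathCost : Integrable (P.pathCost T g) μ :=
  (integrable_finsetSum _ fun _ ht => hP.integrable_stageCost g hu ht).add
    (integrable_dotProduct_mulVec (hP.memLp_state g hT le_rfl le_rfl hu)
      (hP.memLp_state g hT le_rfl le_rfl hu) S.QT)

lemma integral_pathCost :
    ∫ ω, P.pathCost T g ω ∂μ
      = ∑ t ∈ Finset.Ico 1 T, (quadMean μ S.Q (P.state g t) + quadMean μ S.R (P.control g t))
        + quadMean μ S.QT (P.state g T) := by
  have hx {t : ℕ} (ht : 1 ≤ t) (htT : t ≤ T) := hP.memLp_state g ht htT le_rfl hu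
  have hstage (t : ℕ) (ht : t ∈ Finset.Ico 1 T) := hP.integrable_stageCost g hu ht
  simp only [pathCost]
  rw [integral_add (integrable_finsetSum _ hstage)
    (integrable_dotProduct_mulVec (hx hT le_rfl) (hx hT le_rfl) S.QT),
    integral_finsetSum _ hstage]
  refine congrArg (· + _) (Finset.sum_congr rfl fun t ht => ?_)
  obtain ⟨ht, htT⟩ := Finset.mem_Ico.1 ht
  exact integral_add (integrable_dotProduct_mulVec (hx ht htT.le) (hx ht htT.le) S.Q)
    (integrable_dotProduct_mulVec (hu t ht htT) (hu t ht htT) S.R)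

lemma integral_pathCost_eq_value_add :
    ∫ ω, P.pathCost T g ω ∂μ
      = P.value μ g T 1 + ∑ t ∈ Finset.Ico 1 T, P.noiseCost μ T t
        + ∑ t ∈ Finset.Ico 1 T, P.gap μ g T t := by
  have hx {t : ℕ} (ht : 1 ≤ t) (htT : t ≤ T) := hP.memLp_state g ht htT le_rfl hu
  have hterminal : quadMean μ S.QT (P.state g T) = P.value μ g T T := by
    rw [hP.quadMean_state g hT le_rfl (hx hT le_rfl), value, S.riccatiC_self]
    simp only [S.riccatiL_self]
  have hstage : ∀ t ∈ Finset.Ico 1 T,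
      quadMean μ S.Q (P.state g t) + quadMean μ S.R (P.control g t)
        = P.noiseCost μ T t + P.gap μ g T t - (P.value μ g T (t + 1) - P.value μ g T t) := by
    intro t ht
    obtain ⟨ht, htT⟩ := Finset.mem_Ico.1 ht
    linarith [hP.stage_add_value g ht htT (hx ht htT.le) (hu t ht htT)]
  rw [hP.integral_pathCost g hu hT, hterminal, Finset.sum_congr rfl hstage,
    Finset.sum_sub_distrib, Finset.sum_Ico_sub _ hT, Finset.sum_add_distrib]
  ring

lemma cost_eq :
    P.cost μ T g
      = ENNReal.ofReal (P.value μ g T 1 + ∑ t ∈ Finset.Ico 1 T, P.noiseCost μ T t)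
        + ENNReal.ofReal (∑ t ∈ Finset.Ico 1 T, P.gap μ g T t) := by
  rw [← ENNReal.ofReal_add
    (add_nonneg (value_nonneg g 1) (Finset.sum_nonneg fun t _ => noiseCost_nonneg t))
    (Finset.sum_nonneg fun t _ => gap_nonneg g t), ← hP.integral_pathCost_eq_value_add g hu hT,
    cost, ofReal_integral_eq_lintegral_ofReal (hP.integrable_pathCost g hu hT)
      (.of_forall (pathCost_nonneg g))]

end CostEq

end Admissible

/-! ### Strategies that follow the gains -/

/-- The actions at time `t` are given by the gains and the estimates. -/
def FollowsGains (P : Primitives S Ω) (μ : Measure Ω) (T : ℕ) (g : S.Strategy) (t : ℕ) : Prop :=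
  ∀ᵐ ω ∂μ,
    comp (P.control g t ω) 0 = -(blockRow (S.gainC T t) 0 *ᵥ P.estMajor μ g t ω) ∧
    ∀ i : Fin n, comp (P.control g t ω) i.succ
      = -(blockRow (S.gainC T t) i.succ *ᵥ P.estMajor μ g t ω)
        - S.gainL T i t *ᵥ P.localEst μ g i t ω

lemma memLp_control_of_followsGains {g : S.Strategy} {t : ℕ} (hx : MemLp (P.state g t) 2 μ)
    (hg : P.FollowsGains μ T g t) : MemLp (P.control g t) 2 μ := by
  have hcommon (i : Fin (n + 1)) :=
    (memLp_mulVec (blockRow (S.gainC T t) i) (memLp_estMajor hx)).neg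
  refine memLp_of_comp fun i => ?_
  cases i using Fin.cases with
  | zero => exact (hcommon 0).ae_eq (hg.mono fun ω hω => hω.1.symm)
  | succ i =>
    exact ((hcommon i.succ).sub (memLp_mulVec (S.gainL T i t) (memLp_localEst i hx))).ae_eq
      (hg.mono fun ω hω => (hω.2 i).symm)

namespace Admissible

variable (hP : P.Admissible T μ) [IsFiniteMeasure μ] {g : S.Strategy} {t : ℕ} (ht : 1 ≤ t)

include hP ht

variable (g) in
lemma condExp_localEst_eq_zero (htT : t ≤ T) (i : Fin n) :
    μ[P.localEst μ g i t | P.sigmaMajor g t] =ᵐ[μ] 0 := by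
  have hminor : Integrable (P.estMinor μ g i t) μ := integrable_condExp
  have hmajor : Integrable (P.estMajor μ g t) μ := integrable_condExp
  have htower : μ[P.estMinor μ g i t | P.sigmaMajor g t] =ᵐ[μ] P.estMajor μ g t :=
    condExp_condExp_of_le (sigmaMajor_le_sigmaMinor g i t) (hP.sigmaMinor_le g i ht htT)
  have hknown : μ[P.estMajor μ g t | P.sigmaMajor g t] = P.estMajor μ g t :=
    condExp_of_stronglyMeasurable (hP.sigmaMajor_le g ht htT) stronglyMeasurable_condExp hmajor
  filter_upwards [condExp_sub (integrable_comp hminor i.succ) (integrable_comp hmajor i.succ)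
    (P.sigmaMajor g t), condExp_comp (m := P.sigmaMajor g t) hminor i.succ,
    condExp_comp (m := P.sigmaMajor g t) hmajor i.succ, htower] with ω hsub hcomp hcomp' htower
  refine hsub.trans ?_
  rw [Pi.sub_apply, hcomp, hcomp', htower, hknown, sub_self, Pi.zero_apply]

lemma memLp_of_followsGains (hg : ∀ t, 1 ≤ t → t < T → P.FollowsGains μ T g t) (htT : t < T) :
    MemLp (P.control g t) 2 μ := by
  suffices hx : MemLp (P.state g t) 2 μ from memLp_control_of_followsGains hx (hg t ht htT)
  replace htT := htT.le
  induction t, ht using Nat.le_induction with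
  | base => exact hP.memLp_state_one g
  | succ t ht ih =>
    have hx := ih (Nat.le_of_succ_le htT)
    exact hP.memLp_state_succ g ht (Nat.le_of_succ_le htT) le_rfl hx
      (memLp_control_of_followsGains hx (hg t ht htT))

variable (htT : t < T) (hx : MemLp (P.state g t) 2 μ)

include htT hx

lemma comp_commonControl_of_followsGains (hg : P.FollowsGains μ T g t) (i : Fin n) :
    ∀ᵐ ω ∂μ, comp (P.commonControl μ g t ω) i.succ
      = -(blockRow (S.gainC T t) i.succ *ᵥ P.estMajor μ g t ω) := by
  have hu := (memLp_control_of_followsGains hx hg).integrable one_le_two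
  have hlocal := (memLp_localEst i hx).integrable one_le_two
  have hcommon : Integrable (fun ω => blockRow (S.gainC T t) i.succ *ᵥ P.estMajor μ g t ω) μ :=
    integrable_mulVec _ integrable_condExp
  have hest : StronglyMeasurable[P.sigmaMajor g t] (P.estMajor μ g t) := stronglyMeasurable_condExp
  have hknown := condExp_of_stronglyMeasurable (hP.sigmaMajor_le g ht htT.le)
    (stronglyMeasurable_mulVec (blockRow (S.gainC T t) i.succ) hest).neg hcommon.neg
  have hcontrol : μ[fun ω => comp (P.control g t ω) i.succ | P.sigmaMajor g t] =ᵐ[μ]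
      μ[(fun ω => -(blockRow (S.gainC T t) i.succ *ᵥ P.estMajor μ g t ω))
        - (fun ω => S.gainL T i t *ᵥ P.localEst μ g i t ω) | P.sigmaMajor g t] :=
    condExp_congr_ae (hg.mono fun ω hω => hω.2 i)
  filter_upwards [hcontrol, condExp_sub hcommon.neg (integrable_mulVec (S.gainL T i t) hlocal)
    (P.sigmaMajor g t), condExp_comp (m := P.sigmaMajor g t) hu i.succ,
    condExp_mulVec (m := P.sigmaMajor g t) (S.gainL T i t) hlocal,
    hP.condExp_localEst_eq_zero g ht htT.le i] with ω hcontrol hsub hcomp hmul hzero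
  rw [commonControl, ← hcomp, hcontrol]
  refine hsub.trans ?_
  rw [Pi.sub_apply, hknown, hmul, hzero, Pi.zero_apply, Matrix.mulVec_zero, sub_zero]
  rfl

lemma commonControl_of_followsGains (hg : P.FollowsGains μ T g t) :
    ∀ᵐ ω ∂μ, P.commonControl μ g t ω = -(S.gainC T t *ᵥ P.estMajor μ g t ω) := by
  have hu := (memLp_control_of_followsGains hx hg).integrable one_le_two
  filter_upwards [hg, hP.comp_commonControl_zero g ht htT.le hu,
    ae_all_iff.2 (hP.comp_commonControl_of_followsGains ht htT hx hg)] with ω hω hmajor hminor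
  refine ext_comp fun i => ?_
  rw [comp_neg, comp_mulVec]
  cases i using Fin.cases with
  | zero => rw [hmajor, hω.1]
  | succ i => rw [hminor i]

lemma gap_eq_zero_of_followsGains (hg : P.FollowsGains μ T g t) : P.gap μ g T t = 0 := by
  have hcommon := hP.commonControl_of_followsGains ht htT hx hg
  refine (gap_eq_zero_iff hx (memLp_control_of_followsGains hx hg)).2 ⟨?_, fun i => ?_⟩
  · filter_upwards [hcommon] with ω hω
    rw [hω, neg_add_cancel, Pi.zero_apply]
  · filter_upwards [hcommon, hg] with ω hω hcontrol
    rw [localControl, comp_sub, hcontrol.2 i, hω, comp_neg, comp_mulVec, Pi.zero_apply]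
    abel

lemma followsGains_of_gap_eq_zero (hu : MemLp (P.control g t) 2 μ) (hgap : P.gap μ g T t = 0) :
    P.FollowsGains μ T g t := by
  obtain ⟨hcommon, hlocal⟩ := (gap_eq_zero_iff hx hu).1 hgap
  filter_upwards [hcommon, ae_all_iff.2 hlocal,
    hP.comp_commonControl_zero g ht htT.le (hu.integrable one_le_two)] with ω hcommon hlocal hmajor
  replace hcommon (i : Fin (n + 1)) : comp (P.commonControl μ g t ω) i
      = -(blockRow (S.gainC T t) i *ᵥ P.estMajor μ g t ω) := by
    rw [eq_neg_of_add_eq_zero_left hcommon, comp_neg, comp_mulVec]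
  refine ⟨hmajor.symm.trans (hcommon 0), fun i => ?_⟩
  have hlocal := eq_neg_of_add_eq_zero_left (hlocal i)
  rw [localControl, comp_sub, hcommon i.succ, sub_eq_iff_eq_add'] at hlocal
  rw [hlocal, sub_eq_add_neg]

end Admissible

end Primitives

/-! ### Existence, optimality and uniqueness -/

/-- The strategy `g`, with the laws at time `t` replaced by `a` and `b`. -/
def System.Strategy.update {n : ℕ} {S : System n} (g : S.Strategy) (t : ℕ)
    {a : S.InfoMajor t → Fin (S.du 0) → ℝ} (ha : Measurable a)
    {b : (i : Fin n) → S.InfoMinor i t → Fin (S.du i.succ) → ℝ} (hb : ∀ i, Measurable (b i)) :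
    S.Strategy where
  major := Function.update g.major t a
  minor i := Function.update (g.minor i) t (b i)
  measurable_major s := by
    rcases eq_or_ne s t with rfl | h
    · rwa [Function.update_self]
    · rw [Function.update_of_ne h]
      exact g.measurable_major s
  measurable_minor i s := by
    rcases eq_or_ne s t with rfl | h
    · rw [Function.update_self]
      exact hb i
    · rw [Function.update_of_ne h]
      exact g.measurable_minor i s

namespace Primitives

variable {n : ℕ} {S : System n} {Ω : Type*} {P : Primitives S Ω} {T : ℕ}

section Update

variable (g : S.Strategy) {t : ℕ} {a : S.InfoMajor t → Fin (S.du 0) → ℝ} (ha : Measurable a)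
  {b : (i : Fin n) → S.InfoMinor i t → Fin (S.du i.succ) → ℝ} (hb : ∀ i, Measurable (b i))

lemma control_update_of_lt {s : ℕ} (hs : 1 ≤ s) (hst : s < t) (ω : Ω) :
    P.control (g.update t ha hb) s ω = P.control g s ω :=
  P.control_congr (fun _ _ hr => Function.update_of_ne hr.ne _ _)
    (fun _ _ _ hr => Function.update_of_ne hr.ne _ _) ω s hs hst

variable (ht : 1 ≤ t) (ω : Ω)

include ht

lemma comp_control_update_zero :
    comp (P.control (g.update t ha hb) t ω) 0 = a (P.infoMajor g t ω) := by
  have hinfo : P.infoMajor (g.update t ha hb) t ω = P.infoMajor g t ω :=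
    P.infoMajorOf_congr fun s hs hst => control_update_of_lt g ha hb hs hst ω
  rw [P.comp_control_zero _ ht, hinfo]
  exact congrFun (Function.update_self t a g.major) _

lemma comp_control_update_succ (i : Fin n) :
    comp (P.control (g.update t ha hb) t ω) i.succ = b i (P.infoMinor g i t ω) := by
  have hinfo : P.infoMinor (g.update t ha hb) i t ω = P.infoMinor g i t ω :=
    P.infoMinorOf_congr fun s hs hst => control_update_of_lt g ha hb hs hst ω
  rw [P.comp_control_succ _ ht, hinfo]
  exact congrFun (Function.update_self t (b i) (g.minor i)) _

end Update

variable [MeasurableSpace Ω] {μ : Measure Ω}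

section Congr

variable {g g' : S.Strategy} {t : ℕ}
  (h : ∀ s, 1 ≤ s → s < t → P.control g s =ᵐ[μ] P.control g' s)

include h

lemma forall_control_eq_ae : ∀ᵐ ω ∂μ, ∀ s, 1 ≤ s → s < t → P.control g s ω = P.control g' s ω :=
  ae_all_iff.2 fun s => ae_all_iff.2 fun hs => ae_all_iff.2 fun hst => h s hs hst

lemma state_ae_eq : P.state g t =ᵐ[μ] P.state g' t :=
  (forall_control_eq_ae h).mono fun _ hω => P.stateOf_congr hω

lemma infoMajor_ae_eq : P.infoMajor g t =ᵐ[μ] P.infoMajor g' t :=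
  (forall_control_eq_ae h).mono fun _ hω => P.infoMajorOf_congr hω

lemma infoMinor_ae_eq (i : Fin n) : P.infoMinor g i t =ᵐ[μ] P.infoMinor g' i t :=
  (forall_control_eq_ae h).mono fun _ hω => P.infoMinorOf_congr hω

variable (ht : 1 ≤ t) (htT : t ≤ T)

include ht htT

lemma estMajor_ae_eq : P.estMajor μ g t =ᵐ[μ] P.estMajor μ g' t := by
  rw [estMajor, estMajor, sigmaMajor_eq g ht htT, sigmaMajor_eq g' ht htT]
  exact condExp_congr_ae (state_ae_eq h)

lemma localEst_ae_eq (i : Fin n) : P.localEst μ g i t =ᵐ[μ] P.localEst μ g' i t := by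
  have hminor : P.estMinor μ g i t =ᵐ[μ] P.estMinor μ g' i t := by
    rw [estMinor, estMinor, P.sigmaMinor_eq g i ht, P.sigmaMinor_eq g' i ht]
    exact condExp_congr_ae (state_ae_eq h)
  filter_upwards [hminor, estMajor_ae_eq h ht htT] with ω hminor hmajor
  rw [localEst, localEst, hminor, hmajor]

end Congr

lemma FollowsGains.congr_ae {g g' : S.Strategy} {t : ℕ} (hg : P.FollowsGains μ T g t)
    (ht : 1 ≤ t) (htT : t ≤ T) (h : ∀ s, 1 ≤ s → s ≤ t → P.control g s =ᵐ[μ] P.control g' s) :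
    P.FollowsGains μ T g' t := by
  have hpast := fun s hs (hst : s < t) => h s hs hst.le
  filter_upwards [hg, h t ht le_rfl, estMajor_ae_eq hpast ht htT,
    ae_all_iff.2 (localEst_ae_eq hpast ht htT)] with ω hω hcontrol hmajor hminor
  simpa only [hcontrol, hmajor, hminor] using hω

lemma control_ae_eq_of_followsGains {g g' : S.Strategy}
    (hg : ∀ t, 1 ≤ t → t < T → P.FollowsGains μ T g t)
    (hg' : ∀ t, 1 ≤ t → t < T → P.FollowsGains μ T g' t) (t : ℕ) (ht : 1 ≤ t) (htT : t < T) :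
    P.control g t =ᵐ[μ] P.control g' t := by
  induction t using Nat.strong_induction_on with
  | _ t ih =>
    have hpast := fun s hs hst => ih s hst hs (hst.trans htT)
    filter_upwards [hg t ht htT, hg' t ht htT, estMajor_ae_eq hpast ht htT.le,
      ae_all_iff.2 (localEst_ae_eq hpast ht htT.le)] with ω hω hω' hmajor hminor
    refine ext_comp fun i => ?_
    cases i using Fin.cases with
    | zero => rw [hω.1, hω'.1, hmajor]
    | succ i => rw [hω.2 i, hω'.2 i, hmajor, hminor i]

variable (P μ) in
lemma exists_measurable_major (g : S.Strategy) (t : ℕ)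
    (L : Matrix (Fin (S.du 0)) (Σ i, Fin (S.dx i)) ℝ) :
    ∃ a : S.InfoMajor t → Fin (S.du 0) → ℝ, Measurable a ∧
      ∀ ω, a (P.infoMajor g t ω) = -(L *ᵥ P.estMajor μ g t ω) := by
  have hest : StronglyMeasurable[P.sigmaMajor g t] (P.estMajor μ g t) := stronglyMeasurable_condExp
  obtain ⟨a, ha, h⟩ := (stronglyMeasurable_mulVec L hest).neg.measurable.exists_eq_measurable_comp
  exact ⟨a, ha, fun ω => (congrFun h ω).symm⟩

variable (P μ) in
lemma exists_measurable_minor (g : S.Strategy) (i : Fin n) (t : ℕ)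
    (L : Matrix (Fin (S.du i.succ)) (Σ i, Fin (S.dx i)) ℝ)
    (L' : Matrix (Fin (S.du i.succ)) (Fin (S.dx i.succ)) ℝ) :
    ∃ b : S.InfoMinor i t → Fin (S.du i.succ) → ℝ, Measurable b ∧
      ∀ ω, b (P.infoMinor g i t ω) = -(L *ᵥ P.estMajor μ g t ω) - L' *ᵥ P.localEst μ g i t ω := by
  have hminor : StronglyMeasurable[P.sigmaMinor g i t] (P.estMinor μ g i t) :=
    stronglyMeasurable_condExp
  have hmajor : StronglyMeasurable[P.sigmaMinor g i t] (P.estMajor μ g t) :=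
    stronglyMeasurable_condExp.mono (sigmaMajor_le_sigmaMinor g i t)
  have hlocal : StronglyMeasurable[P.sigmaMinor g i t] (P.localEst μ g i t) :=
    (stronglyMeasurable_comp hminor i.succ).sub (stronglyMeasurable_comp hmajor i.succ)
  obtain ⟨b, hb, h⟩ := ((stronglyMeasurable_mulVec L hmajor).neg.sub
    (stronglyMeasurable_mulVec L' hlocal)).measurable.exists_eq_measurable_comp
  exact ⟨b, hb, fun ω => (congrFun h ω).symm⟩

variable (P μ) in
lemma exists_followsGains_lt {k : ℕ} (hk : k ≤ T) :
    ∃ g : S.Strategy, ∀ t, 1 ≤ t → t < k → P.FollowsGains μ T g t := by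
  induction k with
  | zero =>
    exact ⟨⟨fun _ _ => 0, fun _ _ _ => 0, fun _ => measurable_const, fun _ _ => measurable_const⟩,
      fun _ _ ht => absurd ht (Nat.not_lt_zero _)⟩
  | succ k ih =>
    obtain ⟨g, hg⟩ := ih (Nat.le_of_succ_le hk)
    obtain ⟨a, ha, hmajor⟩ := P.exists_measurable_major μ g k (blockRow (S.gainC T k) 0)
    choose b hb hminor using fun i =>
      P.exists_measurable_minor μ g i k (blockRow (S.gainC T k) i.succ) (S.gainL T i k)
    have hpast (s : ℕ) (hs : 1 ≤ s) (hsk : s < k) :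
        P.control g s =ᵐ[μ] P.control (g.update k ha hb) s :=
      .of_forall fun ω => (control_update_of_lt g ha hb hs hsk ω).symm
    refine ⟨g.update k ha hb, fun t ht htk => ?_⟩
    rcases (Nat.lt_succ_iff.1 htk).lt_or_eq with htk | rfl
    · exact (hg t ht htk).congr_ae ht (by omega) fun s hs hst => hpast s hs (hst.trans_lt htk)
    · filter_upwards [estMajor_ae_eq hpast ht (Nat.le_of_succ_le hk),
        ae_all_iff.2 (localEst_ae_eq hpast ht (Nat.le_of_succ_le hk))] with ω hest hlocal
      simp only [comp_control_update_zero g ha hb ht, comp_control_update_succ g ha hb ht, hmajor,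
        hminor, hest, hlocal, implies_true, and_self]

namespace Admissible

variable (hP : P.Admissible T μ)

include hP

section Laws

variable {g g' : S.Strategy} {t : ℕ} (ht : 1 ≤ t) (htT : t < T)
  (h : ∀ s, 1 ≤ s → s < T → P.control g s =ᵐ[μ] P.control g' s)

include ht htT h

lemma major_ae_eq : g.major t =ᵐ[μ.map (P.infoMajor g t)] g'.major t := by
  refine (ae_map_iff (hP.measurable_infoMajor g ht htT.le).aemeasurable
    (measurableSet_eq_fun (g.measurable_major t) (g'.measurable_major t))).2 ?_
  filter_upwards [h t ht htT, infoMajor_ae_eq fun s hs hst => h s hs (hst.trans htT)]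
    with ω hcontrol hinfo
  rw [← P.comp_control_zero g ht, hcontrol, P.comp_control_zero g' ht, hinfo]

lemma minor_ae_eq (i : Fin n) : g.minor i t =ᵐ[μ.map (P.infoMinor g i t)] g'.minor i t := by
  refine (ae_map_iff (hP.measurable_infoMinor g i ht htT.le).aemeasurable
    (measurableSet_eq_fun (g.measurable_minor i t) (g'.measurable_minor i t))).2 ?_
  filter_upwards [h t ht htT, infoMinor_ae_eq (fun s hs hst => h s hs (hst.trans htT)) i]
    with ω hcontrol hinfo
  rw [← P.comp_control_succ g ht, hcontrol, P.comp_control_succ g' ht, hinfo]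

end Laws

variable [IsFiniteMeasure μ] (hT : 1 ≤ T)

section Optimality

include hT

lemma cost_lt_top_of_memLp {g : S.Strategy}
    (hu : ∀ t, 1 ≤ t → t < T → MemLp (P.control g t) 2 μ) : P.cost μ T g < ⊤ := by
  rw [hP.cost_eq g hu hT]
  exact ENNReal.add_lt_top.2 ⟨ENNReal.ofReal_lt_top, ENNReal.ofReal_lt_top⟩

lemma cost_eq_add_gap {g g' : S.Strategy} (hg : ∀ t, 1 ≤ t → t < T → P.FollowsGains μ T g t)
    (hu : ∀ t, 1 ≤ t → t < T → MemLp (P.control g' t) 2 μ) :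
    P.cost μ T g'
      = P.cost μ T g + ENNReal.ofReal (∑ t ∈ Finset.Ico 1 T, P.gap μ g' T t) := by
  have hug := fun t ht htT => hP.memLp_of_followsGains (t := t) ht hg htT
  have hgap : ∑ t ∈ Finset.Ico 1 T, P.gap μ g T t = 0 := Finset.sum_eq_zero fun t ht => by
    obtain ⟨ht, htT⟩ := Finset.mem_Ico.1 ht
    exact hP.gap_eq_zero_of_followsGains ht htT (hP.memLp_state g ht htT.le le_rfl hug)
      (hg t ht htT)
  rw [hP.cost_eq g hug hT, hP.cost_eq g' hu hT, hgap, ENNReal.ofReal_zero, add_zero,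
    value_one_congr hT g g']

lemma isOptimal_of_followsGains {g : S.Strategy}
    (hg : ∀ t, 1 ≤ t → t < T → P.FollowsGains μ T g t) : P.IsOptimal μ T g := by
  intro g'
  rcases eq_or_ne (P.cost μ T g') ⊤ with hcost | hcost
  · exact hcost ▸ le_top
  · rw [hP.cost_eq_add_gap hT hg fun t => hP.memLp_control_of_cost_lt_top g' hcost.lt_top]
    exact le_self_add

lemma followsGains_of_isOptimal {g : S.Strategy} (hopt : P.IsOptimal μ T g) {t : ℕ} (ht : 1 ≤ t)
    (htT : t < T) : P.FollowsGains μ T g t := by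
  obtain ⟨g₀, hg₀⟩ := P.exists_followsGains_lt μ (le_refl T)
  have hfin : P.cost μ T g₀ < ⊤ := hP.cost_lt_top_of_memLp hT fun t ht htT =>
    hP.memLp_of_followsGains ht hg₀ htT
  have hu (t : ℕ) := hP.memLp_control_of_cost_lt_top g ((hopt g₀).trans_lt hfin) (t := t)
  have hsum : ENNReal.ofReal (∑ t ∈ Finset.Ico 1 T, P.gap μ g T t) ≤ 0 := by
    refine (ENNReal.add_le_add_iff_left hfin.ne).1 ?_
    rw [add_zero, ← hP.cost_eq_add_gap hT hg₀ hu]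
    exact hopt g₀
  have hgap := (Finset.sum_eq_zero_iff_of_nonneg fun t _ => gap_nonneg g t).1
    ((ENNReal.ofReal_eq_zero.1 (nonpos_iff_eq_zero.1 hsum)).antisymm
      (Finset.sum_nonneg fun t _ => gap_nonneg g t)) t (Finset.mem_Ico.2 ⟨ht, htT⟩)
  exact hP.followsGains_of_gap_eq_zero ht htT (hP.memLp_state g ht htT.le le_rfl hu) (hu t ht htT)
    hgap

lemma isOptimal_iff (g : S.Strategy) :
    P.IsOptimal μ T g ↔ ∀ t, 1 ≤ t → t < T → P.FollowsGains μ T g t :=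
  ⟨fun hopt _ => hP.followsGains_of_isOptimal hT hopt, hP.isOptimal_of_followsGains hT⟩

lemma exists_isOptimal : ∃ g : S.Strategy, P.IsOptimal μ T g :=
  (P.exists_followsGains_lt μ (le_refl T)).imp fun _ => hP.isOptimal_of_followsGains hT

end Optimality

/-! ### The estimates in terms of the observed quantities -/

variable (g : S.Strategy) {t : ℕ} (ht : 1 ≤ t)

include ht

lemma estMajor_succ_observed (htT : t < T) (hx : Integrable (P.state g t) μ)
    (hu : Integrable (P.control g t) μ) :
    ∀ᵐ ω ∂μ, P.estMajor μ g (t + 1) ω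
      = S.A *ᵥ stackMM (comp (P.state g t ω) 0) (fun i => comp (P.estMajor μ g t ω) i.succ)
        + S.B *ᵥ stackMM (comp (P.control g t ω) 0)
            (fun i => comp (P.commonControl μ g t ω) i.succ)
        + stackMM (comp (P.state g (t + 1) ω) 0 - block S.A 0 0 *ᵥ comp (P.state g t ω) 0
            - block S.B 0 0 *ᵥ comp (P.control g t ω) 0) fun _ => 0 := by
  filter_upwards [hP.estMajor_succ g ht htT hx hu, hP.comp_estMajor_zero g ht htT.le hx,
    hP.comp_commonControl_zero g ht htT.le hu] with ω hsucc hstate hcontrol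
  have hnoise : comp (P.state g (t + 1) ω) 0 - block S.A 0 0 *ᵥ comp (P.state g t ω) 0
      - block S.B 0 0 *ᵥ comp (P.control g t ω) 0 = P.w 0 t ω := by
    rw [P.comp_state_succ_zero g ht]
    abel
  rw [hnoise, ← hstate, ← hcontrol, stackMM_comp, stackMM_comp, hsucc]

lemma estMinor_eq_integral (htT : t ≤ T) (i : Fin n) (hx : Integrable (P.state g t) μ)
    {f : S.InfoMinor i t → (Fin (S.dx i.succ) → ℝ) → ℝ≥0∞}
    (hf : IsCondDensity μ (fun ω => comp (P.state g t ω) i.succ) (P.infoMinor g i t) f) :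
    ∀ᵐ ω ∂μ, Integrable (fun x => (f (P.infoMinor g i t ω) x).toReal • x) volume ∧
      comp (P.estMinor μ g i t ω) i.succ = ∫ x, (f (P.infoMinor g i t ω) x).toReal • x := by
  filter_upwards [hf.condExp_eq_integral (integrable_comp hx i.succ)
    (hP.measurable_infoMinor g i ht htT), condExp_comp (m := P.sigmaMinor g i t) hx i.succ]
    with ω hdensity hcomp
  exact ⟨hdensity.1, hcomp.symm.trans hdensity.2⟩

end Admissible

end Primitives

end MajorMinor

end

theorem mainTheorem1 {n T : ℕ} (hT : 1 ≤ T) (S : MajorMinor.System n)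
    {Ω : Type*} [MeasurableSpace Ω] (μ : Measure Ω) [IsProbabilityMeasure μ]
    (P : MajorMinor.Primitives S Ω) (hP : P.Admissible T μ) :
    -- an optimal general strategy exists
    (∃ g : S.Strategy, P.IsOptimal μ T g) ∧
    -- a strategy is optimal if and only if its actions are given by the stated formulas
    (∀ g : S.Strategy, P.IsOptimal μ T g ↔ ∀ t, 1 ≤ t → t < T → ∀ᵐ ω ∂μ,
      MajorMinor.comp (P.control g t ω) 0
          = -(MajorMinor.blockRow (S.gainC T t) 0 *ᵥ P.estMajor μ g t ω) ∧
      ∀ i : Fin n, MajorMinor.comp (P.control g t ω) i.succ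
          = -(MajorMinor.blockRow (S.gainC T t) i.succ *ᵥ P.estMajor μ g t ω)
            - S.gainL T i t *ᵥ (MajorMinor.comp (P.estMinor μ g i t ω) i.succ
                - MajorMinor.comp (P.estMajor μ g t ω) i.succ)) ∧
    -- an optimal strategy has finite cost and square integrable actions, and its common
    -- control is `-L^c(t) x̂(t|c)`
    (∀ g : S.Strategy, P.IsOptimal μ T g → P.cost μ T g < ⊤ ∧
      ∀ t, 1 ≤ t → t < T → MemLp (P.control g t) 2 μ ∧
        ∀ᵐ ω ∂μ, P.commonControl μ g t ω = -(S.gainC T t *ᵥ P.estMajor μ g t ω)) ∧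
    -- the optimal strategy is unique: the control laws agree almost everywhere with respect to
    -- the law of the information, and the actions agree almost surely
    (∀ g g' : S.Strategy, P.IsOptimal μ T g → P.IsOptimal μ T g' →
      ∀ t, 1 ≤ t → t < T →
        P.control g t =ᵐ[μ] P.control g' t ∧
        g.major t =ᵐ[μ.map (P.infoMajor g t)] g'.major t ∧
        ∀ i : Fin n, g.minor i t =ᵐ[μ.map (P.infoMinor g i t)] g'.minor i t) ∧
    -- the linear recursion of the major agent's estimate, for every strategy with integrable
    -- actions
    (∀ g : S.Strategy, (∀ t, 1 ≤ t → t < T → Integrable (P.control g t) μ) →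
      (∀ᵐ ω ∂μ, P.estMajor μ g 1 ω
        = MajorMinor.stackMM (MajorMinor.comp (P.state g 1 ω) 0) fun _ => 0) ∧
      ∀ t, 1 ≤ t → t < T → ∀ᵐ ω ∂μ, P.estMajor μ g (t + 1) ω
        = S.A *ᵥ MajorMinor.stackMM (MajorMinor.comp (P.state g t ω) 0)
              (fun i => MajorMinor.comp (P.estMajor μ g t ω) i.succ)
          + S.B *ᵥ MajorMinor.stackMM (MajorMinor.comp (P.control g t ω) 0)
              (fun i => MajorMinor.comp (P.commonControl μ g t ω) i.succ)
          + MajorMinor.stackMM (MajorMinor.comp (P.state g (t + 1) ω) 0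
                - MajorMinor.block S.A 0 0 *ᵥ MajorMinor.comp (P.state g t ω) 0
                - MajorMinor.block S.B 0 0 *ᵥ MajorMinor.comp (P.control g t ω) 0)
              fun _ => 0) ∧
    -- the minor agent's estimate is the mean of the conditional density
    (∀ g : S.Strategy, (∀ t, 1 ≤ t → t < T → Integrable (P.control g t) μ) →
      ∀ (i : Fin n) (t : ℕ), 1 ≤ t → t ≤ T →
      ∀ f : S.InfoMinor i t → (Fin (S.dx i.succ) → ℝ) → ℝ≥0∞,
        MajorMinor.IsCondDensity μ (fun ω => MajorMinor.comp (P.state g t ω) i.succ)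
          (P.infoMinor g i t) f →
        ∀ᵐ ω ∂μ, Integrable (fun x => (f (P.infoMinor g i t ω) x).toReal • x) volume ∧
          MajorMinor.comp (P.estMinor μ g i t ω) i.succ
            = ∫ x, (f (P.infoMinor g i t ω) x).toReal • x) ∧
    -- the initial conditional density, for every strategy
    (∀ (g : S.Strategy) (i : Fin n) (ξ : (Fin (S.dx i.succ) → ℝ) → ℝ≥0∞)
      (ν : (Fin (S.dy i) → ℝ) → ℝ≥0∞),
      MajorMinor.HasDensity μ (P.init i.succ) ξ → MajorMinor.HasDensity μ (P.v i 1) ν →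
      MajorMinor.IsCondDensity μ (fun ω => MajorMinor.comp (P.state g 1 ω) i.succ)
        (P.infoMinor g i 1) (S.bayesInit i ξ ν)) ∧
    -- the Bayesian filter, for every strategy
    (∀ (g : S.Strategy) (i : Fin n) (t : ℕ) (ht : 1 ≤ t), t < T →
      ∀ (φ₀ : (Fin (S.dx 0) → ℝ) → ℝ≥0∞) (φ : (Fin (S.dx i.succ) → ℝ) → ℝ≥0∞)
        (ν : (Fin (S.dy i) → ℝ) → ℝ≥0∞),
      MajorMinor.HasDensity μ (P.w 0 t) φ₀ → MajorMinor.HasDensity μ (P.w i.succ t) φ →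
      MajorMinor.HasDensity μ (P.v i (t + 1)) ν →
      ∀ f : S.InfoMinor i t → (Fin (S.dx i.succ) → ℝ) → ℝ≥0∞,
        MajorMinor.IsCondDensity μ (fun ω => MajorMinor.comp (P.state g t ω) i.succ)
          (P.infoMinor g i t) f →
        MajorMinor.IsCondDensity μ (fun ω => MajorMinor.comp (P.state g (t + 1) ω) i.succ)
          (P.infoMinor g i (t + 1)) (S.bayesUpdate ht φ₀ φ ν f)) := by
  refine ⟨hP.exists_isOptimal hT, hP.isOptimal_iff hT, fun g hg => ?_, fun g g' hg hg' => ?_,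
    fun g hu => ⟨hP.estMajor_one g hT, fun t ht htT => hP.estMajor_succ_observed g ht htT
      (hP.integrable_state g ht htT.le hu) (hu t ht htT)⟩,
    fun g hu i t ht htT f hf => hP.estMinor_eq_integral g ht htT i
      (hP.integrable_state g ht htT hu) hf,
    fun g i ξ ν hξ hν => hP.isCondDensity_bayesInit g i hT hξ hν,
    fun g i t ht htT φ₀ φ ν hφ₀ hφ hν f hf =>
      hP.isCondDensity_bayesUpdate g i ht htT hφ₀ hφ hν hf⟩
  · have hgains := (hP.isOptimal_iff hT g).1 hg
    have hu := fun t (ht : 1 ≤ t) (htT : t < T) => hP.memLp_of_followsGains ht hgains htT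
    exact ⟨hP.cost_lt_top_of_memLp hT hu, fun t ht htT => ⟨hu t ht htT,
      hP.commonControl_of_followsGains ht htT (hP.memLp_state g ht htT.le le_rfl hu)
        (hgains t ht htT)⟩⟩
  · intro t ht htT
    have hcontrol := MajorMinor.Primitives.control_ae_eq_of_followsGains
      ((hP.isOptimal_iff hT g).1 hg) ((hP.isOptimal_iff hT g').1 hg')
    exact ⟨hcontrol t ht htT, hP.major_ae_eq ht htT hcontrol, hP.minor_ae_eq ht htT hcontrol⟩
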